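/- Let $n\ge 0$, $a>0$, and let $H:(-2a,2a)\to\mathbb C^{n\times n}$ be an even matrix function ($H(-t)=H(t)$ for almost every $t$) with entries in $L_1(-2a,2a)$. Suppose that for every $\xi\in(0,a]$ the equation $$q(t,\xi)+\int_{-\xi}^{\xi}H(t-s)\,q(s,\xi)\,ds=I,\qquad -\xi\le t\le\xi,$$ has a unique continuous matrix solution $q(\cdot,\xi)$, and that, with $M(\xi)=\int_0^\xi q(s,\xi)\,ds$, one has $\det M'(\xi)\ne0$ for all $\xi\in[0,a]$. Then $M$ is differentiable on $[0,a]$, for every $\xi\in(0,a]$ the transposed equation $$q^*(t,\xi)+\int_{-\xi}^{\xi}q^*(s,\xi)\,H(s-t)\,ds=I,\qquad -\xi\le t\le\xi,$$ also has a unique continuous matrix solution $q^*(\cdot,\xi)$, and for every continuous $f:[-a,a]\to\mathbb C^n$ the equation $$\phi(t)+\int_{-a}^{a}H(t-s)\,\phi(s)\,ds=f(t),\qquad -a\le t\le a,$$ has a unique continuous solution $\phi:[-a,a]\to\mathbb C^n$. It is given, for all $t\in[-a,a]$, by $$\phi(t)=\tfrac12\,q(t,a)\,F(a)-\tfrac12\int_{|t|}^{a}q(t,\xi)\,dF(\xi)-\tfrac12\,\frac{d}{dt}\int_{|t|}^{a}q(t,\xi)\,M'(\xi)^{-1}\Bigl(\int_{-\xi}^{\xi}q^*(s,\xi)\,df(s)\Bigr)d\xi,$$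 $$F(\xi)=M'(\xi)^{-1}\,\frac{d}{d\xi}\int_{-\xi}^{\xi}q^*(s,\xi)\,f(s)\,ds\qquad(0\le\xi\le a),$$ where all derivatives exist (one-sided at end points of the intervals), the integrals $\int q\,dF$ and $\int q^*\,df$ exist as Riemann–Stieltjes integrals, and the integral with respect to $d\xi$ is an ordinary Lebesgue integral. If $F$ is absolutely continuous on $[0,a]$, then $\int_{|t|}^{a}q(t,\xi)\,dF(\xi)=\int_{|t|}^{a}q(t,\xi)\,F'(\xi)\,d\xi$ for all $t\in[-a,a]$, the latter as a Lebesgue integral. -/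

import Mathlib

open Set MeasureTheory

open scoped Matrix

noncomputable section

/-- `Q` is a continuous matrix solution on `[-ξ, ξ]` of
`Q(t) + ∫_{-ξ}^{ξ} H(t - s) Q(s) ds = I`. The integral is taken entrywise. -/
def IsTruncatedSol {n : ℕ} (H : ℝ → Matrix (Fin n) (Fin n) ℂ) (ξ : ℝ)
    (Q : ℝ → Matrix (Fin n) (Fin n) ℂ) : Prop :=
  ContinuousOn Q (Icc (-ξ) ξ) ∧
    ∀ t ∈ Icc (-ξ) ξ, ∀ i j,
      Q t i j + ∫ s in (-ξ)..ξ, (H (t - s) * Q s) i j = (1 : Matrix (Fin n) (Fin n) ℂ) i j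

/-- `Q` is a continuous matrix solution on `[-ξ, ξ]` of the transposed ("starred") equation
`Q(t) + ∫_{-ξ}^{ξ} Q(s) H(s - t) ds = I`. -/
def IsTruncatedSolStar {n : ℕ} (H : ℝ → Matrix (Fin n) (Fin n) ℂ) (ξ : ℝ)
    (Q : ℝ → Matrix (Fin n) (Fin n) ℂ) : Prop :=
  ContinuousOn Q (Icc (-ξ) ξ) ∧
    ∀ t ∈ Icc (-ξ) ξ, ∀ i j,
      Q t i j + ∫ s in (-ξ)..ξ, (Q s * H (s - t)) i j = (1 : Matrix (Fin n) (Fin n) ℂ) i j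

/-- `φ` is a continuous vector solution on `[-a, a]` of
`φ(t) + ∫_{-a}^{a} H(t - s) φ(s) ds = f(t)`. -/
def IsSystemSol {n : ℕ} (H : ℝ → Matrix (Fin n) (Fin n) ℂ) (a : ℝ)
    (f φ : ℝ → Fin n → ℂ) : Prop :=
  ContinuousOn φ (Icc (-a) a) ∧
    ∀ t ∈ Icc (-a) a, φ t + ∫ s in (-a)..a, H (t - s) *ᵥ φ s = f t

/-- The Riemann–Stieltjes integral `∫_c^d g(s) dF(s)` (matrix times vector, `c ≤ d`) exists and
equals `L`: the sums `∑ g(τ_k) (F(x_{k+1}) - F(x_k))` over tagged partitions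
`c = x_0 ≤ τ_0 ≤ x_1 ≤ ⋯ ≤ x_N = d` converge to `L` as the mesh tends to zero. -/
def HasStieltjesIntegral {n : ℕ} (g : ℝ → Matrix (Fin n) (Fin n) ℂ) (F : ℝ → Fin n → ℂ)
    (c d : ℝ) (L : Fin n → ℂ) : Prop :=
  ∀ ε : ℝ, 0 < ε → ∃ δ : ℝ, 0 < δ ∧ ∀ (N : ℕ) (x τ : ℕ → ℝ), x 0 = c → x N = d →
    (∀ k < N, x k ≤ τ k ∧ τ k ≤ x (k + 1) ∧ x (k + 1) - x k < δ) →
      ‖(∑ k ∈ Finset.range N, g (τ k) *ᵥ (F (x (k + 1)) - F (x k))) - L‖ < ε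

/-- `M(ξ) = ∫_0^ξ q(s, ξ) ds`, entrywise. -/
def kreinM {n : ℕ} (q : ℝ → ℝ → Matrix (Fin n) (Fin n) ℂ) (ξ : ℝ) :
    Matrix (Fin n) (Fin n) ℂ :=
  Matrix.of fun i j => ∫ s in (0 : ℝ)..ξ, q s ξ i j

/-- The derivative `M'(ξ)` on `[0, a]` (one-sided at the end points), entrywise. -/
def kreinM' {n : ℕ} (a : ℝ) (q : ℝ → ℝ → Matrix (Fin n) (Fin n) ℂ) (ξ : ℝ) :
    Matrix (Fin n) (Fin n) ℂ :=
  Matrix.of fun i j => derivWithin (fun η => kreinM q η i j) (Icc 0 a) ξ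

/-- `∫_{-ξ}^{ξ} p(s, ξ) f(s) ds`. -/
def truncPairing {n : ℕ} (p : ℝ → ℝ → Matrix (Fin n) (Fin n) ℂ) (f : ℝ → Fin n → ℂ) (ξ : ℝ) :
    Fin n → ℂ :=
  ∫ s in (-ξ)..ξ, p s ξ *ᵥ f s

/-- `F(ξ) = M'(ξ)⁻¹ (d/dξ) ∫_{-ξ}^{ξ} p(s, ξ) f(s) ds` on `[0, a]`. -/
def kreinDensity {n : ℕ} (a : ℝ) (q p : ℝ → ℝ → Matrix (Fin n) (Fin n) ℂ)
    (f : ℝ → Fin n → ℂ) (ξ : ℝ) : Fin n → ℂ :=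
  (kreinM' a q ξ)⁻¹ *ᵥ derivWithin (truncPairing p f) (Icc 0 a) ξ

/-- `∫_{|t|}^{a} q(t, ξ) M'(ξ)⁻¹ S(ξ) dξ`. -/
def kreinPotential {n : ℕ} (a : ℝ) (q : ℝ → ℝ → Matrix (Fin n) (Fin n) ℂ)
    (S : ℝ → Fin n → ℂ) (t : ℝ) : Fin n → ℂ :=
  ∫ ξ in |t|..a, q t ξ *ᵥ ((kreinM' a q ξ)⁻¹ *ᵥ S ξ)

end

/-! ### Convolution of an even integrable kernel with bounded functions -/

noncomputable section

open Filter Topology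

/-! Let T(ξ) be the integral operator truncated to [-ξ, ξ], acting on C[-a, a], let R(ξ) = (1 +
T(ξ))⁻¹ and ψ_ξ = R(ξ) f. Unique solvability of the matrix equations makes 1 + T(ξ) injective; T(ξ)
is compact, so the inverse exists (`isUnit_one_add_op`, `regular_of_unique`), and it is norm
continuous in ξ. Transposing the integrals carries regularity over to the equation for q*
(`Regular.dual`). The solution sought is φ = ψ_a; what has to be proved is its representation
through q.

Pairing with q* turns data into boundary values of ψ_ξ. The pairing ∫ q* f equals ∫ ψ_ξ over [-ξ,
ξ], and its derivative in ξ is q*(ξ, ξ)(ψ_ξ(ξ) + ψ_ξ(-ξ)) (`Regular.hasDerivWithinAt_pairing`).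
Constant f gives M'(ξ) = q*(ξ, ξ) q(ξ, ξ). Hence q(ξ, ξ) is invertible and F(ξ) = q(ξ, ξ)⁻¹ (ψ_ξ(ξ)
+ ψ_ξ(-ξ)). Likewise ∫ q* df = q*(ξ, ξ)(ψ_ξ(ξ) - ψ_ξ(-ξ)) (`Regular.hasRSIntegral_dualSol`). The
factor q*(ξ, ξ) cancels against M'(ξ)⁻¹ in both terms, and evenness of the kernel lets the even and
odd parts of f be treated apart.

Even f: put c(ξ) = q(ξ, ξ)⁻¹ ψ_ξ(ξ). An increment of R(ξ) f depends on the solution near ±ξ only,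
where ψ_ξ and q(·, ξ) c(ξ) agree. Formally dψ_ξ(t) = dq(t, ξ) c(ξ), and summation by parts gives
ψ_a(t) = q(t, a) c(a) - ∫ q(t, ξ) dc(ξ). No bounded variation of c or of q in ξ is available; the
Stieltjes sums converge because the accumulated error of the local replacements is bounded by the
largest single one, uniformly over partitions (`Regular.exists_norm_shellSum_le`).

Odd f: the primitive W_ξ(t) = ∫_t^ξ ψ_ξ vanishes at both ends ±ξ, extends by zero, and solves the
truncated equation with right-hand side a constant minus a primitive of f. Enlarging ξ therefore
changes W_ξ by q(t, ξ) times a constant vector, up to o(h), and evaluation at t = ξ shows that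
vector to be h q(ξ, ξ)⁻¹ ψ_ξ(ξ) + o(h). Integrating in ξ and differentiating in t gives the last
term of the formula (`Regular.hasDerivWithinAt_solPrimitive`). -/

/-- An even integrable kernel with values in the continuous endomorphisms of `E`. -/
structure EvenKernel (E : Type*) [NormedAddCommGroup E] [NormedSpace ℂ E] where
  toFun : ℝ → E →L[ℂ] E
  integrable : Integrable toFun
  even : ∀ t, toFun (-t) = toFun t

/-- `u` is a.e. strongly measurable and bounded in norm by `C`. -/
structure BddMeas {E : Type*} [NormedAddCommGroup E] (u : ℝ → E) (C : ℝ) : Prop where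
  aesm : AEStronglyMeasurable u volume
  bound : ∀ s, ‖u s‖ ≤ C

namespace BddMeas

variable {E : Type*} [NormedAddCommGroup E] {u v : ℝ → E} {C D : ℝ}

theorem nonneg (hu : BddMeas u C) : 0 ≤ C := (norm_nonneg _).trans (hu.bound 0)

theorem indicator (hu : BddMeas u C) {s : Set ℝ} (hs : MeasurableSet s) :
    BddMeas (s.indicator u) C :=
  ⟨hu.aesm.indicator hs, fun t => (norm_indicator_le_norm_self u t).trans (hu.bound t)⟩

theorem add (hu : BddMeas u C) (hv : BddMeas v D) : BddMeas (fun s => u s + v s) (C + D) :=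
  ⟨hu.aesm.add hv.aesm, fun s => norm_add_le_of_le (hu.bound s) (hv.bound s)⟩

theorem sub (hu : BddMeas u C) (hv : BddMeas v D) : BddMeas (fun s => u s - v s) (C + D) :=
  ⟨hu.aesm.sub hv.aesm, fun s => norm_sub_le_of_le (hu.bound s) (hv.bound s)⟩

theorem integrableOn (hu : BddMeas u C) {s : Set ℝ} (hs : volume s ≠ ⊤) :
    IntegrableOn u s := by
  have : IsFiniteMeasure (volume.restrict s) :=
    ⟨by rw [Measure.restrict_apply_univ]; exact hs.lt_top⟩
  exact Integrable.of_bound hu.aesm.restrict C (ae_of_all _ hu.bound)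

theorem integrable_indicator (hu : BddMeas u C) {s : Set ℝ} (hm : MeasurableSet s)
    (hs : volume s ≠ ⊤) : Integrable (s.indicator u) :=
  (integrable_indicator_iff hm).2 (hu.integrableOn hs)

theorem mono (hu : BddMeas u C) (h : C ≤ D) : BddMeas u D :=
  ⟨hu.aesm, fun s => (hu.bound s).trans h⟩

end BddMeas

namespace EvenKernel

variable {E : Type*} [NormedAddCommGroup E] [NormedSpace ℂ E] (k : EvenKernel E)

/-- The `L¹` norm of the kernel. -/
def mass : ℝ := ∫ t, ‖k.toFun t‖

/-- The convolution `∫ k(t - s) u(s) ds`. -/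
def conv (u : ℝ → E) (t : ℝ) : E := ∫ s, k.toFun (t - s) (u s)

theorem mass_nonneg : 0 ≤ k.mass := integral_nonneg fun _ => norm_nonneg _

variable {k} in
theorem even_sub (t s : ℝ) : k.toFun (t - s) = k.toFun (s - t) := by
  rw [← k.even (s - t), neg_sub]

theorem integrable_sub (t : ℝ) : Integrable fun s => k.toFun (t - s) :=
  k.integrable.comp_sub_left t

theorem integrable_norm_sub (t : ℝ) : Integrable fun s => ‖k.toFun (t - s)‖ :=
  (k.integrable_sub t).norm

theorem integral_norm_sub (t : ℝ) : ∫ s, ‖k.toFun (t - s)‖ = k.mass :=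
  integral_sub_left_eq_self (fun s => ‖k.toFun s‖) volume t

theorem aesm_apply {f : ℝ → E →L[ℂ] E} {u : ℝ → E} {μ : Measure ℝ} (hf : AEStronglyMeasurable f μ)
    (hu : AEStronglyMeasurable u μ) : AEStronglyMeasurable (fun s => f s (u s)) μ :=
  (ContinuousLinearMap.id ℂ (E →L[ℂ] E)).aestronglyMeasurable_comp₂ hf hu

variable {k} {u v : ℝ → E} {C D : ℝ}

theorem norm_apply_le (hu : BddMeas u C) (t s : ℝ) :
    ‖k.toFun (t - s) (u s)‖ ≤ ‖k.toFun (t - s)‖ * C :=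
  (ContinuousLinearMap.le_opNorm _ _).trans
    (mul_le_mul_of_nonneg_left (hu.bound s) (norm_nonneg _))

theorem integrable_apply (hu : BddMeas u C) (t : ℝ) :
    Integrable fun s => k.toFun (t - s) (u s) :=
  ((k.integrable_norm_sub t).mul_const C).mono'
    (aesm_apply (k.integrable_sub t).aestronglyMeasurable hu.aesm)
    (ae_of_all _ fun s => norm_apply_le hu t s)

theorem norm_conv_le (hu : BddMeas u C) (t : ℝ) : ‖k.conv u t‖ ≤ k.mass * C := by
  refine (norm_integral_le_of_norm_le ((k.integrable_norm_sub t).mul_const C)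
    (ae_of_all _ fun s => norm_apply_le hu t s)).trans_eq ?_
  rw [integral_mul_const, k.integral_norm_sub]

theorem conv_add (hu : BddMeas u C) (hv : BddMeas v D) (t : ℝ) :
    k.conv (fun s => u s + v s) t = k.conv u t + k.conv v t := by
  simp only [conv, map_add]
  exact integral_add (integrable_apply hu t) (integrable_apply hv t)

theorem conv_sub (hu : BddMeas u C) (hv : BddMeas v D) (t : ℝ) :
    k.conv (fun s => u s - v s) t = k.conv u t - k.conv v t := by
  simp only [conv, map_sub]
  exact integral_sub (integrable_apply hu t) (integrable_apply hv t)

theorem conv_smul (c : ℂ) (u : ℝ → E) (t : ℝ) :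
    k.conv (fun s => c • u s) t = c • k.conv u t := by
  simp only [conv, map_smul]
  exact integral_smul c _

theorem conv_congr {u v : ℝ → E} (h : u =ᵐ[volume] v) (t : ℝ) : k.conv u t = k.conv v t :=
  integral_congr_ae (h.mono fun s hs => by simp only [hs])

variable (k) in
/-- Continuity of translations in `L¹`. -/
theorem exists_integral_translate_lt {ε : ℝ} (hε : 0 < ε) :
    ∃ δ > 0, ∀ t t' : ℝ, |t - t'| < δ →
      ∫ s, ‖k.toFun (t - s) - k.toFun (t' - s)‖ < ε := by
  have hm : ∀ h : ℝ, MeasurePreserving (fun x : ℝ => x + h) volume volume :=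
    fun h => measurePreserving_add_right volume h
  let g : ℝ → C(ℝ, ℝ) := fun h => ⟨fun x => x + h, by fun_prop⟩
  have hg : Continuous g := by
    refine ContinuousMap.continuous_of_continuous_uncurry _ ?_
    change Continuous fun p : ℝ × ℝ => p.2 + p.1
    fun_prop
  let A : Lp (E →L[ℂ] E) 1 (volume : Measure ℝ) := k.integrable.toL1 k.toFun
  -- Only continuity at the zero translation is needed: invariance of Lebesgue measure reduces the
  -- pair `t`, `t'` to `t - t'`.
  have hc := (continuous_const (y := A)).compMeasurePreservingLp hg hm ENNReal.one_ne_top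
  obtain ⟨δ, hδ, h⟩ := Metric.continuousAt_iff.1 (hc.continuousAt (x := (0 : ℝ))) ε hε
  refine ⟨δ, hδ, fun t t' htt => ?_⟩
  have h1 := h (x := t - t') (by simpa [Real.dist_eq] using htt)
  rw [dist_eq_norm, L1.norm_eq_integral_norm] at h1
  have e : ∀ h : ℝ, (Lp.compMeasurePreserving (g h) (hm h) A : ℝ → E →L[ℂ] E)
      =ᵐ[volume] fun x => k.toFun (x + h) := fun h => by
    refine (Lp.coeFn_compMeasurePreserving A (hm h)).trans ?_
    exact (hm h).quasiMeasurePreserving.ae_eq_comp (Integrable.coeFn_toL1 k.integrable)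
  have h2 : ∫ x, ‖k.toFun (x + (t - t')) - k.toFun x‖ < ε := by
    refine lt_of_eq_of_lt (integral_congr_ae ?_) h1
    filter_upwards [e (t - t'), e 0, Lp.coeFn_sub (Lp.compMeasurePreserving (g (t - t')) (hm _) A)
      (Lp.compMeasurePreserving (g 0) (hm 0) A)] with x h3 h4 h5
    rw [h5, Pi.sub_apply, h3, h4, add_zero]
  rw [← integral_sub_left_eq_self (fun x => ‖k.toFun (x + (t - t')) - k.toFun x‖) volume t'] at h2
  refine lt_of_eq_of_lt (integral_congr_ae (ae_of_all _ fun s => ?_)) h2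
  simp only
  congr 3
  ring

-- The modulus depends on the kernel only, so convolutions of a bounded family are equicontinuous.
-- Compactness uses this, and so do the boundary layers, where the function convolved varies with
-- the parameter.
variable (k) in
theorem exists_norm_conv_sub_le {ε : ℝ} (hε : 0 < ε) :
    ∃ δ > 0, ∀ t t' : ℝ, |t - t'| < δ → ∀ (u : ℝ → E) (C : ℝ), BddMeas u C →
      ‖k.conv u t - k.conv u t'‖ ≤ ε * C := by
  obtain ⟨δ, hδ, h⟩ := k.exists_integral_translate_lt hε
  refine ⟨δ, hδ, fun t t' htt u C hu => ?_⟩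
  rw [conv, conv, ← integral_sub (integrable_apply hu t) (integrable_apply hu t')]
  have hi : Integrable fun s => ‖k.toFun (t - s) - k.toFun (t' - s)‖ :=
    ((k.integrable_sub t).sub (k.integrable_sub t')).norm
  refine (norm_integral_le_of_norm_le (hi.mul_const C) (ae_of_all _ fun s => ?_)).trans ?_
  · rw [← _root_.sub_apply]
    exact (ContinuousLinearMap.le_opNorm _ _).trans
      (mul_le_mul_of_nonneg_left (hu.bound s) (norm_nonneg _))
  · rw [integral_mul_const]
    exact mul_le_mul_of_nonneg_right (h t t' htt).le hu.nonneg

theorem continuous_conv (hu : BddMeas u C) : Continuous (k.conv u) := by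
  refine Metric.continuous_iff.2 fun t ε hε => ?_
  have hC : 0 < C + 1 := by linarith [hu.nonneg]
  obtain ⟨δ, hδ, h⟩ := k.exists_norm_conv_sub_le (div_pos hε hC)
  refine ⟨δ, hδ, fun t' ht => ?_⟩
  rw [dist_eq_norm]
  refine (h t' t (by rwa [Real.dist_eq] at ht) u C hu).trans_lt ?_
  rw [div_mul_eq_mul_div, div_lt_iff₀ hC]
  nlinarith [hu.nonneg]

theorem conv_neg_arg (u : ℝ → E) (t : ℝ) : k.conv u (-t) = k.conv (fun s => u (-s)) t := by
  rw [conv, ← integral_neg_eq_self, conv]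
  refine integral_congr_ae (ae_of_all _ fun s => ?_)
  simp only
  rw [← k.even (t - s)]
  congr 2
  ring

variable (k) in
/-- Absolute continuity of the integral of the kernel, uniformly in translations. -/
theorem exists_setIntegral_norm_le {ε : ℝ} (hε : 0 < ε) :
    ∃ δ > 0, ∀ (S : Set ℝ), MeasurableSet S → volume S < ENNReal.ofReal δ → ∀ t : ℝ,
      ∫ s in S, ‖k.toFun (t - s)‖ ≤ ε := by
  obtain ⟨δ, hδ, h⟩ := exists_pos_setLIntegral_lt_of_measure_lt (μ := volume)
    (f := fun s => ‖k.toFun s‖ₑ) k.integrable.2.ne (ε := ENNReal.ofReal ε) (by simpa using hε)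
  obtain ⟨δ', hδ', hlt⟩ : ∃ δ' > 0, ENNReal.ofReal δ' < δ := by
    rcases eq_or_ne δ ⊤ with rfl | htop
    · exact ⟨1, one_pos, ENNReal.ofReal_lt_top⟩
    · have : 0 < δ.toReal := ENNReal.toReal_pos hδ.ne' htop
      refine ⟨δ.toReal / 2, by positivity, ?_⟩
      rw [ENNReal.ofReal_lt_iff_lt_toReal (by positivity) htop]
      linarith
  refine ⟨δ', hδ', fun S hS hvol t => ?_⟩
  have hmp : MeasurePreserving (fun s : ℝ => t - s) volume volume :=
    Measure.measurePreserving_sub_left volume t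
  have h1 := h ((fun s => t - s) ⁻¹' S) (by
    rw [hmp.measure_preimage hS.nullMeasurableSet]; exact hvol.trans hlt)
  have h2 : ∫⁻ s in S, ‖k.toFun (t - s)‖ₑ
      = ∫⁻ x in (fun s => t - s) ⁻¹' S, ‖k.toFun x‖ₑ := by
    have := hmp.setLIntegral_comp_preimage_emb (MeasurableEquiv.subLeft t).measurableEmbedding
      (fun x => ‖k.toFun x‖ₑ) ((fun s => t - s) ⁻¹' S)
    rw [← this]
    congr 2
    ext s
    simp
  rw [integral_norm_eq_lintegral_enorm (k.integrable_sub t).aestronglyMeasurable.restrict, h2]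
  exact ENNReal.toReal_le_of_le_ofReal hε.le h1.le

end EvenKernel

/-! ### Continuous functions on [-a, a], shells and clamped parameters -/

/-- Continuous functions on `[-a, a]`. -/
abbrev SymmC (a : ℝ) (E : Type*) [TopologicalSpace E] : Type _ := C(Icc (-a) a, E)

namespace SymmC

variable {a : ℝ} {E : Type*}

open Classical in
/-- The restriction to `[-a, a]` of a continuous function (zero if it is not continuous). -/
def ofFun (a : ℝ) [TopologicalSpace E] [Zero E] (f : ℝ → E) : SymmC a E :=
  if h : Continuous f then ⟨fun t => f t, h.comp continuous_subtype_val⟩ else 0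

theorem ofFun_apply [TopologicalSpace E] [Zero E] {f : ℝ → E} (hf : Continuous f)
    (t : Icc (-a) a) : ofFun a f t = f t := by
  rw [ofFun, dif_pos hf]
  rfl

variable [ha : Fact (0 < a)]

theorem neg_le_self (a : ℝ) [ha : Fact (0 < a)] : -a ≤ a := by linarith [ha.out]

/-- The extension of a function on `[-a, a]` to the line by its end values. -/
def extend [TopologicalSpace E] (u : SymmC a E) : ℝ → E := IccExtend (neg_le_self a) u

theorem continuous_extend [TopologicalSpace E] (u : SymmC a E) : Continuous u.extend :=
  u.continuous.Icc_extend'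

theorem extend_apply [TopologicalSpace E] (u : SymmC a E) {t : ℝ} (ht : t ∈ Icc (-a) a) :
    u.extend t = u ⟨t, ht⟩ := IccExtend_of_mem _ _ ht

theorem extend_coe [TopologicalSpace E] (u : SymmC a E) (t : Icc (-a) a) :
    u.extend t = u t := IccExtend_val _ _ t

theorem extend_ofFun [TopologicalSpace E] [Zero E] {f : ℝ → E} (hf : Continuous f) {t : ℝ}
    (ht : t ∈ Icc (-a) a) : (ofFun a f).extend t = f t := by
  rw [extend_apply _ ht, ofFun_apply hf]

variable [NormedAddCommGroup E]

theorem bddMeas_extend (u : SymmC a E) : BddMeas u.extend ‖u‖ :=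
  ⟨u.continuous_extend.aestronglyMeasurable, fun _ => u.norm_coe_le_norm _⟩

theorem norm_extend_le (u : SymmC a E) (t : ℝ) : ‖u.extend t‖ ≤ ‖u‖ := u.bddMeas_extend.bound t

theorem extend_add (u v : SymmC a E) : (u + v).extend = fun s => u.extend s + v.extend s := rfl

theorem extend_sub (u v : SymmC a E) : (u - v).extend = fun s => u.extend s - v.extend s := rfl

theorem extend_neg (u : SymmC a E) : (-u).extend = fun s => -u.extend s := rfl

theorem extend_smul [NormedSpace ℂ E] (c : ℂ) (u : SymmC a E) :
    (c • u).extend = fun s => c • u.extend s := rfl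

theorem extend_const (x : E) (t : ℝ) :
    SymmC.extend (ContinuousMap.const (Icc (-a) a) x) t = x := rfl

theorem continuous_extend_uncurry {X : Type*} [TopologicalSpace X] {f : X → SymmC a E}
    {g : X → ℝ} (hf : Continuous f) (hg : Continuous g) :
    Continuous fun x => (f x).extend (g x) := by
  change Continuous fun x => (f x) (projIcc (-a) a (neg_le_self a) (g x))
  have : Continuous fun x => projIcc (-a) a (neg_le_self a) (g x) := continuous_projIcc.comp hg
  fun_prop

end SymmC

/-- The shell `{ξ < |s| ≤ ξ'}` up to end points. -/
def shell (ξ ξ' : ℝ) : Set ℝ := Ioc (-ξ') ξ' \ Ioc (-ξ) ξ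

theorem measurableSet_shell (ξ ξ' : ℝ) : MeasurableSet (shell ξ ξ') :=
  measurableSet_Ioc.diff measurableSet_Ioc

theorem volume_shell {ξ ξ' : ℝ} (h0 : 0 ≤ ξ) (h : ξ ≤ ξ') :
    volume (shell ξ ξ') = ENNReal.ofReal (2 * (ξ' - ξ)) := by
  rw [shell, measure_sdiff (Ioc_subset_Ioc (by linarith) h) measurableSet_Ioc.nullMeasurableSet
    (by simp), Real.volume_Ioc, Real.volume_Ioc, ← ENNReal.ofReal_sub _ (by linarith)]
  congr 1
  ring

theorem shell_subset (ξ ξ' : ℝ) : shell ξ ξ' ⊆ Ioc (-ξ') ξ' := sdiff_subset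

theorem abs_mem_of_mem_shell {ξ ξ' s : ℝ} (hs : s ∈ shell ξ ξ') : |s| ∈ Icc ξ ξ' := by
  obtain ⟨⟨h1, h2⟩, h3⟩ := hs
  refine ⟨?_, abs_le.2 ⟨h1.le, h2⟩⟩
  by_contra! h4
  exact h3 ⟨(abs_lt.1 h4).1, (abs_lt.1 h4).2.le⟩

/-- The nearest point of `[0, a]`. -/
def clampIcc (a ξ : ℝ) : ℝ := max 0 (min ξ a)

theorem continuous_clampIcc (a : ℝ) : Continuous (clampIcc a) := by unfold clampIcc; fun_prop

theorem clampIcc_mem {a : ℝ} (ha : 0 ≤ a) (ξ : ℝ) : clampIcc a ξ ∈ Icc 0 a :=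
  ⟨le_max_left _ _, max_le ha (min_le_right _ _)⟩

theorem clampIcc_of_mem {a ξ : ℝ} (h : ξ ∈ Icc 0 a) : clampIcc a ξ = ξ := by
  rw [clampIcc, min_eq_left h.2, max_eq_right h.1]

/-- Ordered pairs suffice; for them the difference of two truncations is an integral over a shell.
-/
theorem continuousOn_Ici_of_increments {F : Type*} [NormedAddCommGroup F] {f : ℝ → F}
    (hf : ∀ ε > 0, ∃ δ > 0, ∀ ξ ξ', 0 ≤ ξ → ξ ≤ ξ' → ξ' - ξ < δ → ‖f ξ' - f ξ‖ ≤ ε) :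
    ContinuousOn f (Ici 0) := by
  refine Metric.continuousOn_iff.2 fun ξ hξ ε hε => ?_
  obtain ⟨δ, hδ, h⟩ := hf _ (half_pos hε)
  refine ⟨δ, hδ, fun ξ' hξ' hd => lt_of_le_of_lt ?_ (half_lt_self hε)⟩
  rw [Real.dist_eq] at hd
  rcases le_total ξ ξ' with h1 | h1
  · rw [dist_eq_norm]
    exact h ξ ξ' hξ h1 ((le_abs_self _).trans_lt hd)
  · rw [dist_comm, dist_eq_norm]
    exact h ξ' ξ hξ' h1 ((le_abs_self _).trans_lt (by rwa [abs_sub_comm]))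

/-! ### Truncated operators: continuity in the parameter, compactness, Fredholm alternative -/

namespace EvenKernel

variable {E : Type*} [NormedAddCommGroup E] [NormedSpace ℂ E] {k : EvenKernel E} {u v : ℝ → E}
  {C D : ℝ}

theorem norm_conv_indicator_le {S : Set ℝ} (hS : MeasurableSet S) (hu : ∀ s ∈ S, ‖u s‖ ≤ C)
    (t : ℝ) : ‖k.conv (S.indicator u) t‖ ≤ (∫ s in S, ‖k.toFun (t - s)‖) * C := by
  rw [← integral_mul_const, ← integral_indicator hS]
  refine norm_integral_le_of_norm_le
    (((k.integrable_norm_sub t).mul_const C).indicator hS) (ae_of_all _ fun s => ?_)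
  by_cases h : s ∈ S
  · rw [indicator_of_mem h, indicator_of_mem h]
    exact (ContinuousLinearMap.le_opNorm _ _).trans
      (mul_le_mul_of_nonneg_left (hu s h) (norm_nonneg _))
  · rw [indicator_of_notMem h, indicator_of_notMem h, map_zero, norm_zero]

variable (k) in
/-- The truncated convolution `∫_{-ξ}^{ξ} k(t - s) u(s) ds`. -/
def truncConv (ξ : ℝ) (u : ℝ → E) : ℝ → E := k.conv ((Ioc (-ξ) ξ).indicator u)

theorem continuous_truncConv (hu : BddMeas u C) (ξ : ℝ) : Continuous (k.truncConv ξ u) :=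
  continuous_conv (hu.indicator measurableSet_Ioc)

theorem norm_truncConv_le (hu : BddMeas u C) (ξ t : ℝ) : ‖k.truncConv ξ u t‖ ≤ k.mass * C :=
  norm_conv_le (hu.indicator measurableSet_Ioc) t

theorem truncConv_add (hu : BddMeas u C) (hv : BddMeas v D) (ξ t : ℝ) :
    k.truncConv ξ (fun s => u s + v s) t = k.truncConv ξ u t + k.truncConv ξ v t := by
  rw [truncConv, truncConv, truncConv, ← conv_add (hu.indicator measurableSet_Ioc)
    (hv.indicator measurableSet_Ioc)]
  congr 1
  exact indicator_add _ u v

theorem truncConv_sub (hu : BddMeas u C) (hv : BddMeas v D) (ξ t : ℝ) :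
    k.truncConv ξ (fun s => u s - v s) t = k.truncConv ξ u t - k.truncConv ξ v t := by
  rw [truncConv, truncConv, truncConv, ← conv_sub (hu.indicator measurableSet_Ioc)
    (hv.indicator measurableSet_Ioc)]
  congr 1
  exact indicator_sub _ u v

theorem truncConv_smul (c : ℂ) (u : ℝ → E) (ξ t : ℝ) :
    k.truncConv ξ (fun s => c • u s) t = c • k.truncConv ξ u t := by
  rw [truncConv, truncConv, ← conv_smul]
  congr 1
  exact indicator_const_smul _ c u

theorem truncConv_congr {ξ : ℝ} (h : ∀ s ∈ Ioc (-ξ) ξ, u s = v s) :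
    k.truncConv ξ u = k.truncConv ξ v := by
  rw [truncConv, truncConv, indicator_congr h]

theorem truncConv_sub_truncConv (hu : BddMeas u C) {ξ ξ' : ℝ} (h : ξ ≤ ξ') (t : ℝ) :
    k.truncConv ξ' u t - k.truncConv ξ u t = k.conv ((shell ξ ξ').indicator u) t := by
  rw [truncConv, truncConv, ← conv_sub (hu.indicator measurableSet_Ioc)
    (hu.indicator measurableSet_Ioc)]
  congr 1
  rw [shell, indicator_sdiff (Ioc_subset_Ioc (by linarith) h)]
  rfl

theorem truncConv_zero (u : ℝ → E) (t : ℝ) : k.truncConv 0 u t = 0 := by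
  simp [truncConv, conv]

variable {a : ℝ} [ha : Fact (0 < a)]

variable (k a) in
/-- The operator `u ↦ ∫_{-ξ}^{ξ} k(t - s) u(s) ds` on `C[-a, a]`. -/
def op (ξ : ℝ) : SymmC a E →L[ℂ] SymmC a E :=
  LinearMap.mkContinuous
    -- Integration runs over [-ξ, ξ] but `t` over all of [-a, a]. All truncations thus act on one
    -- space, and solutions are continued beyond [-ξ, ξ] by the equation itself.
    { toFun := fun u => SymmC.ofFun a (k.truncConv ξ u.extend)
      map_add' := fun u v => by
        ext t
        rw [SymmC.extend_add, ContinuousMap.add_apply,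
          SymmC.ofFun_apply (continuous_truncConv (u.bddMeas_extend.add v.bddMeas_extend) ξ),
          SymmC.ofFun_apply (continuous_truncConv u.bddMeas_extend ξ),
          SymmC.ofFun_apply (continuous_truncConv v.bddMeas_extend ξ),
          truncConv_add u.bddMeas_extend v.bddMeas_extend]
      map_smul' := fun c u => by
        ext t
        rw [ContinuousMap.smul_apply,
          SymmC.ofFun_apply (continuous_truncConv (c • u).bddMeas_extend ξ),
          SymmC.ofFun_apply (continuous_truncConv u.bddMeas_extend ξ), SymmC.extend_smul,
          truncConv_smul, RingHom.id_apply] }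
    k.mass fun u => by
      refine (ContinuousMap.norm_le _ (mul_nonneg k.mass_nonneg (norm_nonneg _))).2 fun t => ?_
      change ‖SymmC.ofFun a (k.truncConv ξ u.extend) t‖ ≤ _
      rw [SymmC.ofFun_apply (continuous_truncConv u.bddMeas_extend ξ)]
      exact norm_truncConv_le u.bddMeas_extend ξ t

theorem op_eq (ξ : ℝ) (u : SymmC a E) : k.op a ξ u = SymmC.ofFun a (k.truncConv ξ u.extend) := rfl

theorem op_apply (ξ : ℝ) (u : SymmC a E) (t : Icc (-a) a) :
    k.op a ξ u t = k.truncConv ξ u.extend t := by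
  rw [op_eq, SymmC.ofFun_apply (continuous_truncConv u.bddMeas_extend ξ)]

theorem extend_op (ξ : ℝ) (u : SymmC a E) {t : ℝ} (ht : t ∈ Icc (-a) a) :
    (k.op a ξ u).extend t = k.truncConv ξ u.extend t := by
  rw [SymmC.extend_apply _ ht, op_apply]

theorem op_sub_op_apply {ξ ξ' : ℝ} (h : ξ ≤ ξ') (u : SymmC a E) (t : Icc (-a) a) :
    (k.op a ξ' - k.op a ξ) u t = k.conv ((shell ξ ξ').indicator u.extend) t := by
  rw [_root_.sub_apply, ContinuousMap.sub_apply, op_apply, op_apply,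
    truncConv_sub_truncConv u.bddMeas_extend h]

/-- Only the values of `u` on the shell enter the bound. The error estimate for the Stieltjes sums
relies on this. -/
theorem norm_op_sub_apply_le {ξ ξ' : ℝ} (h : ξ ≤ ξ') (u : SymmC a E)
    (hu : ∀ s ∈ shell ξ ξ', ‖u.extend s‖ ≤ C) (t : Icc (-a) a) :
    ‖(k.op a ξ' - k.op a ξ) u t‖ ≤ (∫ s in shell ξ ξ', ‖k.toFun (t - s)‖) * C := by
  rw [op_sub_op_apply h]
  exact norm_conv_indicator_le (measurableSet_shell _ _) hu t

variable (k a) in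
theorem exists_norm_op_sub_le {ε : ℝ} (hε : 0 < ε) :
    ∃ δ > 0, ∀ ξ ξ', 0 ≤ ξ → ξ ≤ ξ' → ξ' - ξ < δ → ‖k.op a ξ' - k.op a ξ‖ ≤ ε := by
  obtain ⟨δ, hδ, h⟩ := k.exists_setIntegral_norm_le hε
  refine ⟨δ / 2, by positivity, fun ξ ξ' h0 h1 h2 =>
    ContinuousLinearMap.opNorm_le_bound _ hε.le fun u =>
      (ContinuousMap.norm_le _ (by positivity)).2 fun t =>
        (norm_op_sub_apply_le h1 u (fun s _ => u.norm_extend_le s) t).trans ?_⟩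
  refine mul_le_mul_of_nonneg_right (h _ (measurableSet_shell _ _) ?_ t) (norm_nonneg _)
  rw [volume_shell h0 h1]
  exact (ENNReal.ofReal_lt_ofReal_iff hδ).2 (by linarith)

variable (k a) in
theorem continuous_op_clamp : Continuous fun ξ => k.op a (clampIcc a ξ) := by
  have h : ContinuousOn (fun ξ : ℝ => k.op a ξ) (Ici 0) :=
    continuousOn_Ici_of_increments (F := SymmC a E →L[ℂ] SymmC a E) fun ε hε =>
      k.exists_norm_op_sub_le a hε
  exact h.comp_continuous (continuous_clampIcc a) fun ξ => (clampIcc_mem ha.out.le ξ).1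

theorem op_zero : k.op a 0 = 0 := by
  ext u t
  rw [op_apply, truncConv_zero]
  rfl

-- Arzelà–Ascoli: the image of the unit ball is bounded by the mass of the kernel and equicontinuous
-- by continuity of translations in L¹.
variable (k a) in
theorem isCompactOperator_op [ProperSpace E] (ξ : ℝ) : IsCompactOperator (k.op a ξ) := by
  refine (isCompactOperator_iff_image_closedBall_subset_compact
    (k.op a ξ : SymmC a E →ₗ[ℂ] SymmC a E) one_pos).2 ?_
  set S : Set (SymmC a E) := k.op a ξ '' Metric.closedBall 0 1 with hS
  have hbd : ∀ u ∈ Metric.closedBall (0 : SymmC a E) 1, ‖u‖ ≤ 1 := fun u hu => by simpa using hu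
  have hcpt := BoundedContinuousFunction.arzela_ascoli (Metric.closedBall (0 : E) k.mass)
    (isCompact_closedBall _ _) (BoundedContinuousFunction.mkOfCompact '' S) (by
      rintro _ t ⟨_, ⟨u, hu, rfl⟩, rfl⟩
      rw [mem_closedBall_zero_iff]
      change ‖k.op a ξ u t‖ ≤ _
      rw [op_apply]
      refine (norm_truncConv_le u.bddMeas_extend ξ t).trans ?_
      exact mul_le_of_le_one_right k.mass_nonneg (hbd u hu)) (by
      refine fun t => Metric.equicontinuousAt_iff.2 fun ε hε => ?_
      obtain ⟨δ, hδ, h⟩ := k.exists_norm_conv_sub_le (half_pos hε)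
      refine ⟨δ, hδ, ?_⟩
      rintro t' ht ⟨_, _, ⟨u, hu, rfl⟩, rfl⟩
      change dist (k.op a ξ u t) (k.op a ξ u t') < ε
      rw [dist_eq_norm, op_apply, op_apply]
      refine (h t t' ?_ _ _ (u.bddMeas_extend.indicator measurableSet_Ioc)).trans_lt ?_
      · rw [abs_sub_comm]
        exact ht
      · nlinarith [hbd u hu, norm_nonneg u])
  refine ⟨(ContinuousMap.linearIsometryBoundedOfCompact (Icc (-a) a) E ℂ).symm '' closure
    (BoundedContinuousFunction.mkOfCompact '' S), hcpt.image (LinearIsometryEquiv.continuous _), ?_⟩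
  intro w hw
  exact ⟨_, subset_closure ⟨w, hw, rfl⟩, by ext; rfl⟩

/-- Fredholm alternative: for a compact operator, -1 is an eigenvalue or lies in the resolvent set.
-/
theorem isUnit_one_add_op [ProperSpace E] {ξ : ℝ} (h : ∀ u, u + k.op a ξ u = 0 → u = 0) :
    IsUnit (1 + k.op a ξ) := by
  have : CompleteSpace E := inferInstance
  rcases (k.isCompactOperator_op a ξ).hasEigenvalue_or_mem_resolventSet
    (μ := -1) (by simp) with h1 | h1
  · obtain ⟨u, hu⟩ := h1.exists_hasEigenvector
    refine absurd (h u ?_) hu.2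
    have := hu.apply_eq_smul
    rw [ContinuousLinearMap.coe_coe] at this
    rw [this]
    simp
  · rw [spectrum.mem_resolventSet_iff] at h1
    have h2 := h1.neg
    have h3 : -((algebraMap ℂ (SymmC a E →L[ℂ] SymmC a E)) (-1) - k.op a ξ) = 1 + k.op a ξ := by
      rw [map_neg, map_one]
      abel
    rwa [h3] at h2

end EvenKernel

namespace SymmC

variable {a : ℝ} {E : Type*}

/-- The reflection `u(-t)`. -/
def reflect [TopologicalSpace E] (u : SymmC a E) : SymmC a E :=
  ⟨fun t => u ⟨-t, ⟨neg_le_neg t.2.2, neg_le.1 t.2.1⟩⟩, by fun_prop⟩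

theorem extend_reflect [ha : Fact (0 < a)] [TopologicalSpace E] (u : SymmC a E) (t : ℝ) :
    u.reflect.extend t = u.extend (-t) := by
  change u _ = u _
  congr 1
  ext
  simp only [coe_projIcc]
  rcases le_total a t with h | h <;> rcases le_total (-a) t with h' | h' <;>
    have := ha.out <;> simp [max_def, min_def] <;> split_ifs <;> linarith

end SymmC

/-! ### Resolvents, transposition, and the solutions q and q* -/

namespace EvenKernel

variable {E : Type*} [NormedAddCommGroup E] [NormedSpace ℂ E] {k : EvenKernel E} {u v : ℝ → E}
  {C D : ℝ} {a : ℝ} [ha : Fact (0 < a)]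

variable (k a) in
/-- All truncated equations on `[-ξ, ξ]`, `0 ≤ ξ ≤ a`, are uniquely solvable. -/
def Regular : Prop := ∀ ξ ∈ Icc 0 a, IsUnit (1 + k.op a ξ)

variable (k a) in
/-- The inverse of `1 + k.op a ξ`. -/
def resolvent (ξ : ℝ) : SymmC a E →L[ℂ] SymmC a E :=
  Ring.inverse (1 + k.op a (clampIcc a ξ))

theorem Regular.continuous_resolvent [CompleteSpace E] (hk : k.Regular a) :
    Continuous (k.resolvent a) := by
  refine continuous_iff_continuousAt.2 fun ξ => ?_
  obtain ⟨U, hU⟩ := hk _ (clampIcc_mem ha.out.le ξ)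
  have h1 := NormedRing.inverse_continuousAt (R := SymmC a E →L[ℂ] SymmC a E) U
  rw [hU] at h1
  exact ContinuousAt.comp (f := fun ξ => 1 + k.op a (clampIcc a ξ)) h1
    (continuous_const.add (k.continuous_op_clamp a)).continuousAt

theorem resolvent_clamp (ξ : ℝ) : k.resolvent a (clampIcc a ξ) = k.resolvent a ξ := by
  rw [resolvent, clampIcc_of_mem (clampIcc_mem ha.out.le ξ), resolvent]

theorem Regular.exists_norm_resolvent_le [CompleteSpace E] (hk : k.Regular a) :
    ∃ C > 0, ∀ ξ, ‖k.resolvent a ξ‖ ≤ C := by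
  obtain ⟨C, hC⟩ := (isCompact_Icc (a := 0) (b := a)).exists_bound_of_continuousOn
    (E := SymmC a E →L[ℂ] SymmC a E)
    hk.continuous_resolvent.continuousOn
  refine ⟨max C 1, by positivity, fun ξ => ?_⟩
  rw [← resolvent_clamp]
  exact (hC _ (clampIcc_mem ha.out.le ξ)).trans (le_max_left _ _)

theorem Regular.resolvent_add_op (hk : k.Regular a) {ξ : ℝ} (hξ : ξ ∈ Icc 0 a) (f : SymmC a E) :
    k.resolvent a ξ f + k.op a ξ (k.resolvent a ξ f) = f := by
  have h := Ring.mul_inverse_cancel _ (hk ξ hξ)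
  have h1 := congrArg (fun L => L f) h
  simpa [resolvent, clampIcc_of_mem hξ] using h1

theorem Regular.resolvent_apply_add (hk : k.Regular a) {ξ : ℝ} (hξ : ξ ∈ Icc 0 a)
    (f : SymmC a E) : k.resolvent a ξ (f + k.op a ξ f) = f := by
  have h := Ring.inverse_mul_cancel _ (hk ξ hξ)
  have h1 := congrArg (fun L => L f) h
  simpa [resolvent, clampIcc_of_mem hξ] using h1

theorem Regular.eq_resolvent (hk : k.Regular a) {ξ : ℝ} (hξ : ξ ∈ Icc 0 a) {f g : SymmC a E}
    (h : f + k.op a ξ f = g) : f = k.resolvent a ξ g := by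
  rw [← h, hk.resolvent_apply_add hξ]

theorem Regular.op_resolvent (hk : k.Regular a) {ξ : ℝ} (hξ : ξ ∈ Icc 0 a) (f : SymmC a E) :
    k.op a ξ (k.resolvent a ξ f) = k.resolvent a ξ (k.op a ξ f) := by
  refine hk.eq_resolvent hξ ?_
  rw [← map_add, hk.resolvent_add_op hξ]

theorem Regular.extend_resolvent_add (hk : k.Regular a) {ξ : ℝ} (hξ : ξ ∈ Icc 0 a)
    (f : SymmC a E) {t : ℝ} (ht : t ∈ Icc (-a) a) :
    (k.resolvent a ξ f).extend t + k.truncConv ξ (k.resolvent a ξ f).extend t = f.extend t := by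
  rw [← extend_op ξ _ ht]
  exact congrArg (fun w : SymmC a E => w.extend t) (hk.resolvent_add_op hξ f)

/-- A solution of the truncated equation is given by the resolvent. -/
theorem Regular.eq_extend_resolvent (hk : k.Regular a) {ξ : ℝ} (hξ : ξ ∈ Icc 0 a)
    (hv : BddMeas v C) {g : SymmC a E}
    (h : ∀ t ∈ Icc (-ξ) ξ, v t + k.truncConv ξ v t = g.extend t) :
    ∀ t ∈ Icc (-ξ) ξ, v t = (k.resolvent a ξ g).extend t := by
  have hsub : ∀ t ∈ Icc (-ξ) ξ, t ∈ Icc (-a) a := fun t ht =>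
    ⟨(neg_le_neg hξ.2).trans ht.1, ht.2.trans hξ.2⟩
  -- The convolution sees `v` on [-ξ, ξ] only, so `g - w` continues `v` to [-a, a] and solves the
  -- equation there.
  set w : SymmC a E := SymmC.ofFun a (k.truncConv ξ v) with hw
  have hwt : ∀ t ∈ Icc (-a) a, w.extend t = k.truncConv ξ v t := fun t ht =>
    SymmC.extend_ofFun (continuous_truncConv hv ξ) ht
  have h1 : ∀ t ∈ Icc (-ξ) ξ, (g - w).extend t = v t := fun t ht => by
    simp only [SymmC.extend_sub]
    rw [hwt t (hsub t ht), ← h t ht, add_sub_cancel_right]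
  have h2 : k.op a ξ (g - w) = w := by
    rw [op_eq, truncConv_congr fun s hs => h1 s (Ioc_subset_Icc_self hs)]
  have h3 : g - w = k.resolvent a ξ g := hk.eq_resolvent hξ (by rw [h2, sub_add_cancel])
  intro t ht
  rw [← h1 t ht, h3]

theorem truncConv_reflect (ξ : ℝ) (u : ℝ → E) (t : ℝ) :
    k.truncConv ξ u (-t) = k.truncConv ξ (fun s => u (-s)) t := by
  rw [truncConv, conv_neg_arg, truncConv]
  refine conv_congr ?_ t
  -- Reflection turns the half-open interval into the one open at the other end; the two differ in a
  -- null set.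
  have h : ∀ᵐ s : ℝ, s ≠ -ξ ∧ s ≠ ξ :=
    (Measure.ae_ne volume (-ξ)).and (Measure.ae_ne volume ξ)
  filter_upwards [h] with s hs
  simp only [indicator_apply, mem_Ioc]
  congr 1
  refine propext ⟨fun h1 => ⟨lt_of_le_of_ne (by linarith [h1.2]) hs.1.symm, by linarith [h1.1]⟩,
    fun h1 => ⟨?_, by linarith [h1.1]⟩⟩
  have := lt_of_le_of_ne h1.2 hs.2
  linarith

theorem op_reflect (ξ : ℝ) (f : SymmC a E) : k.op a ξ f.reflect = (k.op a ξ f).reflect := by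
  ext t
  rw [← SymmC.extend_coe (k.op a ξ f).reflect, SymmC.extend_reflect, op_apply, extend_op ξ f
    ⟨neg_le_neg t.2.2, neg_le.1 t.2.1⟩, truncConv_reflect]
  congr 2
  ext s
  rw [SymmC.extend_reflect]

theorem Regular.resolvent_reflect (hk : k.Regular a) {ξ : ℝ} (hξ : ξ ∈ Icc 0 a) (f : SymmC a E) :
    k.resolvent a ξ f.reflect = (k.resolvent a ξ f).reflect := by
  refine (hk.eq_resolvent hξ ?_).symm
  rw [op_reflect]
  conv_rhs => rw [← hk.resolvent_add_op hξ f]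
  rfl

/-- The kernel acting on `E →L[ℂ] E` by composition on the right. -/
def dual (k : EvenKernel E) : EvenKernel (E →L[ℂ] E) where
  toFun t := (ContinuousLinearMap.compL ℂ E E E).flip (k.toFun t)
  integrable := (ContinuousLinearMap.compL ℂ E E E).flip.integrable_comp k.integrable
  even t := by rw [k.even]

theorem dual_apply (t : ℝ) (g : E →L[ℂ] E) : k.dual.toFun t g = g ∘L k.toFun t := rfl

/-- Transposition of the convolution. -/
theorem integral_apply_conv [CompleteSpace E] {g : ℝ → E →L[ℂ] E} (hg : BddMeas g D)
    (hu : BddMeas u C) (hui : Integrable u) :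
    ∫ t, g t (k.conv u t) = ∫ s, k.dual.conv g s (u s) := by
  have h1 : Integrable (fun p : ℝ × ℝ => k.toFun (p.1 - p.2) (u p.2)) (volume.prod volume) :=
    Integrable.convolution_integrand (ContinuousLinearMap.id ℂ (E →L[ℂ] E)).flip hui k.integrable
  have h2 : Integrable (fun p : ℝ × ℝ => g p.1 (k.toFun (p.1 - p.2) (u p.2)))
      (volume.prod volume) := by
    refine (h1.norm.const_mul D).mono' ?_ (ae_of_all _ fun p => ?_)
    · exact (ContinuousLinearMap.id ℂ (E →L[ℂ] E)).aestronglyMeasurable_comp₂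
        hg.aesm.comp_fst h1.aestronglyMeasurable
    · exact (ContinuousLinearMap.le_opNorm _ _).trans
        (mul_le_mul_of_nonneg_right (hg.bound _) (norm_nonneg _))
  have h3 : ∀ t, g t (k.conv u t) = ∫ s, g t (k.toFun (t - s) (u s)) := fun t => by
    rw [conv, ContinuousLinearMap.integral_comp_comm _ (integrable_apply hu t)]
  have h4 : ∀ s, k.dual.conv g s (u s) = ∫ t, g t (k.toFun (t - s) (u s)) := fun s => by
    rw [conv, ContinuousLinearMap.integral_apply (integrable_apply hg s)]
    refine integral_congr_ae (ae_of_all _ fun t => ?_)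
    simp only [dual_apply]
    rw [even_sub, ContinuousLinearMap.comp_apply]
  simp_rw [h3, h4]
  exact integral_integral_swap h2

/-- Transposition of the convolution between two sets of finite measure. -/
theorem setIntegral_apply_conv [CompleteSpace E] {g : ℝ → E →L[ℂ] E} (hg : BddMeas g D)
    (hu : BddMeas u C) {S S' : Set ℝ} (hS : MeasurableSet S) (hS' : MeasurableSet S')
    (hv' : volume S' ≠ ⊤) :
    ∫ t in S, g t (k.conv (S'.indicator u) t) = ∫ s in S', k.dual.conv (S.indicator g) s (u s) := by
  rw [← integral_indicator hS, ← integral_indicator hS']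
  have h := integral_apply_conv (k := k) (hg.indicator hS) (hu.indicator hS')
    (hu.integrable_indicator hS' hv')
  refine Eq.trans (integral_congr_ae (ae_of_all _ fun t => ?_))
    (h.trans (integral_congr_ae (ae_of_all _ fun t => ?_)))
  · by_cases ht : t ∈ S <;> simp [ht]
  · by_cases ht : t ∈ S' <;> simp [ht]

theorem bddMeas_apply {g : ℝ → E →L[ℂ] E} (hg : BddMeas g D) (hu : BddMeas u C) :
    BddMeas (fun s => g s (u s)) (D * C) :=
  ⟨aesm_apply hg.aesm hu.aesm, fun s => (ContinuousLinearMap.le_opNorm _ _).trans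
    (mul_le_mul (hg.bound s) (hu.bound s) (norm_nonneg _) hg.nonneg)⟩

theorem bddMeas_truncConv (hu : BddMeas u C) (ξ : ℝ) :
    BddMeas (k.truncConv ξ u) (k.mass * C) :=
  ⟨(continuous_truncConv hu ξ).aestronglyMeasurable, norm_truncConv_le hu ξ⟩

theorem setIntegral_apply_add_truncConv [CompleteSpace E] {g : ℝ → E →L[ℂ] E} (hg : BddMeas g D)
    (hu : BddMeas u C) (ξ : ℝ) :
    ∫ t in Ioc (-ξ) ξ, g t (u t + k.truncConv ξ u t) =
      ∫ t in Ioc (-ξ) ξ, (g t + k.dual.truncConv ξ g t) (u t) := by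
  have hfin : volume (Ioc (-ξ) ξ) ≠ ⊤ := by simp
  simp only [map_add, _root_.add_apply]
  rw [integral_add ((bddMeas_apply hg hu).integrableOn hfin)
    ((bddMeas_apply hg (bddMeas_truncConv hu ξ)).integrableOn hfin),
    integral_add ((bddMeas_apply hg hu).integrableOn hfin)
    ((bddMeas_apply (bddMeas_truncConv hg ξ) hu).integrableOn hfin)]
  congr 1
  exact setIntegral_apply_conv hg hu measurableSet_Ioc measurableSet_Ioc hfin

/-- By the Fredholm alternative injectivity is enough. If g solves the homogeneous transposed
equation, then ∫ g f = 0 for every f in the range of 1 + T(ξ), which is everything. So g = 0 a.e. on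
(-ξ, ξ), its truncated convolution vanishes, and the equation gives g = 0 on all of [-a, a]. -/
theorem Regular.dual [FiniteDimensional ℂ E] (hk : k.Regular a) : k.dual.Regular a := by
  have : ProperSpace E := FiniteDimensional.proper ℂ E
  have : ProperSpace (E →L[ℂ] E) := FiniteDimensional.proper ℂ _
  intro ξ hξ
  refine isUnit_one_add_op fun g hg => ?_
  have hz : ∀ t ∈ Icc (-a) a, g.extend t + k.dual.truncConv ξ g.extend t = 0 := fun t ht => by
    rw [← extend_op ξ _ ht]
    exact congrArg (fun w : SymmC a (E →L[ℂ] E) => w.extend t) hg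
  have hIoc : ∀ t ∈ Ioc (-ξ) ξ, t ∈ Icc (-a) a := fun t ht =>
    ⟨(neg_le_neg hξ.2).trans ht.1.le, ht.2.trans hξ.2⟩
  have h1 : ∀ f : SymmC a E, ∫ t in Ioc (-ξ) ξ, g.extend t (f.extend t) = 0 := fun f => by
    have h2 := setIntegral_apply_add_truncConv (k := k) g.bddMeas_extend
      (k.resolvent a ξ f).bddMeas_extend ξ
    have h3 : ∫ t in Ioc (-ξ) ξ, (g.extend t + k.dual.truncConv ξ g.extend t)
        ((k.resolvent a ξ f).extend t) = 0 :=
      setIntegral_eq_zero_of_forall_eq_zero fun t ht => by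
        rw [hz t (hIoc t ht), _root_.zero_apply]
    rw [← h3, ← h2]
    refine setIntegral_congr_fun measurableSet_Ioc fun t ht => ?_
    rw [hk.extend_resolvent_add hξ f (hIoc t ht)]
  have h3 : ∀ x : E, ∀ᵐ t : ℝ, t ∈ Ioo (-ξ) ξ → g.extend t x = 0 := fun x => by
    have hc : Continuous fun t => g.extend t x := g.continuous_extend.clm_apply continuous_const
    refine isOpen_Ioo.ae_eq_zero_of_integral_contDiff_smul_eq_zero
      (hc.locallyIntegrable.locallyIntegrableOn _) fun φ hφ _ hsupp => ?_
    have hcf : Continuous fun t => (φ t : ℂ) • x := by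
      have := hφ.continuous
      fun_prop
    rw [← h1 (SymmC.ofFun a fun t => (φ t : ℂ) • x), ← integral_indicator measurableSet_Ioc]
    refine integral_congr_ae (ae_of_all _ fun t => ?_)
    by_cases ht : t ∈ Ioc (-ξ) ξ
    · simp only [indicator_of_mem ht, SymmC.extend_ofFun hcf (hIoc t ht), map_smul]
      rfl
    · have : φ t = 0 := by
        by_contra hne
        exact ht (Ioo_subset_Ioc_self (hsupp (subset_tsupport φ hne)))
      simp only [indicator_of_notMem ht, this, zero_smul]
  have h4 : (Ioc (-ξ) ξ).indicator g.extend =ᵐ[volume] fun _ => 0 := by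
    have h5 : ∀ᵐ t : ℝ, ∀ i, t ∈ Ioo (-ξ) ξ → g.extend t (Module.finBasis ℂ E i) = 0 :=
      ae_all_iff.2 fun i => h3 _
    filter_upwards [h5, Measure.ae_ne volume ξ] with t ht hne
    by_cases hm : t ∈ Ioc (-ξ) ξ
    · rw [indicator_of_mem hm]
      have : (g.extend t : E →ₗ[ℂ] E) = 0 := (Module.finBasis ℂ E).ext fun i =>
        ht i ⟨hm.1, lt_of_le_of_ne hm.2 hne⟩
      exact ContinuousLinearMap.coe_injective this
    · rw [indicator_of_notMem hm]
  ext1 t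
  rw [← SymmC.extend_coe, ← add_zero (g.extend t)]
  have h6 : k.dual.truncConv ξ g.extend t = 0 := by
    rw [truncConv, conv_congr h4]
    simp [conv]
  conv_lhs => rw [← h6]
  exact hz t t.2

variable (k a) in
/-- The solution `q(t, ξ)` of the truncated equation with right-hand side `1`. -/
def unitSol (t ξ : ℝ) : E →L[ℂ] E :=
  ContinuousMap.evalCLM ℂ (projIcc (-a) a (SymmC.neg_le_self a) t) ∘L k.resolvent a ξ ∘L
    ContinuousLinearMap.const ℂ (Icc (-a) a)

variable (k a) in
/-- The solution `q*(t, ξ)` of the transposed truncated equation with right-hand side `1`. -/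
def dualSol (t ξ : ℝ) : E →L[ℂ] E :=
  SymmC.extend (k.dual.resolvent a ξ (ContinuousMap.const _ 1)) t

theorem unitSol_apply (t ξ : ℝ) (x : E) :
    k.unitSol a t ξ x = SymmC.extend (k.resolvent a ξ (ContinuousMap.const _ x)) t := rfl

theorem Regular.continuous_sol [CompleteSpace E] (hk : k.Regular a) (f : SymmC a E)
    {X : Type*} [TopologicalSpace X] {s r : X → ℝ} (hs : Continuous s) (hr : Continuous r) :
    Continuous fun x => (k.resolvent a (r x) f).extend (s x) :=
  SymmC.continuous_extend_uncurry
    ((hk.continuous_resolvent.comp hr).clm_apply continuous_const) hs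

theorem Regular.continuous_unitSol [FiniteDimensional ℂ E] (hk : k.Regular a)
    {X : Type*} [TopologicalSpace X] {s r : X → ℝ} (hs : Continuous s) (hr : Continuous r) :
    Continuous fun x => k.unitSol a (s x) (r x) := by
  have : CompleteSpace E := FiniteDimensional.complete ℂ E
  exact continuous_clm_apply.2 fun x => hk.continuous_sol _ hs hr

theorem Regular.continuous_dualSol [FiniteDimensional ℂ E] (hk : k.Regular a)
    {X : Type*} [TopologicalSpace X] {s r : X → ℝ} (hs : Continuous s) (hr : Continuous r) :
    Continuous fun x => k.dualSol a (s x) (r x) := by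
  have : CompleteSpace E := FiniteDimensional.complete ℂ E
  exact hk.dual.continuous_sol _ hs hr

theorem Regular.unitSol_neg (hk : k.Regular a) {ξ : ℝ} (hξ : ξ ∈ Icc 0 a) (t : ℝ) :
    k.unitSol a (-t) ξ = k.unitSol a t ξ := by
  ext x
  rw [unitSol_apply, ← SymmC.extend_reflect, ← hk.resolvent_reflect hξ]
  rfl

theorem Regular.dualSol_neg [FiniteDimensional ℂ E] (hk : k.Regular a) {ξ : ℝ}
    (hξ : ξ ∈ Icc 0 a) (t : ℝ) : k.dualSol a (-t) ξ = k.dualSol a t ξ := by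
  rw [dualSol, ← SymmC.extend_reflect, ← hk.dual.resolvent_reflect hξ]
  rfl

theorem Regular.dualSol_add [FiniteDimensional ℂ E] (hk : k.Regular a) {ξ : ℝ}
    (hξ : ξ ∈ Icc 0 a) {t : ℝ} (ht : t ∈ Icc (-a) a) :
    k.dualSol a t ξ + k.dual.truncConv ξ (fun s => k.dualSol a s ξ) t = 1 :=
  hk.dual.extend_resolvent_add hξ _ ht

variable (k a) in
theorem bddMeas_dualSol (ξ : ℝ) : BddMeas (fun s => k.dualSol a s ξ)
    ‖k.dual.resolvent a ξ (ContinuousMap.const _ 1)‖ := SymmC.bddMeas_extend _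

/-- Pairing with `q*` inverts the truncated equation in the mean. -/
theorem Regular.setIntegral_dualSol_apply [FiniteDimensional ℂ E] (hk : k.Regular a) {ξ : ℝ}
    (hξ : ξ ∈ Icc 0 a) (hu : BddMeas u C) :
    ∫ t in Ioc (-ξ) ξ, k.dualSol a t ξ (u t + k.truncConv ξ u t) = ∫ t in Ioc (-ξ) ξ, u t := by
  have : CompleteSpace E := FiniteDimensional.complete ℂ E
  rw [setIntegral_apply_add_truncConv (k.bddMeas_dualSol a ξ) hu]
  refine setIntegral_congr_fun measurableSet_Ioc fun t ht => ?_
  simp only [hk.dualSol_add hξ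
    (⟨(neg_le_neg hξ.2).trans ht.1.le, ht.2.trans hξ.2⟩ : t ∈ Icc (-a) a)]
  rfl

/-- q*(·, ξ) satisfies its equation on the whole of [-a, a], hence also on the shell outside [-ξ,
ξ], where the convolution of the truncated q* equals 1 - q*. -/
theorem Regular.setIntegral_dualSol_shell [FiniteDimensional ℂ E] (hk : k.Regular a) {ξ ξ' : ℝ}
    (hξ : ξ ∈ Icc 0 a) (hξ' : ξ' ∈ Icc 0 a) (hu : BddMeas u C) :
    ∫ t in Ioc (-ξ) ξ, k.dualSol a t ξ (k.conv ((shell ξ ξ').indicator u) t) =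
      ∫ t in shell ξ ξ', (u t - k.dualSol a t ξ (u t)) := by
  have : CompleteSpace E := FiniteDimensional.complete ℂ E
  have hfin : volume (shell ξ ξ') ≠ ⊤ :=
    ((measure_mono (shell_subset _ _)).trans_lt (by simp : volume (Ioc (-ξ') ξ') < ⊤)).ne
  rw [setIntegral_apply_conv (k.bddMeas_dualSol a ξ) hu measurableSet_Ioc
    (measurableSet_shell _ _) hfin]
  refine setIntegral_congr_fun (measurableSet_shell _ _) fun t ht => ?_
  have h1 := hk.dualSol_add hξ (t := t) ⟨(neg_le_neg hξ'.2).trans (shell_subset _ _ ht).1.le,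
    (shell_subset _ _ ht).2.trans hξ'.2⟩
  have h2 : k.dual.conv ((Ioc (-ξ) ξ).indicator fun s => k.dualSol a s ξ) t
      = 1 - k.dualSol a t ξ := eq_sub_of_add_eq' h1
  simp only [h2]
  rfl

end EvenKernel

/-! ### Differentiating the pairing with q* in the truncation parameter -/

/-- A uniform first-order expansion to the right gives a derivative. -/
theorem hasDerivWithinAt_of_increments {F : Type*} [NormedAddCommGroup F] [NormedSpace ℝ F]
    {G b : ℝ → F} {c d : ℝ} (hb : Continuous b)
    (h : ∀ ε > 0, ∃ δ > 0, ∀ ξ ∈ Icc c d, ∀ ξ' ∈ Icc c d, ξ ≤ ξ' → ξ' - ξ < δ →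
      ‖G ξ' - G ξ - (ξ' - ξ) • b ξ‖ ≤ ε * (ξ' - ξ)) {ξ : ℝ} (hξ : ξ ∈ Icc c d) :
    HasDerivWithinAt G (b ξ) (Icc c d) ξ := by
  rw [hasDerivWithinAt_iff_isLittleO, Asymptotics.isLittleO_iff]
  intro ε hε
  obtain ⟨δ, hδ, h1⟩ := h (ε / 2) (half_pos hε)
  obtain ⟨δ', hδ', h2⟩ := Metric.continuous_iff.1 hb ξ (ε / 2) (half_pos hε)
  filter_upwards [self_mem_nhdsWithin, mem_nhdsWithin_of_mem_nhds (Metric.ball_mem_nhds ξ hδ),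
    mem_nhdsWithin_of_mem_nhds (Metric.ball_mem_nhds ξ hδ')] with x hx hx1 hx2
  rw [Metric.mem_ball, Real.dist_eq] at hx1
  rcases le_total ξ x with hle | hle
  · refine (h1 ξ hξ x hx hle ((le_abs_self _).trans_lt hx1)).trans ?_
    rw [Real.norm_eq_abs, abs_of_nonneg (sub_nonneg.2 hle)]
    nlinarith [sub_nonneg.2 hle]
  -- For `x` to the left of `ξ` the expansion is taken at `x`, and continuity of `b` replaces `b x`
  -- by `b ξ`.
  · have h3 := h1 x hx ξ hξ hle ((le_abs_self _).trans_lt (by rwa [abs_sub_comm]))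
    have h4 := (h2 x hx2).le
    rw [dist_eq_norm] at h4
    have e : G x - G ξ - (x - ξ) • b ξ
        = -(G ξ - G x - (ξ - x) • b x) - (ξ - x) • (b x - b ξ) := by module
    rw [e, Real.norm_eq_abs, abs_of_nonpos (sub_nonpos.2 hle)]
    refine (norm_sub_le _ _).trans ?_
    rw [norm_neg, norm_smul, Real.norm_eq_abs, abs_of_nonneg (sub_nonneg.2 hle)]
    nlinarith [sub_nonneg.2 hle]

theorem shell_eq_union {ξ ξ' : ℝ} (h0 : 0 ≤ ξ) :
    shell ξ ξ' = Ioc (-ξ') (-ξ) ∪ Ioc ξ ξ' := by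
  ext s
  have hs : s ∈ shell ξ ξ' ↔ s ∈ Ioc (-ξ') ξ' ∧ ¬(-ξ < s ∧ s ≤ ξ) := Iff.rfl
  rw [hs, mem_union, mem_Ioc, mem_Ioc, mem_Ioc, not_and_or, not_lt, not_le]
  constructor
  · rintro ⟨⟨h1, h2⟩, h3 | h3⟩
    · exact Or.inl ⟨h1, h3⟩
    · exact Or.inr ⟨h3, h2⟩
  · rintro (⟨h1, h2⟩ | ⟨h1, h2⟩)
    · exact ⟨⟨h1, by linarith⟩, Or.inl h2⟩
    · exact ⟨⟨by linarith, h2⟩, Or.inr h1⟩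

theorem norm_setIntegral_Ioc_sub_le {F : Type*} [NormedAddCommGroup F] [NormedSpace ℝ F]
    [CompleteSpace F] {g : ℝ → F} {c d ε : ℝ} {x : F} (hcd : c ≤ d)
    (hg : IntegrableOn g (Ioc c d)) (h : ∀ s ∈ Icc c d, ‖g s - x‖ ≤ ε) :
    ‖(∫ s in Ioc c d, g s) - (d - c) • x‖ ≤ ε * (d - c) := by
  have h1 : (d - c) • x = ∫ _ in Ioc c d, x := by
    rw [setIntegral_const, Real.volume_real_Ioc_of_le hcd]
  rw [h1, ← integral_sub hg (integrableOn_const (by simp))]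
  refine (norm_setIntegral_le_of_norm_le_const (by simp) fun s hs =>
    h s (Ioc_subset_Icc_self hs)).trans_eq ?_
  rw [Real.volume_real_Ioc_of_le hcd]

theorem norm_setIntegral_shell_sub_le {F : Type*} [NormedAddCommGroup F] [NormedSpace ℝ F]
    [CompleteSpace F] {g : ℝ → F} {ξ ξ' ε : ℝ} {x y : F} (h0 : 0 ≤ ξ) (hle : ξ ≤ ξ')
    (hg : IntegrableOn g (Ioc (-ξ') ξ')) (h : ∀ s ∈ Icc ξ ξ', ‖g s - x‖ ≤ ε)
    (h' : ∀ s ∈ Icc ξ ξ', ‖g (-s) - y‖ ≤ ε) :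
    ‖(∫ s in shell ξ ξ', g s) - (ξ' - ξ) • (x + y)‖ ≤ 2 * ε * (ξ' - ξ) := by
  have hs1 : Ioc (-ξ') (-ξ) ⊆ Ioc (-ξ') ξ' := Ioc_subset_Ioc le_rfl (by linarith)
  have hs2 : Ioc ξ ξ' ⊆ Ioc (-ξ') ξ' := Ioc_subset_Ioc (by linarith) le_rfl
  rw [shell_eq_union h0, setIntegral_union (by
    rw [Set.disjoint_left]
    rintro s ⟨_, h1⟩ ⟨h2, _⟩
    linarith) measurableSet_Ioc (hg.mono_set hs1) (hg.mono_set hs2)]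
  have h1 := norm_setIntegral_Ioc_sub_le hle (hg.mono_set hs2) h
  have h2 := norm_setIntegral_Ioc_sub_le (neg_le_neg hle) (hg.mono_set hs1)
    (x := y) (ε := ε) fun s hs => by
      simpa using h' (-s) ⟨le_neg.1 hs.2, neg_le.1 hs.1⟩
  rw [show -ξ - -ξ' = ξ' - ξ by ring] at h2
  rw [smul_add]
  refine (norm_le_of_eq_add ?_ h1 h2).trans_eq (by ring)
  abel
where
  norm_le_of_eq_add {F : Type _} [NormedAddCommGroup F] {u v w : F} {α β : ℝ} (h : u = v + w)
      (hv : ‖v‖ ≤ α) (hw : ‖w‖ ≤ β) : ‖u‖ ≤ α + β := h ▸ norm_add_le_of_le hv hw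

/-- Uniform continuity near the diagonal of `[0, a]`. -/
theorem exists_forall_near_diag {F : Type*} [NormedAddCommGroup F] {Φ : ℝ × ℝ × ℝ → F}
    (hΦ : Continuous Φ) (a : ℝ) {ε : ℝ} (hε : 0 < ε) :
    ∃ δ > 0, ∀ r ∈ Icc 0 a, ∀ s ∈ Icc 0 a, ∀ ξ ∈ Icc 0 a, ∀ ξ' ∈ Icc 0 a, |s - r| < δ →
      |ξ - r| < δ → |ξ' - r| < δ → ‖Φ (s, ξ, ξ') - Φ (r, r, r)‖ ≤ ε := by
  have h := (isCompact_Icc (a := ((0 : ℝ), (0 : ℝ), (0 : ℝ))) (b := (a, a, a))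
    ).uniformContinuousOn_of_continuous hΦ.continuousOn
  obtain ⟨δ, hδ, h1⟩ := Metric.uniformContinuousOn_iff.1 h ε hε
  refine ⟨δ, hδ, fun r hr s hs ξ hξ ξ' hξ' d1 d2 d3 => ?_⟩
  have := h1 (s, ξ, ξ') ⟨⟨hs.1, hξ.1, hξ'.1⟩, ⟨hs.2, hξ.2, hξ'.2⟩⟩ (r, r, r)
    ⟨⟨hr.1, hr.1, hr.1⟩, ⟨hr.2, hr.2, hr.2⟩⟩ (by
      simp only [Prod.dist_eq, Real.dist_eq]
      exact max_lt d1 (max_lt d2 d3))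
  rw [dist_eq_norm] at this
  exact this.le

namespace EvenKernel

variable {E : Type*} [NormedAddCommGroup E] [NormedSpace ℂ E] {k : EvenKernel E} {u v : ℝ → E}
  {C D : ℝ} {a : ℝ} [ha : Fact (0 < a)]

/-- Resolvent identity with the larger parameter inside: the increment depends on the values of the
solution for `ξ'` on the shell only. -/
theorem Regular.resolvent_sub_resolvent (hk : k.Regular a) {ξ ξ' : ℝ} (hξ : ξ ∈ Icc 0 a)
    (hξ' : ξ' ∈ Icc 0 a) (f : SymmC a E) :
    k.resolvent a ξ' f - k.resolvent a ξ f =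
      -k.resolvent a ξ ((k.op a ξ' - k.op a ξ) (k.resolvent a ξ' f)) := by
  have key : ∀ w x y : SymmC a E, w + y = f → w + x = f - (y - x) := by
    rintro w x y rfl
    abel
  have h : k.resolvent a ξ' f + k.op a ξ (k.resolvent a ξ' f)
      = f - (k.op a ξ' - k.op a ξ) (k.resolvent a ξ' f) :=
    key _ _ _ (hk.resolvent_add_op hξ' f)
  have h1 := hk.eq_resolvent hξ h
  conv_lhs => rw [h1, map_sub]
  abel

variable (k) in
/-- The pairing `∫_{-ξ}^{ξ} q*(s, ξ) f(s) ds`. -/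
def pairing (f : SymmC a E) (ξ : ℝ) : E := ∫ t in Ioc (-ξ) ξ, k.dualSol a t ξ (f.extend t)

variable [FiniteDimensional ℂ E]

theorem Regular.pairing_eq (hk : k.Regular a) {ξ : ℝ} (hξ : ξ ∈ Icc 0 a) (f : SymmC a E) :
    k.pairing f ξ = ∫ t in Ioc (-ξ) ξ, (k.resolvent a ξ f).extend t := by
  rw [← hk.setIntegral_dualSol_apply hξ (k.resolvent a ξ f).bddMeas_extend, pairing]
  refine setIntegral_congr_fun measurableSet_Ioc fun t ht => ?_
  rw [hk.extend_resolvent_add hξ f ⟨(neg_le_neg hξ.2).trans ht.1.le, ht.2.trans hξ.2⟩]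

/-- The difference of the two solutions solves the equation on [-ξ, ξ] with right-hand side minus
the shell part of the convolution of `ψ'`. Pairing with q* gives -∫ (1 - q*) ψ' over the shell; the
extra piece ∫ ψ' of the larger mean value cancels the 1. -/
theorem Regular.pairing_sub_pairing (hk : k.Regular a) {ξ ξ' : ℝ} (hξ : ξ ∈ Icc 0 a)
    (hξ' : ξ' ∈ Icc 0 a) (hle : ξ ≤ ξ') (f : SymmC a E) :
    k.pairing f ξ' - k.pairing f ξ =
      ∫ t in shell ξ ξ', k.dualSol a t ξ ((k.resolvent a ξ' f).extend t) := by
  have : CompleteSpace E := FiniteDimensional.complete ℂ E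
  set ψ' := k.resolvent a ξ' f with hψ'
  set ψ := k.resolvent a ξ f with hψ
  have hfin : ∀ r : ℝ, volume (Ioc (-r) r) ≠ ⊤ := fun r => by simp
  have hsub : Ioc (-ξ) ξ ⊆ Ioc (-ξ') ξ' := Ioc_subset_Ioc (neg_le_neg hle) hle
  have hbd := bddMeas_apply (k.bddMeas_dualSol a ξ) ψ'.bddMeas_extend
  have h1 := hk.setIntegral_dualSol_apply hξ (ψ' - ψ).bddMeas_extend
  have h2 : ∀ t ∈ Ioc (-ξ) ξ, (ψ' - ψ).extend t + k.truncConv ξ (ψ' - ψ).extend t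
      = -k.conv ((shell ξ ξ').indicator ψ'.extend) t := fun t ht => by
    have hta : t ∈ Icc (-a) a := ⟨(neg_le_neg hξ.2).trans ht.1.le, ht.2.trans hξ.2⟩
    have e1 := hk.extend_resolvent_add hξ f hta
    have e2 := hk.extend_resolvent_add hξ' f hta
    rw [← truncConv_sub_truncConv ψ'.bddMeas_extend hle, SymmC.extend_sub,
      truncConv_sub ψ'.bddMeas_extend ψ.bddMeas_extend]
    rw [← hψ'] at e2
    rw [← hψ, ← e2] at e1
    rw [add_sub_assoc', sub_add_eq_add_sub, sub_sub, e1]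
    abel
  rw [setIntegral_congr_fun (g := fun t => -k.dualSol a t ξ
      (k.conv ((shell ξ ξ').indicator ψ'.extend) t)) measurableSet_Ioc (fun t ht => by
      simp only [h2 t ht, map_neg]), integral_neg,
    hk.setIntegral_dualSol_shell hξ hξ' ψ'.bddMeas_extend] at h1
  rw [hk.pairing_eq hξ, hk.pairing_eq hξ', ← hψ, ← hψ']
  have h3 : ∫ t in Ioc (-ξ') ξ', ψ'.extend t
      = (∫ t in Ioc (-ξ) ξ, ψ'.extend t) + ∫ t in shell ξ ξ', ψ'.extend t := by
    rw [shell, setIntegral_sdiff measurableSet_Ioc (ψ'.bddMeas_extend.integrableOn (hfin _)) hsub]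
    abel
  have hsh := shell_subset ξ ξ'
  rw [integral_sub ((ψ'.bddMeas_extend.integrableOn (hfin ξ')).mono_set hsh)
    ((hbd.integrableOn (hfin ξ')).mono_set hsh), SymmC.extend_sub,
    integral_sub (ψ'.bddMeas_extend.integrableOn (hfin _))
    (ψ.bddMeas_extend.integrableOn (hfin _))] at h1
  rw [h3, add_sub_right_comm, ← h1]
  abel

/-- The derivative of the pairing in the truncation parameter. -/
theorem Regular.hasDerivWithinAt_pairing (hk : k.Regular a) (f : SymmC a E) {ξ : ℝ}
    (hξ : ξ ∈ Icc 0 a) :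
    HasDerivWithinAt (k.pairing f) (k.dualSol a ξ ξ ((k.resolvent a ξ f).extend ξ +
      (k.resolvent a ξ f).extend (-ξ))) (Icc 0 a) ξ := by
  have : CompleteSpace E := FiniteDimensional.complete ℂ E
  refine hasDerivWithinAt_of_increments (b := fun ξ => k.dualSol a ξ ξ
    ((k.resolvent a ξ f).extend ξ + (k.resolvent a ξ f).extend (-ξ))) ?_ (fun ε hε => ?_) hξ
  · exact (hk.continuous_dualSol continuous_id continuous_id).clm_apply
      ((hk.continuous_sol f continuous_id continuous_id).add
        (hk.continuous_sol f continuous_neg continuous_id))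
  -- Three separate variables: q* carries ξ, the solution carries ξ', and the integration variable
  -- lies between them in modulus.
  · have hΦ : ∀ σ : ℝ → ℝ, Continuous σ → Continuous fun p : ℝ × ℝ × ℝ =>
        k.dualSol a (σ p.1) p.2.1 ((k.resolvent a p.2.2 f).extend (σ p.1)) := fun σ hσ =>
      (hk.continuous_dualSol (hσ.comp continuous_fst)
        (continuous_fst.comp continuous_snd)).clm_apply
        (hk.continuous_sol f (hσ.comp continuous_fst) (continuous_snd.comp continuous_snd))
    have hΦ1 := hΦ id continuous_id
    have hΦ2 := hΦ (fun s => -s) continuous_neg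
    obtain ⟨δ1, hδ1, h1⟩ := exists_forall_near_diag hΦ1 a (half_pos hε)
    obtain ⟨δ2, hδ2, h2⟩ := exists_forall_near_diag hΦ2 a (half_pos hε)
    refine ⟨min δ1 δ2, lt_min hδ1 hδ2, fun ξ hξ ξ' hξ' hle hlt => ?_⟩
    have hb := bddMeas_apply (k.bddMeas_dualSol a ξ) (k.resolvent a ξ' f).bddMeas_extend
    have h0 : ∀ s ∈ Icc ξ ξ', s ∈ Icc 0 a ∧ |s - ξ| < min δ1 δ2 := fun s hs =>
      ⟨⟨hξ.1.trans hs.1, hs.2.trans hξ'.2⟩, by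
        rw [abs_of_nonneg (sub_nonneg.2 hs.1)]
        linarith [hs.2]⟩
    have h00 : |ξ - ξ| < min δ1 δ2 := by
      rw [sub_self, abs_zero]
      exact lt_min hδ1 hδ2
    have h01 := (h0 ξ' ⟨hle, le_rfl⟩).2
    rw [hk.pairing_sub_pairing hξ hξ' hle, map_add]
    refine (norm_setIntegral_shell_sub_le hξ.1 hle (hb.integrableOn (by simp)) (fun s hs =>
      h1 ξ hξ s (h0 s hs).1 ξ hξ ξ' hξ' ((h0 s hs).2.trans_le (min_le_left _ _))
        (h00.trans_le (min_le_left _ _)) (h01.trans_le (min_le_left _ _))) (fun s hs => ?_)).trans_eq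
      (by ring)
    rw [← hk.dualSol_neg hξ ξ]
    exact h2 ξ hξ s (h0 s hs).1 ξ hξ ξ' hξ' ((h0 s hs).2.trans_le (min_le_right _ _))
        (h00.trans_le (min_le_right _ _)) (h01.trans_le (min_le_right _ _))

end EvenKernel

/-! ### Riemann–Stieltjes sums and summation by parts -/

theorem le_of_forall_le_succ {N : ℕ} {y : ℕ → ℝ} (hy : ∀ k < N, y k ≤ y (k + 1)) {i j : ℕ}
    (hij : i ≤ j) (hj : j ≤ N) : y i ≤ y j := by
  induction j, hij using Nat.le_induction with
  | base => exact le_rfl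
  | succ m hm ih => exact (ih (by omega)).trans (hy m (by omega))

/-- Summation by parts for Riemann–Stieltjes sums. -/
theorem sum_apply_sub_eq {E F : Type*} [AddCommGroup E] [AddCommGroup F] [Module ℂ E] [Module ℂ F]
    [TopologicalSpace E] [TopologicalSpace F] [IsTopologicalAddGroup F]
    (Q : ℕ → E →L[ℂ] F) (c : ℕ → E) (N : ℕ) :
    ∑ k ∈ Finset.range N, Q (k + 1) (c (k + 1) - c k) = Q (N + 1) (c N) - Q 0 (c 0) -
      ∑ k ∈ Finset.range (N + 1), (Q (k + 1) - Q k) (c k) := by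
  induction N with
  | zero => simp
  | succ N ih =>
    rw [Finset.sum_range_succ, ih, Finset.sum_range_succ _ (N + 1)]
    simp only [map_sub, _root_.sub_apply]
    abel

/-- Convergence of the Riemann–Stieltjes sums of an operator-valued function against a
vector-valued one. -/
def HasRSIntegral {E : Type*} [NormedAddCommGroup E] [NormedSpace ℂ E] (g : ℝ → E →L[ℂ] E)
    (F : ℝ → E) (c d : ℝ) (L : E) : Prop :=
  ∀ ε : ℝ, 0 < ε → ∃ δ : ℝ, 0 < δ ∧ ∀ (N : ℕ) (x τ : ℕ → ℝ), x 0 = c → x N = d →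
    (∀ k < N, x k ≤ τ k ∧ τ k ≤ x (k + 1) ∧ x (k + 1) - x k < δ) →
      ‖(∑ k ∈ Finset.range N, g (τ k) (F (x (k + 1)) - F (x k))) - L‖ < ε

/-- The points `x 0, τ 0, …, τ (N - 1), x N` of a tagged partition. -/
def tagPoints (N : ℕ) (x τ : ℕ → ℝ) : ℕ → ℝ
  | 0 => x 0
  | k + 1 => if k < N then τ k else x N

section tagPoints

variable {N : ℕ} {x τ : ℕ → ℝ} {δ : ℝ}

theorem tagPoints_succ {k : ℕ} (hk : k < N) : tagPoints N x τ (k + 1) = τ k := if_pos hk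

theorem tagPoints_last : tagPoints N x τ (N + 1) = x N := if_neg (lt_irrefl N)

theorem tagPoints_le (h : ∀ k < N, x k ≤ τ k ∧ τ k ≤ x (k + 1) ∧ x (k + 1) - x k < δ) {k : ℕ}
    (hk : k < N + 1) : tagPoints N x τ k ≤ x k := by
  cases k with
  | zero => exact le_rfl
  | succ j => rw [tagPoints_succ (by omega)]; exact (h j (by omega)).2.1

theorem le_tagPoints (h : ∀ k < N, x k ≤ τ k ∧ τ k ≤ x (k + 1) ∧ x (k + 1) - x k < δ) {k : ℕ}
    (hk : k < N + 1) : x k ≤ tagPoints N x τ (k + 1) := by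
  rcases Nat.lt_succ_iff_lt_or_eq.1 hk with h1 | rfl
  · rw [tagPoints_succ h1]
    exact (h k h1).1
  · rw [tagPoints_last]

theorem sub_tagPoints_lt (hδ : 0 < δ)
    (h : ∀ k < N, x k ≤ τ k ∧ τ k ≤ x (k + 1) ∧ x (k + 1) - x k < δ) {k : ℕ}
    (hk : k < N + 1) : x k - tagPoints N x τ k < δ := by
  cases k with
  | zero => simpa [tagPoints] using hδ
  | succ j =>
    rw [tagPoints_succ (by omega)]
    linarith [h j (by omega)]

theorem tagPoints_sub_lt (hδ : 0 < δ)
    (h : ∀ k < N, x k ≤ τ k ∧ τ k ≤ x (k + 1) ∧ x (k + 1) - x k < δ) {k : ℕ}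
    (hk : k < N + 1) : tagPoints N x τ (k + 1) - x k < δ := by
  rcases Nat.lt_succ_iff_lt_or_eq.1 hk with h1 | rfl
  · rw [tagPoints_succ h1]
    linarith [h k h1]
  · rw [tagPoints_last, sub_self]
    exact hδ

theorem tagPoints_mono (h : ∀ k < N, x k ≤ τ k ∧ τ k ≤ x (k + 1) ∧ x (k + 1) - x k < δ) :
    ∀ k < N + 1, tagPoints N x τ k ≤ tagPoints N x τ (k + 1) := fun _ hk =>
  (tagPoints_le h hk).trans (le_tagPoints h hk)

/-- Summation by parts exchanges the roles of points and tags: the `x k` become tags of the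
partition by `tagPoints`. The end points `x 0` and `x N` are added to it, whence `N + 1` terms. -/
theorem sum_tagPoints {E : Type*} [NormedAddCommGroup E] [NormedSpace ℂ E]
    (g : ℝ → E →L[ℂ] E) (F : ℝ → E) :
    ∑ k ∈ Finset.range N, g (τ k) (F (x (k + 1)) - F (x k)) =
      g (x N) (F (x N)) - g (x 0) (F (x 0)) - ∑ k ∈ Finset.range (N + 1),
        (g (tagPoints N x τ (k + 1)) - g (tagPoints N x τ k)) (F (x k)) := by
  have h := sum_apply_sub_eq (fun k => g (tagPoints N x τ k)) (fun k => F (x k)) N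
  simp only [tagPoints_last] at h
  refine (Finset.sum_congr rfl fun k hk => ?_).trans h
  rw [tagPoints_succ (Finset.mem_range.1 hk)]

end tagPoints

/-! ### Even right-hand sides: a bound uniform over partitions and the Stieltjes formula -/

namespace EvenKernel

variable {E : Type*} [NormedAddCommGroup E] [NormedSpace ℂ E] {k : EvenKernel E} {u v : ℝ → E}
  {C D : ℝ} {a : ℝ} [ha : Fact (0 < a)]

theorem setIntegral_shell_add {y₀ y₁ y₂ : ℝ} (h0 : y₀ ≤ y₁) (h1 : y₁ ≤ y₂) (t : ℝ) :
    (∫ s in shell y₀ y₁, ‖k.toFun (t - s)‖) + (∫ s in shell y₁ y₂, ‖k.toFun (t - s)‖) =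
      ∫ s in shell y₀ y₂, ‖k.toFun (t - s)‖ := by
  have hi : ∀ r, IntegrableOn (fun s => ‖k.toFun (t - s)‖) (Ioc (-r) r) := fun r =>
    (k.integrable_norm_sub t).integrableOn
  have hsub : ∀ {r r' : ℝ}, r ≤ r' → Ioc (-r) r ⊆ Ioc (-r') r' := fun h =>
    Ioc_subset_Ioc (neg_le_neg h) h
  rw [shell, shell, shell, setIntegral_sdiff measurableSet_Ioc (hi _) (hsub h0),
    setIntegral_sdiff measurableSet_Ioc (hi _) (hsub h1),
    setIntegral_sdiff measurableSet_Ioc (hi _) (hsub (h0.trans h1))]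
  ring

theorem setIntegral_shell_le_mass (y₀ y₁ t : ℝ) :
    ∫ s in shell y₀ y₁, ‖k.toFun (t - s)‖ ≤ k.mass :=
  (setIntegral_le_integral (k.integrable_norm_sub t) (ae_of_all _ fun _ => norm_nonneg _)).trans_eq
    (k.integral_norm_sub t)

variable (k) in
/-- The sum of the responses `R(y_k) (T(y_{k+1}) - T(y_k)) v_k`. -/
def shellSum (N : ℕ) (y : ℕ → ℝ) (v : ℕ → SymmC a E) : SymmC a E :=
  ∑ i ∈ Finset.range N, k.resolvent a (y i) ((k.op a (y (i + 1)) - k.op a (y i)) (v i))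

theorem shellSum_add (N M : ℕ) (y : ℕ → ℝ) (v : ℕ → SymmC a E) :
    k.shellSum (N + M) y v =
      k.shellSum N y v + k.shellSum M (fun i => y (N + i)) (fun i => v (N + i)) :=
  Finset.sum_range_add _ _ _

theorem shellSum_one (y : ℕ → ℝ) (v : ℕ → SymmC a E) :
    k.shellSum 1 y v = k.resolvent a (y 0) ((k.op a (y 1) - k.op a (y 0)) (v 0)) := by
  simp [shellSum]

/-- Partitions of a short interval: the sum of the responses is not larger than the data. -/
theorem Regular.exists_norm_shellSum_le_of_short [CompleteSpace E] (hk : k.Regular a) :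
    ∃ δ > 0, ∀ (N : ℕ) (y : ℕ → ℝ) (v : ℕ → SymmC a E) (ε : ℝ), 0 ≤ ε → 0 ≤ y 0 → y N ≤ a →
      (∀ i < N, y i ≤ y (i + 1)) → y N - y 0 < δ →
      (∀ i < N, ∀ s ∈ shell (y i) (y (i + 1)), ‖(v i).extend s‖ ≤ ε) →
      ‖k.shellSum N y v‖ ≤ ε := by
  obtain ⟨C, hC, hres⟩ := hk.exists_norm_resolvent_le
  -- With kernel mass 1/(2C) on the shell, data of size 2ε and a resolvent of norm at most C, the
  -- bound returns exactly to ε. The length is δ/2 because a shell has measure twice its width.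
  obtain ⟨δ, hδ, hm⟩ := k.exists_setIntegral_norm_le (ε := 1 / (2 * C)) (by positivity)
  refine ⟨δ / 2, by positivity, ?_⟩
  -- The induction also carries a pointwise bound on S + T(y 0) S, S being the sum. Integrals of the
  -- kernel over successive shells add up exactly, so no factor is lost from one step to the next.
  suffices h : ∀ (N : ℕ) (y : ℕ → ℝ) (v : ℕ → SymmC a E) (ε : ℝ), 0 ≤ ε → 0 ≤ y 0 → y N ≤ a →
      (∀ i < N, y i ≤ y (i + 1)) → y N - y 0 < δ / 2 →
      (∀ i < N, ∀ s ∈ shell (y i) (y (i + 1)), ‖(v i).extend s‖ ≤ ε) →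
      ‖k.shellSum N y v‖ ≤ ε ∧ ∀ t, ‖(k.shellSum N y v + k.op a (y 0) (k.shellSum N y v)) t‖ ≤
        (∫ s in shell (y 0) (y N), ‖k.toFun (t - s)‖) * (2 * ε) from
    fun N y v ε h0 h1 h2 h3 h4 h5 => (h N y v ε h0 h1 h2 h3 h4 h5).1
  intro N
  induction N with
  | zero =>
    intro y v ε hε _ _ _ _ _
    refine ⟨by simpa [shellSum] using hε, fun t => ?_⟩
    simp only [shellSum, Finset.range_zero, Finset.sum_empty, map_zero, add_zero,
      ContinuousMap.zero_apply, norm_zero]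
    exact mul_nonneg (integral_nonneg fun _ => norm_nonneg _) (by positivity)
  | succ N ih =>
    intro y v ε hε h0 ha' hy hw hv
    have h01 : y 0 ≤ y 1 := hy 0 (Nat.succ_pos N)
    have h1N : y 1 ≤ y (N + 1) := le_of_forall_le_succ hy (by omega) le_rfl
    obtain ⟨ih1, ih2⟩ := ih (fun i => y (i + 1)) (fun i => v (i + 1)) ε hε (h0.trans h01) ha'
      (fun i hi => hy (i + 1) (by omega)) (by linarith) fun i hi => hv (i + 1) (by omega)
    set w := k.shellSum N (fun i => y (i + 1)) (fun i => v (i + 1)) with hwdef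
    have hsum : k.shellSum (N + 1) y v
        = w + k.resolvent a (y 0) ((k.op a (y 1) - k.op a (y 0)) (v 0)) :=
      Finset.sum_range_succ' _ N
    have hy0 : y 0 ∈ Icc 0 a := ⟨h0, (h01.trans h1N).trans ha'⟩
    -- Here `w` is the sum without the first interval. Passing from y 1 to y 0 costs a shell term in
    -- `w`, which joins that of `v 0`; both are at most ε on the shell, hence the factor 2ε.
    have hid : k.shellSum (N + 1) y v + k.op a (y 0) (k.shellSum (N + 1) y v)
        = (w + k.op a (y 1) w) + (k.op a (y 1) - k.op a (y 0)) (v 0 - w) := by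
      have h2 := hk.resolvent_add_op hy0 ((k.op a (y 1) - k.op a (y 0)) (v 0))
      rw [hsum, map_add, add_add_add_comm, h2, map_sub, _root_.sub_apply _ _ w]
      abel
    have hb : ∀ t, ‖(k.shellSum (N + 1) y v + k.op a (y 0) (k.shellSum (N + 1) y v)) t‖ ≤
        (∫ s in shell (y 0) (y (N + 1)), ‖k.toFun (t - s)‖) * (2 * ε) := fun t => by
      rw [hid, ContinuousMap.add_apply, ← setIntegral_shell_add h01 h1N, add_mul, add_comm]
      refine norm_add_le_of_le (norm_op_sub_apply_le h01 _ (fun s hs => ?_) t) (ih2 t)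
      rw [SymmC.extend_sub, two_mul]
      exact norm_sub_le_of_le (hv 0 (Nat.succ_pos N) s hs) ((w.norm_extend_le s).trans ih1)
    refine ⟨?_, hb⟩
    rw [hk.eq_resolvent hy0 (f := k.shellSum (N + 1) y v) rfl]
    have hb' : ‖k.shellSum (N + 1) y v + k.op a (y 0) (k.shellSum (N + 1) y v)‖
        ≤ 1 / (2 * C) * (2 * ε) := by
      refine (ContinuousMap.norm_le _ (by positivity)).2 fun t => (hb t).trans ?_
      refine mul_le_mul_of_nonneg_right (hm _ (measurableSet_shell _ _) ?_ t) (by positivity)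
      rw [volume_shell h0 (h01.trans h1N)]
      exact (ENNReal.ofReal_lt_ofReal_iff hδ).2 (by linarith)
    refine ((k.resolvent a (y 0)).le_of_opNorm_le (hres _) _).trans
      ((mul_le_mul_of_nonneg_left hb' hC.le).trans_eq ?_)
    field_simp

/-- The sum of the responses is bounded by the data, uniformly over all partitions. -/
theorem Regular.exists_norm_shellSum_le [CompleteSpace E] (hk : k.Regular a) :
    ∃ K > 0, ∀ (N : ℕ) (y : ℕ → ℝ) (v : ℕ → SymmC a E) (ε : ℝ), 0 ≤ ε → 0 ≤ y 0 → y N ≤ a →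
      (∀ i < N, y i ≤ y (i + 1)) →
      (∀ i < N, ∀ s ∈ shell (y i) (y (i + 1)), ‖(v i).extend s‖ ≤ ε) →
      ‖k.shellSum N y v‖ ≤ K * ε := by
  obtain ⟨δ, hδ, hshort⟩ := hk.exists_norm_shellSum_le_of_short
  obtain ⟨C, hC, hres⟩ := hk.exists_norm_resolvent_le
  have hmass := k.mass_nonneg
  have hstep : ∀ (y : ℕ → ℝ) (v : ℕ → SymmC a E) (ε : ℝ), 0 ≤ ε → y 0 ≤ y 1 →
      (∀ s ∈ shell (y 0) (y 1), ‖(v 0).extend s‖ ≤ ε) → ‖k.shellSum 1 y v‖ ≤ C * k.mass * ε := by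
    intro y v ε hε hle hv
    rw [shellSum_one, mul_assoc]
    refine ((k.resolvent a (y 0)).le_of_opNorm_le (hres _) _).trans
      (mul_le_mul_of_nonneg_left ?_ hC.le)
    exact (ContinuousMap.norm_le _ (by positivity)).2 fun t =>
      (norm_op_sub_apply_le hle _ hv t).trans
        (mul_le_mul_of_nonneg_right (setIntegral_shell_le_mass _ _ _) hε)
  have hall : ∀ (m : ℕ) (N : ℕ) (y : ℕ → ℝ) (v : ℕ → SymmC a E) (ε : ℝ), 0 ≤ ε → 0 ≤ y 0 →
      y N ≤ a → (∀ i < N, y i ≤ y (i + 1)) → y N - y 0 < (m + 1) * δ →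
      (∀ i < N, ∀ s ∈ shell (y i) (y (i + 1)), ‖(v i).extend s‖ ≤ ε) →
      ‖k.shellSum N y v‖ ≤ (m + 1) * (1 + C * k.mass) * ε := by
    intro m
    induction m with
    | zero =>
      intro N y v ε hε h0 hN hy hw hv
      refine (hshort N y v ε hε h0 hN hy (by simpa using hw) hv).trans ?_
      have : 0 ≤ C * k.mass * ε := by positivity
      push_cast
      linarith
    | succ m ih =>
      intro N y v ε hε h0 hN hy hw hv
      -- `j` is the first index with less than (m + 1)δ left to run. The part before the step into
      -- `j` is shorter than δ, so the sharp bound applies; that step may be long and is bounded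
      -- crudely; the rest is covered by induction.
      have hex : ∃ j, j ≤ N ∧ y N - y j < (m + 1) * δ :=
        ⟨N, le_rfl, by rw [sub_self]; positivity⟩
      classical
      set j := Nat.find hex with hj
      obtain ⟨hjN, hjw⟩ := Nat.find_spec hex
      rw [← hj] at hjN hjw
      have hCe : 0 ≤ C * k.mass * ε := by positivity
      obtain ⟨r, hr⟩ := Nat.exists_eq_add_of_le hjN
      have htail : ‖k.shellSum r (fun i => y (j + i)) (fun i => v (j + i))‖
          ≤ (m + 1) * (1 + C * k.mass) * ε := by
        refine ih r (fun i => y (j + i)) (fun i => v (j + i)) ε hε ?_ ?_ ?_ ?_ ?_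
        · exact h0.trans (le_of_forall_le_succ hy (Nat.zero_le _) (by omega))
        · simpa only [← hr] using hN
        · exact fun i hi => hy (j + i) (by omega)
        · simpa only [← hr, add_zero] using hjw
        · exact fun i hi => hv (j + i) (by omega)
      rcases Nat.eq_zero_or_pos j with hj0 | hjpos
      · rw [hj0, zero_add] at hr
        simp only [hj0, zero_add] at htail
        rw [hr]
        refine htail.trans ?_
        push_cast
        nlinarith
      · obtain ⟨i, hi⟩ : ∃ i, j = i + 1 := ⟨j - 1, by omega⟩
        have hmin : ¬ (i ≤ N ∧ y N - y i < (m + 1) * δ) := Nat.find_min hex (by omega)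
        have hwi : (m + 1) * δ ≤ y N - y i := by
          by_contra! hlt
          exact hmin ⟨by omega, hlt⟩
        push_cast at hw
        have hhead := hshort i y v ε hε h0
          ((le_of_forall_le_succ hy (by omega) le_rfl).trans hN) (fun l hl => hy l (by omega))
          (by linarith) fun l hl => hv l (by omega)
        have hmid := hstep (fun l => y (i + l)) (fun l => v (i + l)) ε hε (hy i (by omega))
          (hv i (by omega))
        rw [hr, shellSum_add, hi, shellSum_add]
        rw [hi] at htail
        refine (norm_add_le_of_le (norm_add_le_of_le hhead hmid) htail).trans_eq ?_
        push_cast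
        ring
  obtain ⟨m, hm⟩ := exists_nat_gt (a / δ)
  refine ⟨(m + 1) * (1 + C * k.mass), by positivity, fun N y v ε hε h0 hN hy hv =>
    hall m N y v ε hε h0 hN hy ?_ hv⟩
  rw [div_lt_iff₀ hδ] at hm
  linarith

/-- The solution with an even right-hand side as a Riemann–Stieltjes integral. -/
theorem Regular.hasRSIntegral_unitSol [FiniteDimensional ℂ E] (hk : k.Regular a) {f : SymmC a E}
    (hf : f.reflect = f) {c : ℝ → E} (hc : Continuous c)
    (hcf : ∀ ξ ∈ Icc 0 a, (k.resolvent a ξ f).extend ξ = k.unitSol a ξ ξ (c ξ)) {t : ℝ}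
    (ht : t ∈ Icc (-a) a) :
    HasRSIntegral (fun ξ => k.unitSol a t ξ) c |t| a
      (k.unitSol a t a (c a) - (k.resolvent a a f).extend t) := by
  have : CompleteSpace E := FiniteDimensional.complete ℂ E
  intro ε hε
  obtain ⟨K, hK, hsum⟩ := hk.exists_norm_shellSum_le
  -- This function vanishes on the diagonal by `hcf`, so it is uniformly small near it.
  have hΘ : Continuous fun p : ℝ × ℝ × ℝ =>
      (k.resolvent a p.2.1 f).extend p.1 - k.unitSol a p.1 p.2.1 (c p.2.2) :=
    (hk.continuous_sol f continuous_fst (continuous_fst.comp continuous_snd)).sub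
      ((hk.continuous_unitSol continuous_fst (continuous_fst.comp continuous_snd)).clm_apply
        (hc.comp (continuous_snd.comp continuous_snd)))
  obtain ⟨δ, hδ, hclose⟩ := exists_forall_near_diag hΘ a (ε := ε / (2 * K)) (by positivity)
  refine ⟨δ / 2, by positivity, fun N x τ hx0 hxN hpart => ?_⟩
  set y := tagPoints N x τ with hy
  have hy0 : y 0 = |t| := hx0
  have hyN : y (N + 1) = a := tagPoints_last.trans hxN
  have hmono := tagPoints_mono hpart
  have hyI : ∀ i ≤ N + 1, y i ∈ Icc 0 a := fun i hi =>
    ⟨(abs_nonneg t).trans (hy0 ▸ le_of_forall_le_succ hmono (Nat.zero_le i) hi),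
      hyN ▸ le_of_forall_le_succ hmono hi le_rfl⟩
  have hxI : ∀ i < N + 1, x i ∈ Icc 0 a := fun i hi =>
    ⟨(hyI i hi.le).1.trans (tagPoints_le hpart hi),
      (le_tagPoints hpart hi).trans (hyI (i + 1) hi).2⟩
  have habs : ∀ ξ ∈ Icc 0 a, ∀ (g : SymmC a E), g.reflect = g → ∀ s,
      (k.resolvent a ξ g).extend |s| = (k.resolvent a ξ g).extend s := fun ξ hξ g hg s => by
    rcases abs_choice s with h | h
    · rw [h]
    · rw [h, ← SymmC.extend_reflect, ← hk.resolvent_reflect hξ, hg]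
  -- `v i` is ψ - q c(x i) at parameter y (i + 1). On the shell between y i and y (i + 1) all
  -- arguments are close to y (i + 1), so `v i` is small there, though not elsewhere.
  set v : ℕ → SymmC a E := fun i =>
    k.resolvent a (y (i + 1)) (f - ContinuousMap.const _ (c (x i))) with hv
  have hvext : ∀ i s, (v i).extend s
      = (k.resolvent a (y (i + 1)) f).extend s - k.unitSol a s (y (i + 1)) (c (x i)) :=
    fun i s => by
      simp only [hv, map_sub, SymmC.extend_sub]
      rfl
  have hbound := hsum (N + 1) y v (ε / (2 * K)) (by positivity) (hyI 0 (by omega)).1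
    (hyI (N + 1) le_rfl).2 hmono fun i hi s hs => by
      have h1 := abs_mem_of_mem_shell hs
      have hyi := hyI (i + 1) hi
      have h2 := sub_tagPoints_lt (half_pos hδ) hpart hi
      have h3 := tagPoints_sub_lt (half_pos hδ) hpart hi
      have h4 := tagPoints_le hpart hi
      have h5 := le_tagPoints hpart hi
      have h6 := hclose (y (i + 1)) hyi |s| ⟨abs_nonneg s, h1.2.trans hyi.2⟩ (y (i + 1)) hyi (x i)
        (hxI i hi) (by rw [abs_lt]; constructor <;> linarith [h1.1, h1.2]) (by simpa using hδ)
        (by rw [abs_lt]; constructor <;> linarith)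
      simp only [hcf _ hyi, sub_self, sub_zero] at h6
      have h7 : (v i).extend |s| = (v i).extend s := habs _ hyi _ (by
        ext t
        exact congrArg (fun w : SymmC a E => w t - c (x i)) hf) s
      rw [← h7, hvext]
      exact h6
  have htel : k.shellSum (N + 1) y v = -∑ i ∈ Finset.range (N + 1),
      (k.resolvent a (y (i + 1)) (f - ContinuousMap.const _ (c (x i)))
        - k.resolvent a (y i) (f - ContinuousMap.const _ (c (x i)))) := by
    rw [shellSum, ← Finset.sum_neg_distrib]
    refine Finset.sum_congr rfl fun i hi => ?_
    have hi := Finset.mem_range.1 hi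
    rw [hk.resolvent_sub_resolvent (hyI i hi.le) (hyI (i + 1) hi), neg_neg]
  -- The increments of ψ telescope; those of q, applied to c(x i), form the Stieltjes sum after
  -- summation by parts. The small quantity `shellSum` is their difference.
  have hval : (k.shellSum (N + 1) y v).extend t =
      (∑ i ∈ Finset.range (N + 1), (k.unitSol a t (y (i + 1)) - k.unitSol a t (y i)) (c (x i))) -
        ((k.resolvent a a f).extend t - (k.resolvent a |t| f).extend t) := by
    have h1 : (k.resolvent a a f).extend t - (k.resolvent a |t| f).extend t
        = ∑ i ∈ Finset.range (N + 1), ((k.resolvent a (y (i + 1)) f).extend t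
          - (k.resolvent a (y i) f).extend t) := by
      rw [Finset.sum_range_sub (fun i => (k.resolvent a (y i) f).extend t), hy0, hyN]
    rw [htel, h1, SymmC.extend_apply _ ht, ContinuousMap.neg_apply, ContinuousMap.sum_apply,
      ← Finset.sum_sub_distrib, ← Finset.sum_neg_distrib]
    refine Finset.sum_congr rfl fun i hi => ?_
    rw [ContinuousMap.sub_apply, ← SymmC.extend_apply _ ht, ← SymmC.extend_apply _ ht, map_sub,
      map_sub, SymmC.extend_sub, SymmC.extend_sub, _root_.sub_apply, unitSol_apply, unitSol_apply]
    beta_reduce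
    abel
  have hdiag : k.unitSol a t |t| (c |t|) = (k.resolvent a |t| f).extend t := by
    have htI : |t| ∈ Icc 0 a := ⟨abs_nonneg t, abs_le.2 ⟨ht.1, ht.2⟩⟩
    rw [← habs _ htI f hf t, hcf _ htI]
    exact (habs _ htI (ContinuousMap.const _ (c |t|)) rfl t).symm
  rw [sum_tagPoints (fun ξ => k.unitSol a t ξ) c, hxN, hx0, hdiag]
  have hfin : ‖(k.shellSum (N + 1) y v).extend t‖ < ε :=
    (SymmC.norm_extend_le _ t).trans_lt (hbound.trans_lt (by
      rw [mul_div_assoc', mul_comm K, mul_div_mul_right _ _ hK.ne']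
      linarith))
  rw [hval, norm_sub_rev] at hfin
  refine lt_of_eq_of_lt (congrArg norm ?_) hfin
  beta_reduce
  abel

end EvenKernel

/-! ### The Stieltjes integral of q* against a continuous function -/

/-- Averages over shrinking intervals. -/
theorem tendsto_average_of_near {F : Type*} [NormedAddCommGroup F] [NormedSpace ℝ F]
    [CompleteSpace F] {Φ : ℝ → ℝ → F} {c : ℝ → ℝ} {L : F} (hΦ : ∀ r, Continuous (Φ r))
    (h : ∀ ε > 0, ∀ᶠ r in 𝓝[>] (0 : ℝ), ∀ t ∈ Icc (c r) (c r + 2 * r), ‖Φ r t - L‖ ≤ ε) :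
    Tendsto (fun r => (2 * r)⁻¹ • ∫ t in (c r)..(c r + 2 * r), Φ r t) (𝓝[>] 0) (𝓝 L) := by
  refine Metric.tendsto_nhds.2 fun ε hε => ?_
  filter_upwards [h (ε / 2) (half_pos hε), self_mem_nhdsWithin] with r hr hr0
  have hr0 : 0 < r := hr0
  have hle : c r ≤ c r + 2 * r := by linarith
  have h1 := norm_setIntegral_Ioc_sub_le hle ((hΦ r).integrableOn_Icc.mono_set
    Ioc_subset_Icc_self) hr
  rw [add_sub_cancel_left, ← intervalIntegral.integral_of_le hle] at h1
  have h2 : (2 * r)⁻¹ • (∫ t in (c r)..(c r + 2 * r), Φ r t) - L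
      = (2 * r)⁻¹ • ((∫ t in (c r)..(c r + 2 * r), Φ r t) - (2 * r) • L) := by
    rw [smul_sub, smul_smul, inv_mul_cancel₀ (by positivity), one_smul]
  rw [dist_eq_norm, h2, norm_smul, Real.norm_eq_abs, abs_of_pos (by positivity)]
  refine (mul_le_mul_of_nonneg_left h1 (by positivity)).trans_lt ?_
  field_simp
  linarith

theorem sum_indicator_Ioc {E : Type*} [AddCommMonoid E] {N : ℕ} {y : ℕ → ℝ}
    (hy : ∀ k < N, y k ≤ y (k + 1)) (f : ℝ → E) (s : ℝ) :
    ∑ i ∈ Finset.range N, (Ioc (y i) (y (i + 1))).indicator f s =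
      (Ioc (y 0) (y N)).indicator f s := by
  induction N with
  | zero => simp
  | succ N ih =>
    have h1 : y 0 ≤ y N := le_of_forall_le_succ hy (Nat.zero_le _) (Nat.le_succ _)
    have hd : Disjoint (Ioc (y 0) (y N)) (Ioc (y N) (y (N + 1))) := by
      rw [Set.disjoint_left]
      rintro x ⟨_, h2⟩ ⟨h3, _⟩
      linarith
    rw [Finset.sum_range_succ, ih fun i hi => hy i (by omega),
      ← Ioc_union_Ioc_eq_Ioc h1 (hy N (Nat.lt_succ_self N)), indicator_union_of_disjoint hd]

namespace EvenKernel

variable {E : Type*} [NormedAddCommGroup E] [NormedSpace ℂ E] {k : EvenKernel E} {u v : ℝ → E}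
  {C D : ℝ} {a : ℝ} [ha : Fact (0 < a)]

theorem conv_shift (u : ℝ → E) (t r : ℝ) : k.conv u (t - r) = k.conv (fun s => u (s - r)) t := by
  rw [conv, conv, ← integral_sub_right_eq_self (fun s => k.toFun (t - r - s) (u s)) r]
  refine integral_congr_ae (ae_of_all _ fun s => ?_)
  simp only
  rw [sub_sub_sub_cancel_right]

variable (k a) in
/-- The truncated convolution of a bounded function, as an element of `C[-a, a]`. -/
def truncLift (ξ : ℝ) (g : ℝ → E) : SymmC a E := SymmC.ofFun a (k.truncConv ξ g)

theorem extend_truncLift (hu : BddMeas u C) (ξ : ℝ) {t : ℝ} (ht : t ∈ Icc (-a) a) :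
    (k.truncLift a ξ u).extend t = k.truncConv ξ u t :=
  SymmC.extend_ofFun (continuous_truncConv hu ξ) ht

theorem truncLift_sub (hu : BddMeas u C) (hv : BddMeas v D) (ξ : ℝ) :
    k.truncLift a ξ (fun s => u s - v s) = k.truncLift a ξ u - k.truncLift a ξ v := by
  ext t
  rw [ContinuousMap.sub_apply, ← SymmC.extend_coe, ← SymmC.extend_coe (k.truncLift a ξ u),
    ← SymmC.extend_coe (k.truncLift a ξ v), extend_truncLift hu ξ t.2, extend_truncLift hv ξ t.2,
    extend_truncLift (hu.sub hv) ξ t.2, truncConv_sub hu hv]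

theorem truncLift_add (hu : BddMeas u C) (hv : BddMeas v D) (ξ : ℝ) :
    k.truncLift a ξ (fun s => u s + v s) = k.truncLift a ξ u + k.truncLift a ξ v := by
  ext t
  rw [ContinuousMap.add_apply, ← SymmC.extend_coe, ← SymmC.extend_coe (k.truncLift a ξ u),
    ← SymmC.extend_coe (k.truncLift a ξ v), extend_truncLift hu ξ t.2, extend_truncLift hv ξ t.2,
    extend_truncLift (hu.add hv) ξ t.2, truncConv_add hu hv]

theorem norm_truncLift_le (hu : BddMeas u C) (ξ : ℝ) : ‖k.truncLift a ξ u‖ ≤ k.mass * C :=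
  (ContinuousMap.norm_le _ (mul_nonneg k.mass_nonneg hu.nonneg)).2 fun t => by
    rw [← SymmC.extend_coe, extend_truncLift hu ξ t.2]
    exact norm_truncConv_le hu ξ t

theorem continuousOn_truncLift (hu : BddMeas u C) :
    ContinuousOn (fun ξ => k.truncLift a ξ u) (Ici 0) := by
  refine continuousOn_Ici_of_increments fun ε hε => ?_
  have hC : 0 < C + 1 := by linarith [hu.nonneg]
  obtain ⟨δ, hδ, h⟩ := k.exists_setIntegral_norm_le (div_pos hε hC)
  refine ⟨δ / 2, by positivity, fun ξ ξ' h0 h1 h2 => (ContinuousMap.norm_le _ hε.le).2 fun t => ?_⟩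
  rw [ContinuousMap.sub_apply, ← SymmC.extend_coe, ← SymmC.extend_coe (k.truncLift a ξ u),
    extend_truncLift hu _ t.2, extend_truncLift hu _ t.2, truncConv_sub_truncConv hu h1]
  refine (norm_conv_indicator_le (measurableSet_shell _ _) (fun s _ => hu.bound s) _).trans ?_
  have h3 := h _ (measurableSet_shell ξ ξ') (by
    rw [volume_shell h0 h1]
    exact (ENNReal.ofReal_lt_ofReal_iff hδ).2 (by linarith)) t
  refine (mul_le_mul_of_nonneg_right h3 hu.nonneg).trans ?_
  rw [div_mul_eq_mul_div, div_le_iff₀ hC]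
  nlinarith [hu.nonneg]

variable (k a) in
/-- The truncated convolution of the solution of the truncated equation with a bounded measurable
right-hand side `g`. -/
def response (ξ : ℝ) (g : ℝ → E) : SymmC a E := k.resolvent a ξ (k.truncLift a ξ g)

variable (k a) in
/-- The solution of the truncated equation with a bounded measurable right-hand side `g`. -/
def bddSol (ξ : ℝ) (g : ℝ → E) (t : ℝ) : E := g t - (k.response a ξ g).extend t

theorem bddMeas_bddSol (hu : BddMeas u C) (ξ : ℝ) :
    BddMeas (k.bddSol a ξ u) (C + ‖k.resolvent a ξ‖ * (k.mass * C)) := by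
  refine (hu.sub (k.response a ξ u).bddMeas_extend).mono ?_
  gcongr
  exact (ContinuousLinearMap.le_opNorm _ _).trans
    (mul_le_mul_of_nonneg_left (norm_truncLift_le hu ξ) (norm_nonneg _))

/-- Right-hand sides with jumps must be admitted, as step functions occur below. The solution then
jumps too, but its truncated convolution is continuous and has boundary values. -/
theorem Regular.truncConv_bddSol (hk : k.Regular a) {ξ : ℝ} (hξ : ξ ∈ Icc 0 a)
    (hu : BddMeas u C) {t : ℝ} (ht : t ∈ Icc (-a) a) :
    k.truncConv ξ (k.bddSol a ξ u) t = (k.response a ξ u).extend t := by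
  have h1 := hk.extend_resolvent_add hξ (k.truncLift a ξ u) ht
  have h2 : k.truncConv ξ (k.bddSol a ξ u) t
      = k.truncConv ξ u t - k.truncConv ξ (k.response a ξ u).extend t :=
    truncConv_sub hu (k.response a ξ u).bddMeas_extend ξ t
  rw [extend_truncLift hu ξ ht] at h1
  rw [h2, ← h1]
  exact add_sub_cancel_right _ _

variable [FiniteDimensional ℂ E]

/-- Transposition moves the convolution onto q*, read on the interval shifted by `ρ`; the
inequalities keep this interval inside [-ξ, ξ], and the transposed equation evaluates the result. -/
theorem Regular.integral_dualSol_truncConv_shift (hk : k.Regular a) {ξ η ρ : ℝ}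
    (hξ : ξ ∈ Icc 0 a) (hη : 0 ≤ η) (h1 : η + ρ ≤ ξ) (h2 : η - ρ ≤ ξ) (hv : BddMeas v C) :
    ∫ t in (-ξ)..ξ, k.dualSol a t ξ (k.truncConv η v (t - ρ)) =
      ∫ s in (-η)..η, (v s - k.dualSol a (s + ρ) ξ (v s)) := by
  have : CompleteSpace E := FiniteDimensional.complete ℂ E
  have hvs : BddMeas (fun s => v (s - ρ)) C :=
    ⟨hv.aesm.comp_measurePreserving (measurePreserving_sub_right volume ρ), fun s => hv.bound _⟩
  have hind : (fun s => (Ioc (-η) η).indicator v (s - ρ))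
      = (Ioc (-η + ρ) (η + ρ)).indicator fun s => v (s - ρ) := by
    ext s
    simp only [indicator_apply, mem_Ioc, lt_sub_iff_add_lt, sub_le_iff_le_add]
  have hL : ∀ t, k.truncConv η v (t - ρ)
      = k.conv ((Ioc (-η + ρ) (η + ρ)).indicator fun s => v (s - ρ)) t := fun t => by
    rw [truncConv, conv_shift, hind]
  simp_rw [hL]
  rw [intervalIntegral.integral_of_le (by linarith [hξ.1]),
    setIntegral_apply_conv (k.bddMeas_dualSol a ξ) hvs measurableSet_Ioc measurableSet_Ioc
      (by simp),
    ← sub_add_cancel (∫ s in (-η)..η, (v s - k.dualSol a (s + ρ) ξ (v s))) 0, add_zero, sub_zero]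
  have h3 := intervalIntegral.integral_comp_add_right
    (fun s => v (s - ρ) - k.dualSol a s ξ (v (s - ρ))) (a := -η) (b := η) ρ
  simp only [add_sub_cancel_right] at h3
  rw [h3, intervalIntegral.integral_of_le (by linarith)]
  refine setIntegral_congr_fun measurableSet_Ioc fun s hs => ?_
  have h4 := hk.dualSol_add hξ (t := s) ⟨by linarith [hs.1, hξ.2], by linarith [hs.2, hξ.2]⟩
  have h5 : k.dual.conv ((Ioc (-ξ) ξ).indicator fun s => k.dualSol a s ξ) s
      = 1 - k.dualSol a s ξ := eq_sub_of_add_eq' h4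
  simp only [h5]
  rfl

/-- The symmetric differences of `q*` paired with a right-hand side, in terms of boundary values
of the truncated convolution. -/
theorem Regular.integral_dualSol_difference (hk : k.Regular a) {ξ r : ℝ}
    (hξ : ξ ∈ Icc 0 a) (hr : 0 ≤ r) (hrξ : r ≤ ξ) (hv : BddMeas v C) :
    ∫ t in (-(ξ - r))..(ξ - r), (k.dualSol a (t + r) ξ - k.dualSol a (t - r) ξ)
        (v t + k.truncConv (ξ - r) v t) =
      (∫ t in (ξ - 2 * r)..(ξ - 2 * r + 2 * r),
        k.dualSol a t ξ (k.truncConv (ξ - r) v (t + r))) -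
      ∫ t in (-ξ)..(-ξ + 2 * r), k.dualSol a t ξ (k.truncConv (ξ - r) v (t - r)) := by
  have : CompleteSpace E := FiniteDimensional.complete ℂ E
  set η := ξ - r with hη
  have hη0 : 0 ≤ η := by linarith
  set w := k.truncConv η v with hw
  have hwc : Continuous w := continuous_truncConv hv η
  have hp : Continuous fun t => k.dualSol a t ξ :=
    hk.continuous_dualSol continuous_id continuous_const
  have hc : ∀ ρ σ : ℝ, Continuous fun t => k.dualSol a (t + σ) ξ (w (t + ρ)) := fun ρ σ =>
    (hp.comp (continuous_id.add continuous_const)).clm_apply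
      (hwc.comp (continuous_id.add continuous_const))
  have hi : ∀ ρ σ b c : ℝ, IntervalIntegrable (fun t => k.dualSol a (t + σ) ξ (w (t + ρ)))
      volume b c := fun ρ σ b c => (hc ρ σ).intervalIntegrable b c
  have hvi : ∀ σ : ℝ, IntervalIntegrable (fun t => k.dualSol a (t + σ) ξ (v t)) volume (-η) η :=
    fun σ => by
      rw [intervalIntegrable_iff_integrableOn_Ioc_of_le (by linarith)]
      refine BddMeas.integrableOn (C := ‖k.dual.resolvent a ξ (ContinuousMap.const _ 1)‖ * C) ?_
        (by simp)
      exact bddMeas_apply ⟨(hp.comp (continuous_id.add continuous_const)).aestronglyMeasurable,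
        fun s => (k.bddMeas_dualSol a ξ).bound _⟩ hv
  have hv0 : IntervalIntegrable v volume (-η) η := by
    rw [intervalIntegrable_iff_integrableOn_Ioc_of_le (by linarith)]
    exact hv.integrableOn (by simp)
  -- The terms ∫ v of the two shifted identities cancel in the difference. After substitution the
  -- integrals of `w` cancel as well, except over two boundary layers of width 2r; truncating at ξ -
  -- r leaves room for both shifts.
  have s1 := hk.integral_dualSol_truncConv_shift hξ hη0 (ρ := r) (by linarith) (by linarith) hv
  have s2 := hk.integral_dualSol_truncConv_shift hξ hη0 (ρ := -r) (by linarith) (by linarith) hv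
  rw [intervalIntegral.integral_sub hv0 (hvi _)] at s1 s2
  have c1 := intervalIntegral.integral_comp_add_right
    (fun t => k.dualSol a t ξ (w (t - r))) (a := -η) (b := η) r
  have c2 := intervalIntegral.integral_comp_add_right
    (fun t => k.dualSol a t ξ (w (t + r))) (a := -η) (b := η) (-r)
  simp only [add_sub_cancel_right, neg_add_cancel_right] at c1 c2
  have hi1 : ∀ b c, IntervalIntegrable (fun t => k.dualSol a t ξ (w (t - r))) volume b c :=
    fun b c => by simpa using! hi (-r) 0 b c
  have hi2 : ∀ b c, IntervalIntegrable (fun t => k.dualSol a t ξ (w (t + r))) volume b c :=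
    fun b c => by simpa using! hi r 0 b c
  have a1 := intervalIntegral.integral_add_adjacent_intervals (hi1 (-ξ) (-η + r)) (hi1 (-η + r) ξ)
  have a2 := intervalIntegral.integral_add_adjacent_intervals (hi2 (-ξ) (η + -r)) (hi2 (η + -r) ξ)
  have e1 : η + r = ξ := by rw [hη]; ring
  have e2 : -η + -r = -ξ := by rw [hη]; ring
  have e3 : -ξ + 2 * r = -η + r := by rw [hη]; ring
  have e4 : ξ - 2 * r + 2 * r = ξ := by ring
  have e5 : ξ - 2 * r = η + -r := by rw [hη]; ring
  rw [e1] at c1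
  rw [e2] at c2
  simp only [sub_neg_eq_add] at s2
  rw [e3, e4, e5]
  have hL : ∫ t in (-η)..η, (k.dualSol a (t + r) ξ - k.dualSol a (t - r) ξ) (v t + w t)
      = ((∫ t in (-η)..η, k.dualSol a (t + r) ξ (v t)) + ∫ t in (-η)..η, k.dualSol a (t + r) ξ (w t))
        - ((∫ t in (-η)..η, k.dualSol a (t + -r) ξ (v t))
          + ∫ t in (-η)..η, k.dualSol a (t + -r) ξ (w t)) := by
    have hw1 : IntervalIntegrable (fun t => k.dualSol a (t + r) ξ (w t)) volume (-η) η := by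
      simpa using! hi 0 r (-η) η
    have hw2 : IntervalIntegrable (fun t => k.dualSol a (t + -r) ξ (w t)) volume (-η) η := by
      simpa using! hi 0 (-r) (-η) η
    rw [← intervalIntegral.integral_add (hvi _) hw1, ← intervalIntegral.integral_add (hvi _) hw2,
      ← intervalIntegral.integral_sub ((hvi _).add hw1) ((hvi _).add hw2)]
    refine intervalIntegral.integral_congr fun t _ => ?_
    simp only [_root_.sub_apply, map_add, sub_eq_add_neg t r]
    abel
  rw [hL, c1, c2]
  rw [← a1] at s1
  rw [← a2] at s2
  rw [eq_sub_of_add_eq' s1, eq_sub_of_add_eq s2]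
  abel

/-- The boundary functional that represents `∫ dq* g`. -/
def boundaryFunctional (k : EvenKernel E) (a : ℝ) [Fact (0 < a)] (ξ : ℝ) (g : ℝ → E) : E :=
  k.dualSol a ξ ξ ((k.response a ξ g).extend ξ) -
    k.dualSol a (-ξ) ξ ((k.response a ξ g).extend (-ξ))

theorem Regular.tendsto_integral_difference (hk : k.Regular a) {ξ : ℝ} (hξ : ξ ∈ Ioc 0 a)
    (hu : BddMeas u C) :
    Tendsto (fun r => (2 * r)⁻¹ • ∫ t in (-(ξ - r))..(ξ - r),
      (k.dualSol a (t + r) ξ - k.dualSol a (t - r) ξ) (u t)) (𝓝[>] 0)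
      (𝓝 (k.boundaryFunctional a ξ u)) := by
  have : CompleteSpace E := FiniteDimensional.complete ℂ E
  have hξ' : ξ ∈ Icc 0 a := Ioc_subset_Icc_self hξ
  obtain ⟨K, hK, hres⟩ := hk.exists_norm_resolvent_le
  set B := C + K * (k.mass * C) with hB
  have hm := k.mass_nonneg
  have hC := hu.nonneg
  have hB0 : 0 ≤ B := by positivity
  have hbd : ∀ η, BddMeas (k.bddSol a η u) B := fun η => (bddMeas_bddSol hu η).mono (by
    rw [hB]
    gcongr
    exact hres η)
  have hp : Continuous fun t => k.dualSol a t ξ :=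
    hk.continuous_dualSol continuous_id continuous_const
  set P := ‖k.dual.resolvent a ξ (ContinuousMap.const _ 1)‖ with hP
  have hP0 : 0 ≤ P := norm_nonneg _
  have hpb : ∀ t, ‖k.dualSol a t ξ‖ ≤ P := (k.bddMeas_dualSol a ξ).bound
  have hresp : ∀ ε > 0, ∀ᶠ r in 𝓝[>] (0 : ℝ),
      ‖k.response a (ξ - r) u - k.response a ξ u‖ ≤ ε := fun ε hε => by
    have h1 : ContinuousAt (fun η => k.response a η u) ξ :=
      hk.continuous_resolvent.continuousAt.clm_apply
        ((continuousOn_truncLift hu).continuousAt (Ici_mem_nhds hξ.1))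
    have h2 : Tendsto (fun r => ξ - r) (𝓝[>] (0 : ℝ)) (𝓝 ξ) := by
      have : Tendsto (fun r : ℝ => ξ - r) (𝓝 0) (𝓝 (ξ - 0)) :=
        (continuous_const.sub continuous_id).tendsto 0
      rw [sub_zero] at this
      exact this.mono_left nhdsWithin_le_nhds
    filter_upwards [Metric.tendsto_nhds.1 (h1.tendsto.comp h2) ε hε] with r hr
    rw [dist_eq_norm] at hr
    exact hr.le
  -- near an end point `σ` the integrand is close to its limit
  have hnear : ∀ σ ∈ Icc (-a) a, ∀ ε > 0, ∀ᶠ r in 𝓝[>] (0 : ℝ), ∀ t x : ℝ, |t - σ| ≤ 2 * r →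
      |x - σ| ≤ r → ‖k.dualSol a t ξ (k.truncConv (ξ - r) (k.bddSol a (ξ - r) u) x) -
        k.dualSol a σ ξ ((k.response a ξ u).extend σ)‖ ≤ ε := fun σ hσ ε hε => by
    set Q := ‖(k.response a ξ u).extend σ‖ with hQ
    have hQ0 : 0 ≤ Q := norm_nonneg _
    -- Three errors of ε/3: continuity of q*, equicontinuity of the convolutions (uniform in r
    -- through the bound `B`), and continuity of the response in the truncation.
    obtain ⟨δ1, hδ1, h1⟩ := Metric.continuous_iff.1 hp σ (ε / (3 * (Q + 1))) (by positivity)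
    obtain ⟨δ2, hδ2, h2⟩ := k.exists_norm_conv_sub_le
      (ε := ε / (3 * (P + 1) * (B + 1))) (by positivity)
    have h3 := hresp (ε / (3 * (P + 1))) (by positivity)
    filter_upwards [h3, self_mem_nhdsWithin, mem_nhdsWithin_of_mem_nhds
      (Iio_mem_nhds (show (0 : ℝ) < min (δ1 / 2) (min δ2 ξ) by
        have := hξ.1
        positivity))] with r h3 hr0 hr t x ht hx
    have hr0 : 0 < r := hr0
    have hr : r < min (δ1 / 2) (min δ2 ξ) := hr
    have hrd1 : r < δ1 / 2 := hr.trans_le (min_le_left _ _)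
    have hrd2 : r < δ2 := hr.trans_le ((min_le_right _ _).trans (min_le_left _ _))
    have hrξ : r < ξ := hr.trans_le ((min_le_right _ _).trans (min_le_right _ _))
    have hη : ξ - r ∈ Icc 0 a := ⟨by linarith, by linarith [hξ.2]⟩
    have d1 := (h1 t (by rw [Real.dist_eq]; linarith)).le
    have d2 := h2 x σ (by linarith) _ _ ((hbd (ξ - r)).indicator
      (measurableSet_Ioc (a := -(ξ - r)) (b := ξ - r)))
    have d3 : ‖(k.response a (ξ - r) u).extend σ - (k.response a ξ u).extend σ‖
        ≤ ε / (3 * (P + 1)) :=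
      ((k.response a (ξ - r) u - k.response a ξ u).norm_extend_le σ).trans h3
    rw [dist_eq_norm] at d1
    rw [← hk.truncConv_bddSol hη hu hσ] at d3
    change ‖k.truncConv (ξ - r) (k.bddSol a (ξ - r) u) x
      - k.truncConv (ξ - r) (k.bddSol a (ξ - r) u) σ‖ ≤ _ at d2
    set W := k.truncConv (ξ - r) (k.bddSol a (ξ - r) u) with hW
    set R := (k.response a ξ u).extend σ with hR
    have e : k.dualSol a t ξ (W x) - k.dualSol a σ ξ R = k.dualSol a t ξ (W x - W σ)
        + k.dualSol a t ξ (W σ - R) + (k.dualSol a t ξ - k.dualSol a σ ξ) R := by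
      simp only [map_sub, _root_.sub_apply]
      abel
    rw [e]
    have b1 : ‖k.dualSol a t ξ (W x - W σ)‖ ≤ ε / 3 := by
      refine ((k.dualSol a t ξ).le_of_opNorm_le (hpb t) _).trans
        ((mul_le_mul_of_nonneg_left d2 hP0).trans ?_)
      have : P * (ε / (3 * (P + 1) * (B + 1)) * B)
          = ε / 3 * ((P / (P + 1)) * (B / (B + 1))) := by field_simp
      rw [this]
      refine mul_le_of_le_one_right (by positivity) (mul_le_one₀ ?_ (by positivity) ?_) <;>
        rw [div_le_one (by positivity)] <;> linarith
    have b2 : ‖k.dualSol a t ξ (W σ - R)‖ ≤ ε / 3 := by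
      refine ((k.dualSol a t ξ).le_of_opNorm_le (hpb t) _).trans
        ((mul_le_mul_of_nonneg_left d3 hP0).trans ?_)
      have : P * (ε / (3 * (P + 1))) = ε / 3 * (P / (P + 1)) := by field_simp
      rw [this]
      refine mul_le_of_le_one_right (by positivity) ?_
      rw [div_le_one (by positivity)]
      linarith
    have b3 : ‖(k.dualSol a t ξ - k.dualSol a σ ξ) R‖ ≤ ε / 3 := by
      refine (ContinuousLinearMap.le_of_opNorm_le _ d1 _).trans ?_
      have : ε / (3 * (Q + 1)) * Q = ε / 3 * (Q / (Q + 1)) := by field_simp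
      rw [← hQ, this]
      refine mul_le_of_le_one_right (by positivity) ?_
      rw [div_le_one (by positivity)]
      linarith
    refine (norm_add_le_of_le (norm_add_le_of_le b1 b2) b3).trans (by linarith)
  have hcont : ∀ ρ r : ℝ, Continuous fun t =>
      k.dualSol a t ξ (k.truncConv (ξ - r) (k.bddSol a (ξ - r) u) (t + ρ)) := fun ρ r =>
    hp.clm_apply ((continuous_truncConv (hbd _) _).comp (continuous_id.add continuous_const))
  have l1 := tendsto_average_of_near (c := fun r => ξ - 2 * r)
    (Φ := fun r t => k.dualSol a t ξ (k.truncConv (ξ - r) (k.bddSol a (ξ - r) u) (t + r)))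
    (L := k.dualSol a ξ ξ ((k.response a ξ u).extend ξ)) (fun r => hcont r r) fun ε hε => by
      filter_upwards [hnear ξ ⟨by linarith [hξ.1, hξ.2], hξ.2⟩ ε hε] with r hr t ht
      refine hr t (t + r) ?_ ?_ <;> rw [abs_le] <;> constructor <;> linarith [ht.1, ht.2]
  have l2 := tendsto_average_of_near (c := fun _ => -ξ)
    (Φ := fun r t => k.dualSol a t ξ (k.truncConv (ξ - r) (k.bddSol a (ξ - r) u) (t - r)))
    (L := k.dualSol a (-ξ) ξ ((k.response a ξ u).extend (-ξ)))
    (fun r => by simpa only [sub_eq_add_neg] using! hcont (-r) r) fun ε hε => by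
      filter_upwards [hnear (-ξ) ⟨by linarith [hξ.1, hξ.2], by linarith [hξ.1, hξ.2]⟩ ε hε]
        with r hr t ht
      refine hr t (t - r) ?_ ?_ <;> rw [abs_le] <;> constructor <;> linarith [ht.1, ht.2]
  refine (l1.sub l2).congr' ?_
  filter_upwards [self_mem_nhdsWithin, mem_nhdsWithin_of_mem_nhds (Iio_mem_nhds hξ.1)]
    with r hr0 hr
  have hr0 : 0 < r := hr0
  have hr : r < ξ := hr
  -- The solution truncated at ξ - r is inserted for `v`, so that `v` plus its truncated convolution
  -- is the given `u`.
  rw [← smul_sub, ← hk.integral_dualSol_difference hξ' hr0.le hr.le (hbd (ξ - r))]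
  congr 1
  refine intervalIntegral.integral_congr fun t ht => ?_
  rw [uIcc_of_le (by linarith)] at ht
  have ht' : t ∈ Icc (-a) a := ⟨by linarith [ht.1, hξ.2], by linarith [ht.2, hξ.2]⟩
  rw [hk.truncConv_bddSol ⟨by linarith, by linarith [hξ.2]⟩ hu ht', bddSol, sub_add_cancel]

theorem bddMeas_indicator_const {S : Set ℝ} (hS : MeasurableSet S) (x : E) :
    BddMeas (S.indicator fun _ => x) ‖x‖ :=
  BddMeas.indicator ⟨aestronglyMeasurable_const, fun _ => le_rfl⟩ hS

/-- For a single step the symmetric differences telescope to averages of q* over windows of length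
2r near `y` and near -ξ. This second evaluation of the same limit identifies the functional. -/
theorem Regular.boundaryFunctional_indicator_Iic (hk : k.Regular a) {ξ : ℝ} (hξ : ξ ∈ Ioc 0 a)
    {y : ℝ} (hy : y ∈ Icc (-ξ) ξ) (x : E) :
    k.boundaryFunctional a ξ ((Iic y).indicator fun _ => x) =
      (k.dualSol a y ξ - k.dualSol a (-ξ) ξ) x := by
  have : CompleteSpace E := FiniteDimensional.complete ℂ E
  have hp : Continuous fun t => k.dualSol a t ξ x :=
    (hk.continuous_dualSol continuous_id continuous_const).clm_apply continuous_const
  have hlim : ∀ (σ : ℝ) (c : ℝ → ℝ), (∀ᶠ r in 𝓝[>] (0 : ℝ), c r ∈ Icc (σ - 2 * r) σ) →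
      Tendsto (fun r => (2 * r)⁻¹ • ∫ t in (c r)..(c r + 2 * r), k.dualSol a t ξ x) (𝓝[>] 0)
        (𝓝 (k.dualSol a σ ξ x)) := fun σ c hc =>
    tendsto_average_of_near (Φ := fun _ t => k.dualSol a t ξ x) (fun _ => hp) fun ε hε => by
      obtain ⟨δ, hδ, h⟩ := Metric.continuous_iff.1 hp σ ε hε
      filter_upwards [hc, mem_nhdsWithin_of_mem_nhds (Iio_mem_nhds (half_pos hδ))]
        with r hr hrδ t ht
      have hrδ : r < δ / 2 := hrδ
      have := (h t (by
        rw [Real.dist_eq, abs_lt]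
        constructor <;> linarith [ht.1, ht.2, hr.1, hr.2])).le
      rwa [dist_eq_norm] at this
  -- `y` is moved into [-(ξ - r), ξ - r] so that the window around it stays inside [-ξ, ξ] even when
  -- `y` is an end point.
  set m : ℝ → ℝ := fun r => max (-(ξ - r)) (min y (ξ - r)) with hm
  have hmem : ∀ r ∈ Ioo 0 ξ, m r ∈ Icc (y - r) (y + r) ∧ -(ξ - r) ≤ m r ∧ m r ≤ ξ - r := by
    intro r hr
    have h1 := hy.1
    have h2 := hy.2
    have h3 := hr.1
    have h4 := hr.2
    refine ⟨⟨?_, ?_⟩, le_max_left _ _, max_le (by linarith) (min_le_right _ _)⟩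
    · exact le_max_of_le_right (le_min (by linarith) (by linarith))
    · exact max_le (by linarith) ((min_le_left _ _).trans (by linarith))
  have hev : ∀ᶠ r in 𝓝[>] (0 : ℝ), r ∈ Ioo 0 ξ := Ioo_mem_nhdsGT hξ.1
  have l1 := hlim y (fun r => m r - r) (hev.mono fun r hr => by
    have := hmem r hr
    exact ⟨by linarith [this.1.1], by linarith [this.1.2]⟩)
  have l2 := hlim (-ξ) (fun r => -ξ) (hev.mono fun r hr => ⟨by linarith [hr.1], le_rfl⟩)
  refine tendsto_nhds_unique (hk.tendsto_integral_difference hξ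
    (bddMeas_indicator_const measurableSet_Iic x)) ?_
  rw [_root_.sub_apply]
  refine (l1.sub l2).congr' (hev.mono fun r hr => ?_)
  obtain ⟨_, hm1, hm2⟩ := hmem r hr
  rw [← smul_sub]
  congr 1
  have hi : ∀ b c, IntervalIntegrable (fun t => k.dualSol a t ξ x) volume b c :=
    fun b c => hp.intervalIntegrable b c
  have hf1 : Continuous fun t => k.dualSol a (t + r) ξ x :=
    hp.comp (continuous_id.add continuous_const)
  have hf2 : Continuous fun t => k.dualSol a (t - r) ξ x :=
    hp.comp (continuous_id.sub continuous_const)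
  have h1 : ∫ t in (-(ξ - r))..(ξ - r), (k.dualSol a (t + r) ξ - k.dualSol a (t - r) ξ)
      ((Iic y).indicator (fun _ => x) t)
      = ∫ t in (-(ξ - r))..(m r), (k.dualSol a (t + r) ξ - k.dualSol a (t - r) ξ) x := by
    rw [intervalIntegral.integral_of_le (by linarith [hr.2]), intervalIntegral.integral_of_le hm1,
      ← integral_indicator measurableSet_Ioc, ← integral_indicator measurableSet_Ioc]
    congr 1
    ext t
    by_cases ht : t ∈ Ioc (-(ξ - r)) (m r)
    · have h2 : t ∈ Ioc (-(ξ - r)) (ξ - r) := ⟨ht.1, ht.2.trans hm2⟩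
      have h3 : t ≤ y := by
        rcases le_max_iff.1 ht.2 with h | h
        · exact absurd ht.1 (not_lt.2 h)
        · exact h.trans (min_le_left _ _)
      rw [indicator_of_mem ht, indicator_of_mem h2, indicator_of_mem (show t ∈ Iic y from h3)]
    · rw [indicator_of_notMem ht]
      by_cases h2 : t ∈ Ioc (-(ξ - r)) (ξ - r)
      · have h3 : t ∉ Iic y := fun h3 => ht ⟨h2.1, le_max_of_le_right (le_min h3 h2.2)⟩
        rw [indicator_of_mem h2, indicator_of_notMem h3, map_zero]
      · rw [indicator_of_notMem h2]
  have h2 : ∫ t in (-(ξ - r))..(m r), (k.dualSol a (t + r) ξ - k.dualSol a (t - r) ξ) x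
      = (∫ t in (-(ξ - r) + r)..(m r + r), k.dualSol a t ξ x)
        - ∫ t in (-(ξ - r) - r)..(m r - r), k.dualSol a t ξ x := by
    rw [← intervalIntegral.integral_comp_add_right (fun t => k.dualSol a t ξ x),
      ← intervalIntegral.integral_comp_sub_right (fun t => k.dualSol a t ξ x),
      ← intervalIntegral.integral_sub
        (hf1.intervalIntegrable _ _) (hf2.intervalIntegrable _ _)]
    rfl
  rw [h1, h2, show m r - r + 2 * r = m r + r by ring, show -(ξ - r) - r = -ξ by ring,
    show -(ξ - r) + r = -ξ + 2 * r by ring]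
  have a1 := intervalIntegral.integral_add_adjacent_intervals (hi (-ξ) (-ξ + 2 * r))
    (hi (-ξ + 2 * r) (m r + r))
  have a2 := intervalIntegral.integral_add_adjacent_intervals (hi (-ξ) (m r - r))
    (hi (m r - r) (m r + r))
  rw [← a2] at a1
  rw [eq_sub_of_add_eq' a1]
  abel

theorem boundaryFunctional_sub (hu : BddMeas u C) (hv : BddMeas v D) (ξ : ℝ) :
    k.boundaryFunctional a ξ (fun s => u s - v s) =
      k.boundaryFunctional a ξ u - k.boundaryFunctional a ξ v := by
  simp only [boundaryFunctional, response, truncLift_sub hu hv, map_sub, SymmC.extend_sub]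
  abel

theorem boundaryFunctional_add (hu : BddMeas u C) (hv : BddMeas v D) (ξ : ℝ) :
    k.boundaryFunctional a ξ (fun s => u s + v s) =
      k.boundaryFunctional a ξ u + k.boundaryFunctional a ξ v := by
  simp only [boundaryFunctional, response, truncLift_add hu hv, map_add, SymmC.extend_add]
  abel

theorem boundaryFunctional_congr {ξ : ℝ} (h : ∀ s ∈ Ioc (-ξ) ξ, u s = v s) :
    k.boundaryFunctional a ξ u = k.boundaryFunctional a ξ v := by
  simp only [boundaryFunctional, response, truncLift, truncConv_congr h]

-- Together with the values on steps this says that q*(·, ξ) has bounded variation, in the form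
-- needed: sums of its increments applied to vectors are bounded by the largest vector.
variable (k a) in
theorem exists_norm_boundaryFunctional_le (ξ : ℝ) :
    ∃ K > 0, ∀ (u : ℝ → E) (C : ℝ), BddMeas u C → ‖k.boundaryFunctional a ξ u‖ ≤ K * C := by
  set P := ‖k.dual.resolvent a ξ (ContinuousMap.const _ 1)‖ with hP
  have hm := k.mass_nonneg
  refine ⟨2 * (P * (‖k.resolvent a ξ‖ * k.mass)) + 1, by positivity, fun u C hu => ?_⟩
  have h1 : ∀ t, ‖k.dualSol a t ξ ((k.response a ξ u).extend t)‖
      ≤ P * (‖k.resolvent a ξ‖ * (k.mass * C)) := fun t =>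
    ((k.dualSol a t ξ).le_of_opNorm_le ((k.bddMeas_dualSol a ξ).bound t) _).trans
      (mul_le_mul_of_nonneg_left ((SymmC.norm_extend_le _ t).trans
        ((ContinuousLinearMap.le_opNorm _ _).trans
        (mul_le_mul_of_nonneg_left (norm_truncLift_le hu ξ) (norm_nonneg _)))) (norm_nonneg _))
  refine (norm_sub_le_of_le (h1 ξ) (h1 (-ξ))).trans ?_
  linarith [hu.nonneg]

theorem Regular.boundaryFunctional_indicator_Ioc (hk : k.Regular a) {ξ : ℝ} (hξ : ξ ∈ Ioc 0 a)
    {y y' : ℝ} (hy : y ∈ Icc (-ξ) ξ) (hy' : y' ∈ Icc (-ξ) ξ) (hle : y ≤ y') (x : E) :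
    k.boundaryFunctional a ξ ((Ioc y y').indicator fun _ => x) =
      (k.dualSol a y' ξ - k.dualSol a y ξ) x := by
  have h : (Ioc y y').indicator (fun _ => x)
      = fun s => (Iic y').indicator (fun _ => x) s - (Iic y).indicator (fun _ => x) s := by
    rw [← Iic_sdiff_Iic, indicator_sdiff (Iic_subset_Iic.2 hle)]
    rfl
  rw [h, boundaryFunctional_sub (bddMeas_indicator_const measurableSet_Iic x)
    (bddMeas_indicator_const measurableSet_Iic x), hk.boundaryFunctional_indicator_Iic hξ hy',
    hk.boundaryFunctional_indicator_Iic hξ hy]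
  simp only [_root_.sub_apply]
  abel

/-- The Riemann–Stieltjes integral of `q*` against a continuous function. -/
theorem Regular.hasRSIntegral_dualSol (hk : k.Regular a) {ξ : ℝ} (hξ : ξ ∈ Ioc 0 a)
    (f : SymmC a E) :
    HasRSIntegral (fun s => k.dualSol a s ξ) f.extend (-ξ) ξ
      (k.dualSol a ξ ξ ((k.resolvent a ξ f).extend ξ - (k.resolvent a ξ f).extend (-ξ))) := by
  have : CompleteSpace E := FiniteDimensional.complete ℂ E
  have hξ' : ξ ∈ Icc 0 a := Ioc_subset_Icc_self hξ
  intro ε hε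
  obtain ⟨K, hK, hbd⟩ := k.exists_norm_boundaryFunctional_le a ξ
  have hεK : 0 < ε / (2 * K) := by positivity
  obtain ⟨δ, hδ, huc⟩ := Metric.uniformContinuousOn_iff.1
    ((isCompact_Icc (a := -ξ) (b := ξ)).uniformContinuousOn_of_continuous
      f.continuous_extend.continuousOn) _ hεK
  refine ⟨δ, hδ, fun N x τ hx0 hxN hpart => ?_⟩
  set y := tagPoints N x τ with hy
  have hmono := tagPoints_mono hpart
  have hy0 : y 0 = -ξ := hx0
  have hyN : y (N + 1) = ξ := tagPoints_last.trans hxN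
  have hyI : ∀ i ≤ N + 1, y i ∈ Icc (-ξ) ξ := fun i hi =>
    ⟨hy0 ▸ le_of_forall_le_succ hmono (Nat.zero_le i) hi,
      hyN ▸ le_of_forall_le_succ hmono hi le_rfl⟩
  have hxI : ∀ i < N + 1, x i ∈ Icc (-ξ) ξ := fun i hi =>
    ⟨(hyI i hi.le).1.trans (tagPoints_le hpart hi),
      (le_tagPoints hpart hi).trans (hyI (i + 1) hi).2⟩
  -- The step function with value f(x i) between y i and y (i + 1): its boundary functional is the
  -- Stieltjes sum, and it is uniformly close to `f`.
  set st : ℕ → ℝ → E := fun m s => ∑ i ∈ Finset.range m,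
    (Ioc (y i) (y (i + 1))).indicator (fun _ => f.extend (x i)) s with hst
  have hstep : ∀ m ≤ N + 1, ∃ C, BddMeas (st m) C ∧ k.boundaryFunctional a ξ (st m) =
      ∑ i ∈ Finset.range m, (k.dualSol a (y (i + 1)) ξ - k.dualSol a (y i) ξ)
        (f.extend (x i)) := by
    intro m
    induction m with
    | zero =>
      intro _
      refine ⟨0, ⟨by simp only [hst, Finset.range_zero, Finset.sum_empty]
                     exact aestronglyMeasurable_const, by simp [hst]⟩, ?_⟩
      have h0 : BddMeas (fun _ : ℝ => (0 : E)) 0 := ⟨aestronglyMeasurable_const, by simp⟩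
      have := boundaryFunctional_sub (k := k) (a := a) h0 h0 ξ
      simp only [sub_self] at this
      simpa [hst] using this
    | succ m ih =>
      intro hm
      obtain ⟨C, h1, h2⟩ := ih (by omega)
      have h3 := bddMeas_indicator_const (measurableSet_Ioc (a := y m) (b := y (m + 1)))
        (f.extend (x m))
      have h4 : st (m + 1) = fun s => st m s
          + (Ioc (y m) (y (m + 1))).indicator (fun _ => f.extend (x m)) s := by
        ext s
        exact Finset.sum_range_succ _ _
      refine ⟨_, h4 ▸ h1.add h3, ?_⟩
      rw [h4, boundaryFunctional_add h1 h3, h2, Finset.sum_range_succ,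
        hk.boundaryFunctional_indicator_Ioc hξ (hyI m (by omega)) (hyI (m + 1) hm)
          (hmono m (by omega))]
  obtain ⟨C, hC, hval⟩ := hstep (N + 1) le_rfl
  have hsmall : ∀ s, ‖(Ioc (-ξ) ξ).indicator (fun s => st (N + 1) s - f.extend s) s‖
      ≤ ε / (2 * K) := fun s => by
    by_cases hs : s ∈ Ioc (-ξ) ξ
    · rw [indicator_of_mem hs]
      have h1 := sum_indicator_Ioc hmono f.extend s
      have h2 := sum_indicator_Ioc hmono (fun _ => ε / (2 * K)) s
      have hs' : s ∈ Ioc (tagPoints N x τ 0) (tagPoints N x τ (N + 1)) := by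
        rw [← hy, hy0, hyN]
        exact hs
      rw [indicator_of_mem hs'] at h1 h2
      rw [← h1, ← h2, hst, ← Finset.sum_sub_distrib]
      refine norm_sum_le_of_le _ fun i hi => ?_
      have hi := Finset.mem_range.1 hi
      by_cases hsi : s ∈ Ioc (tagPoints N x τ i) (tagPoints N x τ (i + 1))
      · rw [indicator_of_mem hsi, indicator_of_mem hsi, indicator_of_mem hsi]
        have h3 := sub_tagPoints_lt hδ hpart hi
        have h4 := tagPoints_sub_lt hδ hpart hi
        have h5 := (huc (x i) (hxI i hi) s (Ioc_subset_Icc_self hs) (by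
          rw [Real.dist_eq, abs_lt]
          constructor <;> linarith [hsi.1, hsi.2])).le
        rwa [dist_eq_norm] at h5
      · rw [indicator_of_notMem hsi, indicator_of_notMem hsi, indicator_of_notMem hsi, sub_zero,
          norm_zero]
    · rw [indicator_of_notMem hs, norm_zero]
      exact hεK.le
  have hdiff := hbd _ _ ⟨((hC.sub f.bddMeas_extend).indicator
    (measurableSet_Ioc (a := -ξ) (b := ξ))).aesm, hsmall⟩
  rw [boundaryFunctional_congr (v := fun s => st (N + 1) s - f.extend s)
    fun s hs => indicator_of_mem hs _, boundaryFunctional_sub hC f.bddMeas_extend, hval] at hdiff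
  -- For continuous data the response is f - ψ, so the boundary terms of the summation by parts
  -- combine with it and leave ψ(ξ) and ψ(-ξ).
  have hresp : ∀ t ∈ Icc (-a) a, (k.response a ξ f.extend).extend t
      = f.extend t - (k.resolvent a ξ f).extend t := fun t ht => by
    have h1 : k.response a ξ f.extend = k.op a ξ (k.resolvent a ξ f) :=
      (hk.op_resolvent hξ' f).symm
    rw [h1, extend_op ξ _ ht, ← hk.extend_resolvent_add hξ' f ht, add_sub_cancel_left]
  rw [boundaryFunctional, hresp ξ ⟨by linarith [hξ.1, hξ.2], hξ.2⟩,
    hresp (-ξ) ⟨by linarith [hξ.1, hξ.2], by linarith [hξ.1, hξ.2]⟩] at hdiff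
  rw [sum_tagPoints (fun s => k.dualSol a s ξ) f.extend, hx0, hxN]
  have hfin : K * (ε / (2 * K)) < ε := by
    rw [mul_div_assoc', mul_comm K, mul_div_mul_right _ _ hK.ne']
    linarith
  refine lt_of_eq_of_lt ?_ (hdiff.trans_lt hfin)
  rw [norm_sub_rev, hk.dualSol_neg hξ' ξ]
  congr 1
  simp only [map_sub]
  abel

end EvenKernel

/-! ### Odd right-hand sides: primitives of the truncated solutions -/

namespace SymmC

variable {a : ℝ} [ha : Fact (0 < a)] {E : Type*} [NormedAddCommGroup E] [NormedSpace ℂ E]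

omit [NormedSpace ℂ E] in
theorem extend_neg_of_reflect {f : SymmC a E} (hf : f.reflect = -f) (t : ℝ) :
    f.extend (-t) = -f.extend t := by
  rw [← extend_reflect, hf, extend_neg]

theorem integral_extend_of_reflect [CompleteSpace E] {f : SymmC a E} (hf : f.reflect = -f)
    (r : ℝ) : ∫ s in (-r)..r, f.extend s = 0 := by
  have h := intervalIntegral.integral_comp_neg (a := -r) (b := r) f.extend
  simp only [extend_neg_of_reflect hf, neg_neg, intervalIntegral.integral_neg] at h
  have h2 : (2 : ℂ) • ∫ s in (-r)..r, f.extend s = 0 := by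
    rw [two_smul]
    nth_rw 1 [← h]
    exact neg_add_cancel _
  exact (smul_eq_zero.1 h2).resolve_left two_ne_zero

end SymmC

namespace EvenKernel

variable {E : Type*} [NormedAddCommGroup E] [NormedSpace ℂ E] {k : EvenKernel E} {u v : ℝ → E}
  {C D : ℝ}

theorem conv_eq_integral_apply_sub (u : ℝ → E) (t : ℝ) :
    k.conv u t = ∫ x, k.toFun x (u (t - x)) := by
  rw [conv, ← integral_sub_left_eq_self (fun x => k.toFun x (u (t - x))) volume t]
  simp only [sub_sub_cancel]

theorem bddMeas_primitive (hui : Integrable u) (b : ℝ) :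
    BddMeas (fun s => ∫ r in s..b, u r) (∫ r, ‖u r‖) := by
  refine ⟨?_, fun s => ?_⟩
  · have h := intervalIntegral.continuous_primitive
      (fun _ _ => hui.intervalIntegrable : ∀ c d, IntervalIntegrable u volume c d) b
    refine (h.neg.congr fun s => ?_).aestronglyMeasurable
    exact (intervalIntegral.integral_symm b s).symm
  · exact (intervalIntegral.norm_integral_le_integral_norm_uIoc (f := u)).trans
      (setIntegral_le_integral hui.norm (ae_of_all _ fun _ => norm_nonneg _))

/-- Convolution commutes with taking primitives, up to a constant. -/
theorem conv_primitive_sub [CompleteSpace E] (hui : Integrable u) (b : ℝ) {c t : ℝ}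
    (hct : c ≤ t) :
    k.conv (fun s => ∫ r in s..b, u r) t - k.conv (fun s => ∫ r in s..b, u r) c =
      -∫ r in Ioc c t, k.conv u r := by
  have hV := bddMeas_primitive hui b
  have hii : ∀ c d, IntervalIntegrable u volume c d := fun _ _ => hui.intervalIntegrable
  have hI : Integrable (fun p : ℝ × ℝ => k.toFun p.2 (u (p.1 - p.2)))
      ((volume.restrict (Ioc c t)).prod volume) := by
    have h : Integrable (fun p : ℝ × ℝ => k.toFun p.2 (u (p.1 - p.2)))
        (volume.prod volume) :=
      Integrable.convolution_integrand (ContinuousLinearMap.id ℂ (E →L[ℂ] E)) k.integrable hui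
    have h2 := h.integrableOn (s := Ioc c t ×ˢ univ)
    rwa [IntegrableOn, ← Measure.prod_restrict, Measure.restrict_univ] at h2
  have hint : ∀ r, Integrable fun x => k.toFun x ((fun s => ∫ r in s..b, u r) (r - x)) :=
    fun r => by
      refine ((integrable_apply (k := k) hV r).comp_sub_left r).congr (ae_of_all _ fun x => ?_)
      simp only [sub_sub_cancel]
  have h1 : ∫ r in Ioc c t, k.conv u r = ∫ x, ∫ r in Ioc c t, k.toFun x (u (r - x)) := by
    rw [← integral_integral_swap hI]
    exact integral_congr_ae (ae_of_all _ fun r => conv_eq_integral_apply_sub u r)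
  rw [h1, conv_eq_integral_apply_sub, conv_eq_integral_apply_sub, ← integral_sub (hint t) (hint c),
    ← integral_neg]
  refine integral_congr_ae (ae_of_all _ fun x => ?_)
  have h2 : IntegrableOn (fun r => u (r - x)) (Ioc c t) := (hui.comp_sub_right x).integrableOn
  simp only
  rw [ContinuousLinearMap.integral_comp_comm _ h2, ← map_sub, ← map_neg,
    ← intervalIntegral.integral_of_le hct, intervalIntegral.integral_comp_sub_right]
  congr 1
  rw [← intervalIntegral.integral_add_adjacent_intervals (hii (c - x) (t - x)) (hii (t - x) b)]
  abel

variable {a : ℝ} [ha : Fact (0 < a)]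

variable (k a) in
/-- The primitive `∫_t^ξ ψ_ξ`, extended by zero, of the solution of the truncated equation. -/
def solPrimitive (f : SymmC a E) (ξ t : ℝ) : E :=
  ∫ s in t..a, (Ioc (-ξ) ξ).indicator (k.resolvent a ξ f).extend s

omit [NormedSpace ℂ E] in
theorem integrable_indicator_extend (g : SymmC a E) (ξ : ℝ) :
    Integrable ((Ioc (-ξ) ξ).indicator g.extend) :=
  g.bddMeas_extend.integrable_indicator measurableSet_Ioc (by simp)

theorem bddMeas_solPrimitive (f : SymmC a E) (ξ : ℝ) : BddMeas (k.solPrimitive a f ξ)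
    (∫ r, ‖(Ioc (-ξ) ξ).indicator (k.resolvent a ξ f).extend r‖) :=
  bddMeas_primitive (integrable_indicator_extend _ _) a

theorem solPrimitive_of_le (f : SymmC a E) {ξ t : ℝ} (hξ : ξ ≤ a) (h : ξ ≤ t) :
    k.solPrimitive a f ξ t = 0 := by
  refine intervalIntegral.integral_zero_ae (ae_of_all _ fun s hs => indicator_of_notMem ?_ _)
  exact fun h1 => (lt_of_le_of_lt (le_min h hξ) hs.1).not_ge h1.2

theorem solPrimitive_eq (f : SymmC a E) {ξ t : ℝ} (hξ : ξ ≤ a) (ht : t ∈ Icc (-ξ) ξ) :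
    k.solPrimitive a f ξ t = ∫ s in t..ξ, (k.resolvent a ξ f).extend s := by
  have hi := integrable_indicator_extend (k.resolvent a ξ f) ξ
  have h0 := solPrimitive_of_le (k := k) f hξ le_rfl
  rw [solPrimitive] at h0 ⊢
  rw [← intervalIntegral.integral_add_adjacent_intervals (b := ξ) hi.intervalIntegrable
    hi.intervalIntegrable, h0, add_zero]
  rw [intervalIntegral.integral_of_le ht.2, intervalIntegral.integral_of_le ht.2]
  exact setIntegral_congr_fun measurableSet_Ioc fun s hs =>
    indicator_of_mem (show s ∈ Ioc (-ξ) ξ from ⟨ht.1.trans_lt hs.1, hs.2⟩) _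

section odd

variable {f : SymmC a E} {ξ ξ' : ℝ}

theorem Regular.resolvent_odd (hk : k.Regular a) (hξ : ξ ∈ Icc 0 a) (hf : f.reflect = -f) :
    (k.resolvent a ξ f).reflect = -k.resolvent a ξ f := by
  rw [← hk.resolvent_reflect hξ, hf, map_neg]

variable [CompleteSpace E]

theorem Regular.solPrimitive_of_le_neg (hk : k.Regular a) (hξ : ξ ∈ Icc 0 a)
    (hf : f.reflect = -f) {t : ℝ} (ht : t ≤ -ξ) : k.solPrimitive a f ξ t = 0 := by
  have hi := integrable_indicator_extend (k.resolvent a ξ f) ξ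
  have h1 := solPrimitive_eq (k := k) f hξ.2 (t := -ξ) ⟨le_rfl, by linarith [hξ.1]⟩
  rw [SymmC.integral_extend_of_reflect (hk.resolvent_odd hξ hf), solPrimitive] at h1
  rw [solPrimitive, ← intervalIntegral.integral_add_adjacent_intervals (b := -ξ)
    hi.intervalIntegrable hi.intervalIntegrable, h1, add_zero]
  refine intervalIntegral.integral_zero_ae (ae_of_all _ fun s hs => indicator_of_notMem ?_ _)
  rw [uIoc_of_le ht] at hs
  exact fun h => h.1.not_ge hs.2

/-- The total integral of an odd solution is zero, so its primitive vanishes on both sides of [-ξ,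
ξ]. The truncation is then superfluous, and a full convolution commutes with primitives. -/
theorem Regular.truncConv_solPrimitive (hk : k.Regular a) (hξ : ξ ∈ Icc 0 a)
    (hf : f.reflect = -f) :
    k.truncConv ξ (k.solPrimitive a f ξ) = k.conv (k.solPrimitive a f ξ) := by
  rw [truncConv]
  congr 1
  refine indicator_eq_self.2 fun t ht => ?_
  by_contra hn
  rw [mem_Ioc, not_and_or, not_lt, not_le] at hn
  rcases hn with h | h
  · exact ht (hk.solPrimitive_of_le_neg hξ hf h)
  · exact ht (solPrimitive_of_le f hξ.2 h.le)

/-- The primitive of an odd function is even, so near either end it is an integral over an interval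
of length at most `h`. -/
theorem Regular.norm_solPrimitive_le (hk : k.Regular a) (hξ : ξ ∈ Icc 0 a)
    (hf : f.reflect = -f) {h s : ℝ} (hs : ξ - h ≤ |s|) (hsξ : |s| ≤ ξ) :
    ‖k.solPrimitive a f ξ s‖ ≤ ‖k.resolvent a ξ f‖ * h := by
  have hψ := k.resolvent a ξ f |>.continuous_extend
  have h1 : k.solPrimitive a f ξ s = ∫ r in |s|..ξ, (k.resolvent a ξ f).extend r := by
    rw [solPrimitive_eq f hξ.2 (abs_le.1 hsξ)]
    rcases abs_choice s with h1 | h1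
    · rw [h1]
    · rw [← intervalIntegral.integral_add_adjacent_intervals (b := -s)
        (hψ.intervalIntegrable _ _) (hψ.intervalIntegrable _ _), h1]
      have := SymmC.integral_extend_of_reflect (hk.resolvent_odd hξ hf) (-s)
      rw [neg_neg] at this
      rw [this, zero_add]
  rw [h1]
  refine (intervalIntegral.norm_integral_le_of_norm_le_const fun r _ =>
    SymmC.norm_extend_le _ r).trans (mul_le_mul_of_nonneg_left ?_ (norm_nonneg _))
  rw [abs_of_nonneg (sub_nonneg.2 hsξ)]
  linarith

/-- The truncated equation for ψ integrated once: up to sign the left side has derivative ψ + T(ξ)ψ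
= f. -/
theorem Regular.exists_solPrimitive_add_conv (hk : k.Regular a) (hξ : ξ ∈ Icc 0 a)
    (hf : f.reflect = -f) : ∃ x : E, ∀ t ∈ Icc (-ξ) ξ,
      k.solPrimitive a f ξ t + k.conv (k.solPrimitive a f ξ) t = x - ∫ s in 0..t, f.extend s := by
  refine ⟨k.conv (k.solPrimitive a f ξ) (-ξ) - ∫ s in (-ξ)..0, f.extend s, fun t ht => ?_⟩
  have hψ := k.resolvent a ξ f |>.continuous_extend
  have hfc := f.continuous_extend
  have h1 : k.conv (k.solPrimitive a f ξ) t - k.conv (k.solPrimitive a f ξ) (-ξ) = _ :=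
    conv_primitive_sub (integrable_indicator_extend (k.resolvent a ξ f) ξ) a ht.1
  have h2 : ∫ r in Ioc (-ξ) t, k.conv ((Ioc (-ξ) ξ).indicator (k.resolvent a ξ f).extend) r
      = (∫ r in (-ξ)..t, f.extend r) - ∫ r in (-ξ)..t, (k.resolvent a ξ f).extend r := by
    rw [← intervalIntegral.integral_sub (hfc.intervalIntegrable _ _) (hψ.intervalIntegrable _ _),
      intervalIntegral.integral_of_le ht.1]
    refine setIntegral_congr_fun measurableSet_Ioc fun r hr => ?_
    rw [← hk.extend_resolvent_add hξ f (t := r)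
      ⟨by linarith [hr.1, hξ.2], by linarith [hr.2, ht.2, hξ.2]⟩, add_sub_cancel_left]
    rfl
  have h3 := SymmC.integral_extend_of_reflect (hk.resolvent_odd hξ hf) ξ
  rw [← intervalIntegral.integral_add_adjacent_intervals (b := t)
    (hψ.intervalIntegrable _ _) (hψ.intervalIntegrable _ _), ← solPrimitive_eq f hξ.2 ht] at h3
  rw [h2] at h1
  rw [eq_add_of_sub_eq h1, ← intervalIntegral.integral_add_adjacent_intervals (a := -ξ) (b := 0)
    (c := t) (hfc.intervalIntegrable _ _) (hfc.intervalIntegrable _ _), eq_neg_of_add_eq_zero_right h3]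
  abel

/-- On [-ξ, ξ] the right-hand sides for `ξ` and `ξ'` differ by a constant vector, whose solution is
q applied to it, and by the contribution of the shell. -/
theorem Regular.exists_solPrimitive_sub (hk : k.Regular a) (hξ : ξ ∈ Icc 0 a)
    (hξ' : ξ' ∈ Icc 0 a) (hle : ξ ≤ ξ') (hf : f.reflect = -f) :
    ∃ x : E, ∀ t ∈ Icc (-ξ) ξ, k.solPrimitive a f ξ' t - k.solPrimitive a f ξ t =
      k.unitSol a t ξ x - (k.resolvent a ξ (SymmC.ofFun a
        (k.conv ((shell ξ ξ').indicator (k.solPrimitive a f ξ'))))).extend t := by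
  obtain ⟨x, hx⟩ := hk.exists_solPrimitive_add_conv hξ hf
  obtain ⟨x', hx'⟩ := hk.exists_solPrimitive_add_conv hξ' hf
  refine ⟨x' - x, fun t ht => ?_⟩
  have hb := bddMeas_solPrimitive (k := k) f ξ
  have hb' := bddMeas_solPrimitive (k := k) f ξ'
  have hcw : Continuous (k.conv ((shell ξ ξ').indicator (k.solPrimitive a f ξ'))) :=
    continuous_conv (hb'.indicator (measurableSet_shell _ _))
  refine (hk.eq_extend_resolvent hξ (hb'.sub hb) (g := ContinuousMap.const _ (x' - x)
    - SymmC.ofFun a (k.conv ((shell ξ ξ').indicator (k.solPrimitive a f ξ'))))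
    (fun s hs => ?_) t ht).trans ?_
  · have h1 := hx s hs
    have h2 := hx' s ⟨by linarith [hs.1], by linarith [hs.2]⟩
    rw [truncConv_sub hb' hb, hk.truncConv_solPrimitive hξ hf, SymmC.extend_sub]
    beta_reduce
    rw [SymmC.extend_const, SymmC.extend_ofFun hcw
      ⟨by linarith [hs.1, hξ.2], by linarith [hs.2, hξ.2]⟩,
      ← truncConv_sub_truncConv hb' hle, hk.truncConv_solPrimitive hξ' hf,
      eq_sub_of_add_eq' h1, eq_sub_of_add_eq' h2]
    abel
  · rw [map_sub, SymmC.extend_sub]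
    rfl

end odd

theorem norm_unitSol_le {K : ℝ} (hK : ∀ ξ, ‖k.resolvent a ξ‖ ≤ K) (t ξ : ℝ) (x : E) :
    ‖k.unitSol a t ξ x‖ ≤ K * ‖x‖ := by
  rw [unitSol_apply]
  refine (SymmC.norm_extend_le _ t).trans (((k.resolvent a ξ).le_of_opNorm_le (hK ξ) _).trans
    (mul_le_mul_of_nonneg_left ?_ ((norm_nonneg (k.resolvent a ξ)).trans (hK ξ))))
  exact (ContinuousMap.norm_le _ (norm_nonneg _)).2 fun _ => le_rfl

variable (k a) in
/-- The inverse of `q(ξ, ξ)`. -/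
def diagInv (ξ : ℝ) : E →L[ℂ] E := Ring.inverse (k.unitSol a (clampIcc a ξ) (clampIcc a ξ))

variable [FiniteDimensional ℂ E]

theorem Regular.continuous_diagInv (hk : k.Regular a)
    (hu : ∀ ξ ∈ Icc 0 a, IsUnit (k.unitSol a ξ ξ)) : Continuous (k.diagInv a) := by
  have : CompleteSpace E := FiniteDimensional.complete ℂ E
  refine continuous_iff_continuousAt.2 fun ξ => ?_
  obtain ⟨U, hU⟩ := hu _ (clampIcc_mem ha.out.le ξ)
  have h1 := NormedRing.inverse_continuousAt (R := E →L[ℂ] E) U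
  rw [hU] at h1
  exact ContinuousAt.comp (f := fun ξ => k.unitSol a (clampIcc a ξ) (clampIcc a ξ)) h1
    (hk.continuous_unitSol (continuous_clampIcc a) (continuous_clampIcc a)).continuousAt

omit [FiniteDimensional ℂ E] in
theorem unitSol_diagInv {ξ : ℝ} (hξ : ξ ∈ Icc 0 a) (hu : IsUnit (k.unitSol a ξ ξ)) (x : E) :
    k.unitSol a ξ ξ (k.diagInv a ξ x) = x := by
  rw [diagInv, clampIcc_of_mem hξ]
  exact congrArg (fun L : E →L[ℂ] E => L x) (Ring.mul_inverse_cancel _ hu)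

omit [FiniteDimensional ℂ E] in
theorem diagInv_unitSol {ξ : ℝ} (hξ : ξ ∈ Icc 0 a) (hu : IsUnit (k.unitSol a ξ ξ)) (x : E) :
    k.diagInv a ξ (k.unitSol a ξ ξ x) = x := by
  rw [diagInv, clampIcc_of_mem hξ]
  exact congrArg (fun L : E →L[ℂ] E => L x) (Ring.inverse_mul_cancel _ hu)

variable {f : SymmC a E}

theorem Regular.hasDerivWithinAt_solPrimitive (hk : k.Regular a)
    (hu : ∀ ξ ∈ Icc 0 a, IsUnit (k.unitSol a ξ ξ)) (hf : f.reflect = -f) {t ξ : ℝ}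
    (hξ : ξ ∈ Icc |t| a) :
    HasDerivWithinAt (fun ξ => k.solPrimitive a f ξ t)
      (k.unitSol a t ξ (k.diagInv a ξ ((k.resolvent a ξ f).extend ξ))) (Icc |t| a) ξ := by
  have : CompleteSpace E := FiniteDimensional.complete ℂ E
  have hG := hk.continuous_diagInv hu
  refine hasDerivWithinAt_of_increments (b := fun ξ =>
    k.unitSol a t ξ (k.diagInv a ξ ((k.resolvent a ξ f).extend ξ))) ?_ (fun ε hε => ?_) hξ
  · exact (hk.continuous_unitSol continuous_const continuous_id).clm_apply
      (hG.clm_apply (hk.continuous_sol f continuous_id continuous_id))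
  obtain ⟨K, hK, hres⟩ := hk.exists_norm_resolvent_le
  obtain ⟨B, hB⟩ := (isCompact_Icc (a := 0) (b := a)).exists_bound_of_continuousOn
    (E := E →L[ℂ] E) hG.continuousOn
  have hB0 : 0 ≤ B := (norm_nonneg _).trans (hB 0 ⟨le_rfl, ha.out.le⟩)
  -- Chosen so that the final error KB(ρ + ρ) + ρ, per unit of `h`, stays below ε.
  set ρ := ε / (2 * (K * B + 1)) with hρ
  have hρ0 : 0 < ρ := by positivity
  have hρε : K * B * (ρ + ρ) + ρ ≤ ε := by
    have : (K * B + 1) * (ρ + ρ) = ε := by rw [hρ]; field_simp; ring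
    linarith
  have hM0 : 0 ≤ K * (K * ‖f‖) := by positivity
  obtain ⟨δ1, hδ1, h1⟩ := k.exists_setIntegral_norm_le (ε := ρ / (K * (K * ‖f‖) + 1))
    (by positivity)
  have hΦ : Continuous fun p : ℝ × ℝ × ℝ => (k.resolvent a p.2.2 f).extend p.1 :=
    hk.continuous_sol f continuous_fst (continuous_snd.comp continuous_snd)
  obtain ⟨δ2, hδ2, h2⟩ := exists_forall_near_diag hΦ a hρ0
  refine ⟨min (δ1 / 2) δ2, by positivity, fun ξ hξt ξ' hξt' hle hlt => ?_⟩
  have hξ : ξ ∈ Icc 0 a := ⟨(abs_nonneg t).trans hξt.1, hξt.2⟩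
  have hξ' : ξ' ∈ Icc 0 a := ⟨(abs_nonneg t).trans hξt'.1, hξt'.2⟩
  have ht : t ∈ Icc (-ξ) ξ := abs_le.1 hξt.1
  obtain ⟨x, hx⟩ := hk.exists_solPrimitive_sub hξ hξ' hle hf
  set h := ξ' - ξ with hh
  have hh0 : 0 ≤ h := sub_nonneg.2 hle
  set d := k.diagInv a ξ ((k.resolvent a ξ f).extend ξ) with hd
  set w := SymmC.ofFun a (k.conv ((shell ξ ξ').indicator (k.solPrimitive a f ξ'))) with hw
  -- Two small factors: the primitive is O(h) on the shell, and the kernel mass of the shell tends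
  -- to zero. Hence the shell contribution is o(h).
  have hwb : ‖w‖ ≤ ρ / (K * (K * ‖f‖) + 1) * (K * ‖f‖ * h) := by
    refine (ContinuousMap.norm_le _ (by positivity)).2 fun s => ?_
    rw [hw, SymmC.ofFun_apply (continuous_conv ((bddMeas_solPrimitive f ξ').indicator
      (measurableSet_shell _ _)))]
    refine (norm_conv_indicator_le (C := K * ‖f‖ * h) (measurableSet_shell _ _)
      (fun r hr => ?_) _).trans (mul_le_mul_of_nonneg_right
        (h1 _ (measurableSet_shell _ _) ?_ _) (by positivity))
    · have hr := abs_mem_of_mem_shell hr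
      refine (hk.norm_solPrimitive_le hξ' hf (h := h) (by linarith [hr.1]) hr.2).trans ?_
      exact mul_le_mul_of_nonneg_right ((k.resolvent a ξ').le_of_opNorm_le (hres _) _) hh0
    · rw [volume_shell hξ.1 hle]
      refine (ENNReal.ofReal_lt_ofReal_iff hδ1).2 ?_
      linarith [hlt.trans_le (min_le_left _ _)]
  have hRw : ∀ s, ‖(k.resolvent a ξ w).extend s‖ ≤ ρ * h := fun s => by
    refine (SymmC.norm_extend_le _ s).trans (((k.resolvent a ξ).le_of_opNorm_le (hres _) _).trans
      ((mul_le_mul_of_nonneg_left hwb hK.le).trans ?_))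
    have : K * (ρ / (K * (K * ‖f‖) + 1) * (K * ‖f‖ * h))
        = ρ * h * ((K * (K * ‖f‖)) / (K * (K * ‖f‖) + 1)) := by field_simp
    rw [this]
    refine mul_le_of_le_one_right (by positivity) ?_
    rw [div_le_one (by positivity)]
    linarith
  have hψ : ‖k.solPrimitive a f ξ' ξ - h • (k.resolvent a ξ f).extend ξ‖ ≤ ρ * h := by
    rw [solPrimitive_eq f hξ'.2 ⟨by linarith [hξ.1, hξ'.1], hle⟩,
      intervalIntegral.integral_of_le hle]
    refine norm_setIntegral_Ioc_sub_le hle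
      ((k.resolvent a ξ' f).bddMeas_extend.integrableOn (by simp)) fun s hs => ?_
    have hlt2 := hlt.trans_le (min_le_right _ _)
    refine h2 ξ hξ s ⟨hξ.1.trans hs.1, hs.2.trans hξ'.2⟩ ξ hξ ξ' hξ' ?_ (by simpa using hδ2) ?_
    · rw [abs_of_nonneg (sub_nonneg.2 hs.1)]
      linarith [hs.2]
    · rwa [abs_of_nonneg hh0]
  -- The constant `x` is found at t = ξ: there the primitive for `ξ` is zero and the one for `ξ'` is
  -- hψ_ξ(ξ) + o(h). Invertibility of q(ξ, ξ) gives x = h d + o(h).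
  have hdiag : ‖k.unitSol a ξ ξ (x - h • d)‖ ≤ (ρ + ρ) * h := by
    have e := hx ξ ⟨by linarith [hξ.1], le_rfl⟩
    rw [solPrimitive_of_le f hξ.2 le_rfl, sub_zero] at e
    have e2 : k.unitSol a ξ ξ (x - h • d) = (k.solPrimitive a f ξ' ξ
        - h • (k.resolvent a ξ f).extend ξ) + (k.resolvent a ξ w).extend ξ := by
      rw [e, map_sub, ContinuousLinearMap.map_smul_of_tower, hd, unitSol_diagInv hξ (hu ξ hξ)]
      abel
    rw [e2, add_mul]
    exact norm_add_le_of_le hψ (hRw ξ)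
  have hxd : ‖x - h • d‖ ≤ B * ((ρ + ρ) * h) := by
    rw [← diagInv_unitSol hξ (hu ξ hξ) (x - h • d)]
    exact ((k.diagInv a ξ).le_of_opNorm_le (hB ξ hξ) _).trans
      (mul_le_mul_of_nonneg_left hdiag hB0)
  have e3 : k.solPrimitive a f ξ' t - k.solPrimitive a f ξ t - h • k.unitSol a t ξ d
      = k.unitSol a t ξ (x - h • d) - (k.resolvent a ξ w).extend t := by
    rw [hx t ht, map_sub, ContinuousLinearMap.map_smul_of_tower]
    abel
  rw [e3]
  refine (norm_sub_le_of_le ((norm_unitSol_le hres t ξ _).trans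
    (mul_le_mul_of_nonneg_left hxd hK.le)) (hRw t)).trans ?_
  calc K * (B * ((ρ + ρ) * h)) + ρ * h = (K * B * (ρ + ρ) + ρ) * h := by ring
    _ ≤ ε * h := mul_le_mul_of_nonneg_right hρε hh0

/-- The solution with an odd right-hand side as a potential. -/
theorem Regular.integral_unitSol_diagInv (hk : k.Regular a)
    (hu : ∀ ξ ∈ Icc 0 a, IsUnit (k.unitSol a ξ ξ)) (hf : f.reflect = -f) {t : ℝ}
    (ht : t ∈ Icc (-a) a) :
    ∫ ξ in |t|..a, k.unitSol a t ξ (k.diagInv a ξ ((k.resolvent a ξ f).extend ξ)) =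
      ∫ s in t..a, (k.resolvent a a f).extend s := by
  have : CompleteSpace E := FiniteDimensional.complete ℂ E
  have hta : |t| ≤ a := abs_le.2 ht
  have hc : Continuous fun ξ => k.unitSol a t ξ (k.diagInv a ξ ((k.resolvent a ξ f).extend ξ)) :=
    (hk.continuous_unitSol continuous_const continuous_id).clm_apply
      ((hk.continuous_diagInv hu).clm_apply (hk.continuous_sol f continuous_id continuous_id))
  have hd := fun ξ hξ => hk.hasDerivWithinAt_solPrimitive (t := t) (ξ := ξ) hu hf hξ
  rw [intervalIntegral.integral_eq_sub_of_hasDerivAt_of_le hta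
    (fun ξ hξ => (hd ξ hξ).continuousWithinAt)
    (fun ξ hξ => (hd ξ (Ioo_subset_Icc_self hξ)).hasDerivAt (Icc_mem_nhds hξ.1 hξ.2))
    (hc.intervalIntegrable _ _), solPrimitive_eq f le_rfl ht]
  have h0 : k.solPrimitive a f |t| t = 0 := by
    rcases le_total 0 t with h | h
    · exact solPrimitive_of_le f hta (abs_of_nonneg h).le
    · refine hk.solPrimitive_of_le_neg ⟨abs_nonneg t, hta⟩ hf ?_
      rw [abs_of_nonpos h, neg_neg]
  rw [h0, sub_zero]

end EvenKernel

/-! ### Comparison of Stieltjes integrals: absolutely continuous integrators, change at an end point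
-/

namespace AbsolutelyContinuousOnInterval

variable {E F : Type*} [NormedAddCommGroup E] [NormedSpace ℝ E] [NormedAddCommGroup F]
  [NormedSpace ℝ F] {f : ℝ → E} {c d : ℝ}

theorem clm_comp (hf : AbsolutelyContinuousOnInterval f c d) (L : E →L[ℝ] F) :
    AbsolutelyContinuousOnInterval (fun x => L (f x)) c d := by
  refine squeeze_zero (fun t => Finset.sum_nonneg fun i _ => dist_nonneg) (fun t => ?_)
    (by simpa using! Tendsto.const_mul ‖L‖ hf)
  rw [Finset.mul_sum]
  refine Finset.sum_le_sum fun i _ => ?_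
  rw [dist_eq_norm, dist_eq_norm, ← map_sub]
  exact L.le_opNorm _

variable [FiniteDimensional ℝ E]

/-- A.e. differentiability of the vector function yields one null set for all functionals; the
scalar theorems then pass to vectors coordinatewise. -/
theorem ae_deriv_clm_comp (hf : AbsolutelyContinuousOnInterval f c d) :
    ∀ᵐ x, x ∈ uIcc c d → ∀ L : E →L[ℝ] ℝ, deriv (fun y => L (f y)) x = L (deriv f x) := by
  filter_upwards [hf.boundedVariationOn.ae_differentiableAt_of_mem_uIcc] with x hx hxm L
  exact (L.hasFDerivAt.comp_hasDerivAt x (hx hxm).hasDerivAt).deriv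

theorem intervalIntegrable_deriv_vector (hf : AbsolutelyContinuousOnInterval f c d) :
    IntervalIntegrable (deriv f) volume c d := by
  let Φ : E ≃L[ℝ] (Fin (Module.finrank ℝ E) → ℝ) := ContinuousLinearEquiv.ofFinrankEq (by simp)
  rw [intervalIntegrable_iff, IntegrableOn, ← Φ.integrable_comp_iff]
  refine Integrable.of_eval fun i => ?_
  let L : E →L[ℝ] ℝ := ContinuousLinearMap.proj i ∘L Φ.toContinuousLinearMap
  have h := (hf.clm_comp L).intervalIntegrable_deriv
  rw [intervalIntegrable_iff] at h
  refine h.congr ((ae_restrict_iff' measurableSet_uIoc).2 ?_)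
  filter_upwards [hf.ae_deriv_clm_comp] with x hx hxm
  exact hx (uIoc_subset_uIcc hxm) L

theorem integral_deriv_eq_sub_vector (hf : AbsolutelyContinuousOnInterval f c d) :
    ∫ x in c..d, deriv f x = f d - f c := by
  have : CompleteSpace E := FiniteDimensional.complete ℝ E
  let Φ : E ≃L[ℝ] (Fin (Module.finrank ℝ E) → ℝ) := ContinuousLinearEquiv.ofFinrankEq (by simp)
  refine Φ.injective (funext fun i => ?_)
  let L : E →L[ℝ] ℝ := ContinuousLinearMap.proj i ∘L Φ.toContinuousLinearMap
  change L (∫ x in c..d, deriv f x) = L (f d - f c)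
  rw [map_sub, ← (hf.clm_comp L).integral_deriv_eq_sub,
    ← L.intervalIntegral_comp_comm hf.intervalIntegrable_deriv_vector]
  refine intervalIntegral.integral_congr_ae ?_
  filter_upwards [hf.ae_deriv_clm_comp] with x hx hxm
  exact (hx (uIoc_subset_uIcc hxm) L).symm

end AbsolutelyContinuousOnInterval

/-- A Riemann–Stieltjes integral against an absolutely continuous function is a Lebesgue
integral. -/
theorem HasRSIntegral.eq_integral_deriv {E : Type*} [NormedAddCommGroup E] [NormedSpace ℂ E]
    [FiniteDimensional ℂ E] {g : ℝ → E →L[ℂ] E} {F : ℝ → E} {c d : ℝ} {L : E}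
    (h : HasRSIntegral g F c d L) (hcd : c ≤ d) (hg : Continuous g)
    (hF : AbsolutelyContinuousOnInterval F c d) :
    IntervalIntegrable (fun ξ => g ξ (deriv F ξ)) volume c d ∧
      L = ∫ ξ in c..d, g ξ (deriv F ξ) := by
  have : CompleteSpace E := FiniteDimensional.complete ℂ E
  have hF' := hF.intervalIntegrable_deriv_vector
  have hint : ∀ {φ : ℝ → E →L[ℂ] E}, Continuous φ →
      IntervalIntegrable (fun ξ => φ ξ (deriv F ξ)) volume c d := fun {φ} hφ => by
    obtain ⟨K, hK⟩ := (isCompact_Icc (a := c) (b := d)).exists_bound_of_continuousOn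
      (E := E →L[ℂ] E) hφ.continuousOn
    rw [intervalIntegrable_iff_integrableOn_Ioc_of_le hcd] at hF' ⊢
    refine (hF'.norm.const_mul K).mono'
      (EvenKernel.aesm_apply hφ.aestronglyMeasurable hF'.aestronglyMeasurable)
      ((ae_restrict_iff' measurableSet_Ioc).2 (ae_of_all _ fun s hs => ?_))
    exact (φ s).le_of_opNorm_le (hK s (Ioc_subset_Icc_self hs)) _
  refine ⟨hint hg, sub_eq_zero.1 (norm_le_zero_iff.1 (le_of_forall_pos_le_add fun ε hε => ?_))⟩
  rw [zero_add]
  set m := ∫ s in c..d, ‖deriv F s‖ with hm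
  have hm0 : 0 ≤ m := intervalIntegral.integral_nonneg hcd fun _ _ => norm_nonneg _
  obtain ⟨δ1, hδ1, h1⟩ := Metric.uniformContinuousOn_iff.1
    ((isCompact_Icc (a := c) (b := d)).uniformContinuousOn_of_continuous hg.continuousOn)
    (ε / (2 * (m + 1))) (by positivity)
  obtain ⟨δ2, hδ2, h2⟩ := h (ε / 2) (half_pos hε)
  obtain ⟨N, hN⟩ := exists_nat_gt ((d - c) / min δ1 δ2)
  have hN0 : (0 : ℝ) < N := lt_of_le_of_lt (div_nonneg (sub_nonneg.2 hcd)
    (lt_min hδ1 hδ2).le) hN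
  rw [div_lt_iff₀ (lt_min hδ1 hδ2)] at hN
  set η := (d - c) / N with hη
  have hη0 : 0 ≤ η := div_nonneg (sub_nonneg.2 hcd) hN0.le
  have hηδ : η < min δ1 δ2 := by
    rw [hη, div_lt_iff₀ hN0, mul_comm]
    exact hN
  -- Existence of the Stieltjes integral is given, so one fine equidistant partition with left tags
  -- identifies its value.
  set x : ℕ → ℝ := fun i => c + i * η with hx
  have hx0 : x 0 = c := by simp [hx]
  have hxN : x N = d := by
    simp only [hx, hη]
    field_simp
    ring
  have hstep : ∀ i, x (i + 1) - x i = η := fun i => by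
    simp only [hx]
    push_cast
    ring
  have hmono : ∀ i, x i ≤ x (i + 1) := fun i => by linarith [hstep i]
  have hI : ∀ i ≤ N, x i ∈ Icc c d := fun i hi =>
    ⟨hx0 ▸ le_of_forall_le_succ (fun j _ => hmono j) (Nat.zero_le i) hi,
      hxN ▸ le_of_forall_le_succ (fun j _ => hmono j) hi le_rfl⟩
  have h3 := (h2 N x x hx0 hxN fun i _ =>
    ⟨le_rfl, hmono i, by rw [hstep]; exact hηδ.trans_le (min_le_right _ _)⟩).le
  have hsub : ∀ i < N, uIcc (x i) (x (i + 1)) ⊆ uIcc c d := fun i hi => by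
    rw [uIcc_of_le (hmono i), uIcc_of_le hcd]
    exact Icc_subset_Icc (hI i hi.le).1 (hI (i + 1) hi).2
  have h4 : ‖(∑ i ∈ Finset.range N, g (x i) (F (x (i + 1)) - F (x i)))
      - ∫ ξ in c..d, g ξ (deriv F ξ)‖ ≤ ε / (2 * (m + 1)) * m := by
    have e1 := intervalIntegral.sum_integral_adjacent_intervals (a := x) (n := N)
      fun i hi => (hint hg).mono_set (hsub i hi)
    have e2 := intervalIntegral.sum_integral_adjacent_intervals (a := x) (n := N)
      fun i hi => hF'.norm.mono_set (hsub i hi)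
    rw [hx0, hxN] at e1 e2
    rw [← e1, ← Finset.sum_sub_distrib]
    refine (norm_sum_le_of_le (n := fun i => ε / (2 * (m + 1)) *
      ∫ s in (x i)..(x (i + 1)), ‖deriv F s‖) _ fun i hi => ?_).trans_eq
      (by rw [← Finset.mul_sum, e2])
    have hi := Finset.mem_range.1 hi
    have e3 : g (x i) (F (x (i + 1)) - F (x i))
        = ∫ s in (x i)..(x (i + 1)), g (x i) (deriv F s) := by
      rw [← (hF.mono (hsub i hi)).integral_deriv_eq_sub_vector]
      exact ((g (x i)).intervalIntegral_comp_comm (hF'.mono_set (hsub i hi))).symm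
    rw [e3, ← intervalIntegral.integral_sub ((hint continuous_const).mono_set (hsub i hi))
      ((hint hg).mono_set (hsub i hi)), ← intervalIntegral.integral_const_mul]
    refine intervalIntegral.norm_integral_le_of_norm_le (hmono i)
      (ae_of_all _ fun s hs => ?_) ((hF'.norm.mono_set (hsub i hi)).const_mul _)
    rw [← _root_.sub_apply]
    refine ContinuousLinearMap.le_of_opNorm_le _ ?_ _
    rw [← dist_eq_norm]
    refine (h1 _ (hI i hi.le) s ⟨(hI i hi.le).1.trans hs.1.le, hs.2.trans (hI (i + 1) hi).2⟩ ?_).le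
    rw [Real.dist_eq, abs_sub_comm, abs_of_nonneg (by linarith [hs.1])]
    linarith [hs.2, hstep i, hηδ.trans_le (min_le_left _ _)]
  have h5 : ε / (2 * (m + 1)) * m ≤ ε / 2 := by
    have : ε / (2 * (m + 1)) * m = ε / 2 * (m / (m + 1)) := by field_simp
    rw [this]
    refine mul_le_of_le_one_right (by positivity) ?_
    rw [div_le_one (by positivity)]
    linarith
  rw [norm_sub_rev] at h3
  refine (norm_sub_le_norm_sub_add_norm_sub _ (∑ i ∈ Finset.range N,
    g (x i) (F (x (i + 1)) - F (x i))) _).trans ?_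
  linarith

/-- Changing the integrand at the left end point, where the integrator is continuous, does not
change a Riemann–Stieltjes integral. -/
theorem HasRSIntegral.congr_Ioc {E : Type*} [NormedAddCommGroup E] [NormedSpace ℂ E]
    {g g' : ℝ → E →L[ℂ] E} {F F' : ℝ → E} {c d : ℝ} {L : E}
    (h : HasRSIntegral g F c d L) (hF : ContinuousAt F c) (hg : ∀ s ∈ Ioc c d, g' s = g s)
    (hFF : ∀ s ∈ Icc c d, F' s = F s) : HasRSIntegral g' F' c d L := by
  intro ε hε
  set B := g' c - g c with hB
  obtain ⟨δ1, hδ1, h1⟩ := h (ε / 2) (half_pos hε)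
  obtain ⟨δ2, hδ2, h2⟩ := Metric.continuousAt_iff.1 hF (ε / (2 * (‖B‖ + 1))) (by positivity)
  refine ⟨min δ1 δ2, lt_min hδ1 hδ2, fun N x τ hx0 hxN hp => ?_⟩
  have hmono : ∀ i < N, x i ≤ x (i + 1) := fun i hi => (hp i hi).1.trans (hp i hi).2.1
  have hI : ∀ i ≤ N, x i ∈ Icc c d := fun i hi =>
    ⟨hx0 ▸ le_of_forall_le_succ hmono (Nat.zero_le i) hi, hxN ▸ le_of_forall_le_succ hmono hi le_rfl⟩
  have h3 := h1 N x τ hx0 hxN fun i hi =>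
    ⟨(hp i hi).1, (hp i hi).2.1, (hp i hi).2.2.trans_le (min_le_left _ _)⟩
  classical
  -- At most one nondegenerate interval has its tag at `c`: if τ M = c then x i = c for all i ≤ M,
  -- and the earlier terms are zero. One term remains, small by continuity of the integrator.
  have h4 : ∀ M ≤ N, ‖∑ i ∈ Finset.range M, if τ i = c then B (F (x (i + 1)) - F (x i)) else 0‖
      ≤ ε / 2 := fun M hM => by
    induction M with
    | zero => simpa using! (half_pos hε).le
    | succ M ih =>
      have hMN : M < N := hM
      rw [Finset.sum_range_succ]
      by_cases hτ : τ M = c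
      · have hxM : ∀ i ≤ M, x i = c := fun i hi => le_antisymm
          ((le_of_forall_le_succ hmono hi hMN.le).trans ((hp M hMN).1.trans_eq hτ))
          (hI i (hi.trans hMN.le)).1
        have hz : ∑ i ∈ Finset.range M, (if τ i = c then B (F (x (i + 1)) - F (x i)) else 0)
            = 0 := Finset.sum_eq_zero fun i hi => by
          have hi := Finset.mem_range.1 hi
          rw [hxM i hi.le, hxM (i + 1) hi, sub_self, map_zero, ite_self]
        rw [hz, zero_add, if_pos hτ, hxM M le_rfl]
        have h5 := (h2 (x := x (M + 1)) (by
          rw [Real.dist_eq, ← hxM M le_rfl, abs_of_nonneg (sub_nonneg.2 (hmono M hMN))]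
          exact (hp M hMN).2.2.trans_le (min_le_right _ _))).le
        rw [dist_eq_norm] at h5
        refine (B.le_opNorm _).trans ((mul_le_mul_of_nonneg_left h5 (norm_nonneg _)).trans ?_)
        have : ‖B‖ * (ε / (2 * (‖B‖ + 1))) = ε / 2 * (‖B‖ / (‖B‖ + 1)) := by field_simp
        rw [this]
        refine mul_le_of_le_one_right (by positivity) ?_
        rw [div_le_one (by positivity)]
        linarith
      · rw [if_neg hτ, add_zero]
        exact ih hMN.le
  have h6 : ∑ i ∈ Finset.range N, g' (τ i) (F' (x (i + 1)) - F' (x i))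
      = (∑ i ∈ Finset.range N, g (τ i) (F (x (i + 1)) - F (x i)))
        + ∑ i ∈ Finset.range N, if τ i = c then B (F (x (i + 1)) - F (x i)) else 0 := by
    rw [← Finset.sum_add_distrib]
    refine Finset.sum_congr rfl fun i hi => ?_
    have hi := Finset.mem_range.1 hi
    rw [hFF _ (hI i hi.le), hFF _ (hI (i + 1) hi)]
    split_ifs with hτ
    · rw [hτ, hB, _root_.sub_apply]
      abel
    · rw [add_zero, hg]
      exact ⟨lt_of_le_of_ne ((hI i hi.le).1.trans (hp i hi).1) (Ne.symm hτ),
        (hp i hi).2.1.trans (hI (i + 1) hi).2⟩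
  rw [h6, add_sub_right_comm]
  exact (norm_add_le _ _).trans_lt (by linarith [h4 N le_rfl])

/-! ### From matrix equations to operators -/

/-- Square matrices as continuous operators. -/
def matCLM (n : ℕ) : Matrix (Fin n) (Fin n) ℂ ≃ₐ[ℂ] ((Fin n → ℂ) →L[ℂ] (Fin n → ℂ)) :=
  Matrix.toLinAlgEquiv'.trans (Module.End.toContinuousLinearMap (𝕜 := ℂ) (Fin n → ℂ))

section matCLM

variable {n : ℕ}

theorem matCLM_apply (A : Matrix (Fin n) (Fin n) ℂ) (x : Fin n → ℂ) : matCLM n A x = A *ᵥ x := rfl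

theorem matCLM_symm_apply (L : (Fin n → ℂ) →L[ℂ] (Fin n → ℂ)) (i j : Fin n) :
    (matCLM n).symm L i j = L (Pi.single j 1) i := LinearMap.toMatrixAlgEquiv'_apply _ i j

theorem matCLM_symm_mulVec (L : (Fin n → ℂ) →L[ℂ] (Fin n → ℂ)) (x : Fin n → ℂ) :
    (matCLM n).symm L *ᵥ x = L x := by
  rw [← matCLM_apply, AlgEquiv.apply_symm_apply]

/-- The entries of an operator on `ℂⁿ`. -/
def entryCLM (i j : Fin n) : ((Fin n → ℂ) →L[ℂ] (Fin n → ℂ)) →L[ℂ] ℂ :=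
  ContinuousLinearMap.proj i ∘L ContinuousLinearMap.apply ℂ (Fin n → ℂ) (Pi.single j 1)

theorem entryCLM_apply (i j : Fin n) (L : (Fin n → ℂ) →L[ℂ] (Fin n → ℂ)) :
    entryCLM i j L = (matCLM n).symm L i j := (matCLM_symm_apply L i j).symm

theorem entryCLM_matCLM (i j : Fin n) (A : Matrix (Fin n) (Fin n) ℂ) :
    entryCLM i j (matCLM n A) = A i j := by
  rw [entryCLM_apply, AlgEquiv.symm_apply_apply]

theorem continuous_matCLM : Continuous (matCLM n) :=
  LinearMap.continuous_of_finiteDimensional (matCLM n).toLinearMap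

theorem continuous_matCLM_symm : Continuous (matCLM n).symm :=
  continuous_matrix fun i j => (entryCLM i j).continuous.congr fun L => entryCLM_apply i j L

theorem one_apply_eq_single (i j : Fin n) :
    (1 : Matrix (Fin n) (Fin n) ℂ) i j = (Pi.single j 1 : Fin n → ℂ) i := by
  rw [Matrix.one_apply, Pi.single_apply]

end matCLM

theorem integrable_matCLM {n : ℕ} {A : ℝ → Matrix (Fin n) (Fin n) ℂ}
    (hA : ∀ i j, Integrable fun t => A t i j) : Integrable fun t => matCLM n (A t) := by
  let L : (Fin n → Fin n → ℂ) →ₗ[ℂ] ((Fin n → ℂ) →L[ℂ] (Fin n → ℂ)) :=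
    (matCLM n).toLinearMap ∘ₗ (Matrix.ofLinearEquiv ℂ).toLinearMap
  exact (LinearMap.toContinuousLinearMap L).integrable_comp
    (Integrable.of_eval fun i => Integrable.of_eval fun j => hA i j)

/-- The even part of a matrix function on `(-2a, 2a)`, extended by zero. -/
def evenPart {n : ℕ} (a : ℝ) (H : ℝ → Matrix (Fin n) (Fin n) ℂ) (t : ℝ) :
    Matrix (Fin n) (Fin n) ℂ :=
  Matrix.of fun i j => (1 / 2 : ℂ) * ((Ioo (-2 * a) (2 * a)).indicator (fun t => H t i j) t +
    (Ioo (-2 * a) (2 * a)).indicator (fun t => H t i j) (-t))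

/-- The even kernel that represents an a.e. even integrable matrix function on `(-2a, 2a)`. -/
def symmKernel {n : ℕ} {a : ℝ} (H : ℝ → Matrix (Fin n) (Fin n) ℂ)
    (hH : ∀ i j, IntegrableOn (fun t => H t i j) (Ioo (-2 * a) (2 * a)) volume) :
    EvenKernel (Fin n → ℂ) where
  toFun t := matCLM n (evenPart a H t)
  integrable := integrable_matCLM fun i j => by
    have h := (integrable_indicator_iff measurableSet_Ioo).2 (hH i j)
    exact (h.add h.comp_neg).const_mul _
  even t := by simp only [evenPart, neg_neg, add_comm]

theorem symmKernel_ae_eq {n : ℕ} {a : ℝ} {H : ℝ → Matrix (Fin n) (Fin n) ℂ}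
    (hH : ∀ i j, IntegrableOn (fun t => H t i j) (Ioo (-2 * a) (2 * a)) volume)
    (heven : ∀ᵐ t ∂(volume.restrict (Ioo (-2 * a) (2 * a))), H (-t) = H t) :
    ∀ᵐ t, t ∈ Ioo (-2 * a) (2 * a) → (symmKernel H hH).toFun t = matCLM n (H t) := by
  filter_upwards [(ae_restrict_iff' measurableSet_Ioo).1 heven] with t h ht
  have ht' : -t ∈ Ioo (-2 * a) (2 * a) := ⟨by linarith [ht.2], by linarith [ht.1]⟩
  refine congrArg (matCLM n) (Matrix.ext fun i j => ?_)
  rw [evenPart, Matrix.of_apply, indicator_of_mem ht, indicator_of_mem ht', h ht]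
  ring

theorem exists_bddMeas_indicator_Icc {E : Type*} [NormedAddCommGroup E] {u : ℝ → E} {c d : ℝ}
    (hu : ContinuousOn u (Icc c d)) : ∃ C, BddMeas ((Icc c d).indicator u) C := by
  obtain ⟨C, hC⟩ := isCompact_Icc.exists_bound_of_continuousOn hu
  refine ⟨max C 0, (aestronglyMeasurable_indicator_iff measurableSet_Icc).2
    (hu.aestronglyMeasurable measurableSet_Icc), fun s => ?_⟩
  by_cases hs : s ∈ Icc c d
  · rw [indicator_of_mem hs]
    exact (hC s hs).trans (le_max_left _ _)
  · rw [indicator_of_notMem hs, norm_zero]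
    exact le_max_right _ _

namespace EvenKernel

variable {n : ℕ} {a : ℝ} {k : EvenKernel (Fin n → ℂ)} {H : ℝ → Matrix (Fin n) (Fin n) ℂ}
  {ξ t C : ℝ} {u : ℝ → Fin n → ℂ} {g : ℝ → (Fin n → ℂ) →L[ℂ] (Fin n → ℂ)}

/-- The kernel agrees with `H` only a.e. on the open interval. For these `t` and `s` the difference
t - s can leave it only at t = -a, s = a, so `s = a` is discarded. -/
theorem ae_toFun_sub (hkH : ∀ᵐ t, t ∈ Ioo (-2 * a) (2 * a) → k.toFun t = matCLM n (H t))
    (ht : t ∈ Icc (-a) a) (hξ : ξ ≤ a) :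
    ∀ᵐ s, s ∈ Ioc (-ξ) ξ → k.toFun (t - s) = matCLM n (H (t - s)) ∧
      k.toFun (t - s) = matCLM n (H (s - t)) := by
  filter_upwards [(quasiMeasurePreserving_sub_left volume t).ae hkH,
    (measurePreserving_sub_right volume t).quasiMeasurePreserving.ae hkH, Measure.ae_ne volume a]
    with s h1 h2 hs hm
  have hsa : s < a := lt_of_le_of_ne (hm.2.trans hξ) hs
  refine ⟨h1 ⟨?_, ?_⟩, (even_sub t s).trans (h2 ⟨?_, ?_⟩)⟩ <;>
    linarith [ht.1, ht.2, hm.1]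

theorem truncConv_eq_integral
    (hkH : ∀ᵐ t, t ∈ Ioo (-2 * a) (2 * a) → k.toFun t = matCLM n (H t))
    (ht : t ∈ Icc (-a) a) (hξ : ξ ∈ Icc 0 a) (u : ℝ → Fin n → ℂ) :
    k.truncConv ξ u t = ∫ s in (-ξ)..ξ, H (t - s) *ᵥ u s := by
  rw [intervalIntegral.integral_of_le (by linarith [hξ.1]), ← integral_indicator measurableSet_Ioc]
  refine integral_congr_ae ?_
  filter_upwards [ae_toFun_sub hkH ht hξ.2] with s hs
  by_cases hm : s ∈ Ioc (-ξ) ξ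
  · rw [indicator_of_mem hm, indicator_of_mem hm, (hs hm).1, matCLM_apply]
  · rw [indicator_of_notMem hm, indicator_of_notMem hm, map_zero]

theorem intervalIntegrable_mulVec_apply
    (hkH : ∀ᵐ t, t ∈ Ioo (-2 * a) (2 * a) → k.toFun t = matCLM n (H t))
    (ht : t ∈ Icc (-a) a) (hξ : ξ ∈ Icc 0 a) (hu : BddMeas u C) (i : Fin n) :
    IntervalIntegrable (fun s => (H (t - s) *ᵥ u s) i) volume (-ξ) ξ := by
  rw [intervalIntegrable_iff_integrableOn_Ioc_of_le (by linarith [hξ.1])]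
  refine ((integrable_apply (k := k) hu t).eval i).integrableOn.congr ?_
  refine (ae_restrict_iff' measurableSet_Ioc).2 ?_
  filter_upwards [ae_toFun_sub hkH ht hξ.2] with s hs hm
  rw [(hs hm).1, matCLM_apply]

theorem truncConv_apply_eq_integral
    (hkH : ∀ᵐ t, t ∈ Ioo (-2 * a) (2 * a) → k.toFun t = matCLM n (H t))
    (ht : t ∈ Icc (-a) a) (hξ : ξ ∈ Icc 0 a) (hu : BddMeas u C) (i : Fin n) :
    k.truncConv ξ u t i = ∫ s in (-ξ)..ξ, (H (t - s) *ᵥ u s) i := by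
  rw [truncConv_eq_integral hkH ht hξ, intervalIntegral.integral_of_le (by linarith [hξ.1]),
    intervalIntegral.integral_of_le (by linarith [hξ.1]), eval_integral]
  intro i
  have := intervalIntegrable_mulVec_apply hkH ht hξ hu i
  rwa [intervalIntegrable_iff_integrableOn_Ioc_of_le (by linarith [hξ.1])] at this

theorem entry_dual_truncConv
    (hkH : ∀ᵐ t, t ∈ Ioo (-2 * a) (2 * a) → k.toFun t = matCLM n (H t))
    (ht : t ∈ Icc (-a) a) (hξ : ξ ∈ Icc 0 a) (hg : BddMeas g C) (i j : Fin n) :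
    entryCLM i j (k.dual.truncConv ξ g t) =
      ∫ s in (-ξ)..ξ, ((matCLM n).symm (g s) * H (s - t)) i j := by
  rw [truncConv, conv, ← ContinuousLinearMap.integral_comp_comm _
    (integrable_apply (k := k.dual) (hg.indicator measurableSet_Ioc) t),
    intervalIntegral.integral_of_le (by linarith [hξ.1]), ← integral_indicator measurableSet_Ioc]
  refine integral_congr_ae ?_
  filter_upwards [ae_toFun_sub hkH ht hξ.2] with s hs
  by_cases hm : s ∈ Ioc (-ξ) ξ
  · rw [indicator_of_mem hm, indicator_of_mem hm, dual_apply, (hs hm).2, entryCLM_apply]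
    have : g s ∘L matCLM n (H (s - t)) = matCLM n ((matCLM n).symm (g s) * H (s - t)) := by
      rw [map_mul, AlgEquiv.apply_symm_apply]
      rfl
    rw [this, AlgEquiv.symm_apply_apply]
  · rw [indicator_of_notMem hm, indicator_of_notMem hm, map_zero, map_zero]

theorem Icc_neg_subset (hξ : ξ ∈ Icc 0 a) : Icc (-ξ) ξ ⊆ Icc (-a) a :=
  Icc_subset_Icc (neg_le_neg hξ.2) hξ.2

variable [ha : Fact (0 < a)]

/-- Continuous solutions of a truncated vector equation are given by the resolvent. -/
theorem Regular.eq_extend_resolvent_of_integral (hk : k.Regular a)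
    (hkH : ∀ᵐ t, t ∈ Ioo (-2 * a) (2 * a) → k.toFun t = matCLM n (H t)) (hξ : ξ ∈ Icc 0 a)
    (hu : ContinuousOn u (Icc (-ξ) ξ)) {f : SymmC a (Fin n → ℂ)}
    (h : ∀ t ∈ Icc (-ξ) ξ, ∀ i, u t i + ∫ s in (-ξ)..ξ, (H (t - s) *ᵥ u s) i = f.extend t i) :
    ∀ t ∈ Icc (-ξ) ξ, u t = (k.resolvent a ξ f).extend t := by
  obtain ⟨C, hC⟩ := exists_bddMeas_indicator_Icc hu
  intro t ht
  rw [← indicator_of_mem ht u]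
  refine hk.eq_extend_resolvent hξ hC (fun t ht => funext fun i => ?_) t ht
  rw [← h t ht i, Pi.add_apply, indicator_of_mem ht,
    truncConv_apply_eq_integral hkH (Icc_neg_subset hξ ht) hξ hC]
  congr 1
  refine intervalIntegral.integral_congr fun s hs => ?_
  rw [uIcc_of_le (by linarith [hξ.1])] at hs
  simp only [indicator_of_mem hs]

theorem Regular.eq_dualSol_of_isTruncatedSolStar (hk : k.Regular a)
    (hkH : ∀ᵐ t, t ∈ Ioo (-2 * a) (2 * a) → k.toFun t = matCLM n (H t)) (hξ : ξ ∈ Icc 0 a)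
    {Q : ℝ → Matrix (Fin n) (Fin n) ℂ} (hQ : IsTruncatedSolStar H ξ Q) :
    ∀ t ∈ Icc (-ξ) ξ, Q t = (matCLM n).symm (k.dualSol a t ξ) := by
  obtain ⟨C, hC⟩ := exists_bddMeas_indicator_Icc (continuous_matCLM.comp_continuousOn hQ.1)
  intro t ht
  rw [← AlgEquiv.symm_apply_apply (matCLM n) (Q t)]
  congr 1
  rw [← Function.comp_apply (f := matCLM n), ← indicator_of_mem ht (⇑(matCLM n) ∘ Q)]
  refine hk.dual.eq_extend_resolvent hξ hC (fun t ht => ?_) t ht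
  refine (matCLM n).symm.injective (Matrix.ext fun i j => ?_)
  rw [← entryCLM_apply, map_add, entry_dual_truncConv hkH (Icc_neg_subset hξ ht) hξ hC,
    indicator_of_mem ht, Function.comp_apply, entryCLM_matCLM, SymmC.extend_const, map_one,
    ← hQ.2 t ht i j]
  congr 1
  refine intervalIntegral.integral_congr fun s hs => ?_
  rw [uIcc_of_le (by linarith [hξ.1])] at hs
  simp only [indicator_of_mem hs, Function.comp_apply, AlgEquiv.symm_apply_apply]

theorem Regular.isTruncatedSolStar_dualSol (hk : k.Regular a)
    (hkH : ∀ᵐ t, t ∈ Ioo (-2 * a) (2 * a) → k.toFun t = matCLM n (H t)) (hξ : ξ ∈ Icc 0 a) :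
    IsTruncatedSolStar H ξ fun t => (matCLM n).symm (k.dualSol a t ξ) := by
  refine ⟨(continuous_matCLM_symm.comp
    (hk.continuous_dualSol continuous_id continuous_const)).continuousOn, fun t ht i j => ?_⟩
  beta_reduce
  rw [← entry_dual_truncConv hkH (Icc_neg_subset hξ ht) hξ (k.bddMeas_dualSol a ξ),
    ← entryCLM_apply, ← map_add, hk.dualSol_add hξ (Icc_neg_subset hξ ht), entryCLM_apply, map_one]

/-- Unique solvability of the matrix equations makes the kernel regular. -/
theorem regular_of_unique (hkH : ∀ᵐ t, t ∈ Ioo (-2 * a) (2 * a) → k.toFun t = matCLM n (H t))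
    {q : ℝ → ℝ → Matrix (Fin n) (Fin n) ℂ}
    (hq : ∀ ξ ∈ Ioc 0 a, IsTruncatedSol H ξ (fun t => q t ξ))
    (hq_unique : ∀ ξ ∈ Ioc 0 a, ∀ Q : ℝ → Matrix (Fin n) (Fin n) ℂ,
      IsTruncatedSol H ξ Q → EqOn Q (fun t => q t ξ) (Icc (-ξ) ξ)) : k.Regular a := by
  intro ξ hξ
  refine isUnit_one_add_op fun u hu => ?_
  have hop : k.op a ξ u = 0 := by
    -- The hypotheses say nothing at ξ = 0, but T(0) = 0.
    rcases hξ.1.eq_or_lt with rfl | h0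
    · rw [op_zero, _root_.zero_apply]
    have hξ' : ξ ∈ Ioc 0 a := ⟨h0, hξ.2⟩
    have hz : ∀ t ∈ Icc (-ξ) ξ, u.extend t = 0 := by
      -- Adding a homogeneous solution to every column of q gives another matrix solution, so
      -- uniqueness forces it to vanish on [-ξ, ξ].
      have hQ : IsTruncatedSol H ξ fun t => q t ξ + Matrix.of fun i _ => u.extend t i := by
        refine ⟨(hq ξ hξ').1.add (Continuous.continuousOn ?_), fun t ht i j => ?_⟩
        · exact continuous_matrix fun i j => (continuous_apply i).comp u.continuous_extend
        · have hta := Icc_neg_subset hξ ht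
          obtain ⟨C, hC⟩ := exists_bddMeas_indicator_Icc (u := fun s l => q s ξ l j)
            (c := -ξ) (d := ξ) (continuousOn_pi.2 fun l => by
              exact (continuous_id.matrix_elem l j).comp_continuousOn (hq ξ hξ').1)
          have h1 := intervalIntegrable_mulVec_apply hkH hta hξ hC i
          have h2 := intervalIntegrable_mulVec_apply hkH hta hξ u.bddMeas_extend i
          have h3 : u.extend t i + ∫ s in (-ξ)..ξ, (H (t - s) *ᵥ u.extend s) i = 0 := by
            rw [← truncConv_apply_eq_integral hkH hta hξ u.bddMeas_extend, ← extend_op ξ u hta]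
            exact congrFun (congrArg (fun w : SymmC a (Fin n → ℂ) => w.extend t) hu) i
          have h4 : ∫ s in (-ξ)..ξ, (H (t - s) *
              (q s ξ + (Matrix.of fun i _ => u.extend s i : Matrix (Fin n) (Fin n) ℂ)) :
              Matrix (Fin n) (Fin n) ℂ) i j
              = (∫ s in (-ξ)..ξ, (H (t - s) * q s ξ) i j)
                + ∫ s in (-ξ)..ξ, (H (t - s) *ᵥ u.extend s) i := by
            have h5 : IntervalIntegrable (fun s => (H (t - s) * q s ξ) i j) volume (-ξ) ξ := by
              refine h1.congr fun s hs => ?_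
              rw [uIoc_of_le (by linarith)] at hs
              simp only [indicator_of_mem (Ioc_subset_Icc_self hs)]
              rfl
            rw [← intervalIntegral.integral_add h5 h2]
            refine intervalIntegral.integral_congr fun s _ => ?_
            simp only [Matrix.mul_add, Matrix.add_apply]
            rfl
          beta_reduce
          rw [h4, Matrix.add_apply, Matrix.of_apply, add_add_add_comm, (hq ξ hξ').2 t ht i j, h3,
            add_zero]
      intro t ht
      have h := hq_unique ξ hξ' _ hQ ht
      have h' : (Matrix.of fun i _ => u.extend t i : Matrix (Fin n) (Fin n) ℂ) = 0 :=
        add_eq_left.1 h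
      exact funext fun i => congrFun (congrFun h' i) i
    rw [op_eq, truncConv_congr (v := fun _ => 0) fun s hs => hz s (Ioc_subset_Icc_self hs)]
    ext1 t
    have h0 : k.truncConv ξ (fun _ => (0 : Fin n → ℂ)) = fun _ => 0 := by
      ext1 t
      simp [truncConv, conv]
    rw [h0, SymmC.ofFun_apply continuous_const]
    rfl
  rwa [hop, add_zero] at hu

theorem Regular.eq_unitSol_of_isTruncatedSol (hk : k.Regular a)
    (hkH : ∀ᵐ t, t ∈ Ioo (-2 * a) (2 * a) → k.toFun t = matCLM n (H t)) (hξ : ξ ∈ Icc 0 a)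
    {Q : ℝ → Matrix (Fin n) (Fin n) ℂ} (hQ : IsTruncatedSol H ξ Q) (ht : t ∈ Icc (-ξ) ξ) :
    Q t = (matCLM n).symm (k.unitSol a t ξ) := by
  refine Matrix.ext fun i j => ?_
  rw [matCLM_symm_apply, unitSol_apply]
  have h := hk.eq_extend_resolvent_of_integral hkH hξ (u := fun s l => Q s l j)
    (f := ContinuousMap.const _ (Pi.single j 1)) (continuousOn_pi.2 fun l => by
      exact (continuous_id.matrix_elem l j).comp_continuousOn hQ.1) (fun t ht i => by
      rw [SymmC.extend_const, ← one_apply_eq_single]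
      exact hQ.2 t ht i j) t ht
  exact congrFun h i

end EvenKernel

/-! ### Splitting into even and odd parts, and the formula -/

namespace EvenKernel

section decomposition

variable {E : Type*} [NormedAddCommGroup E] [NormedSpace ℂ E] [FiniteDimensional ℂ E]
  {k : EvenKernel E} {a : ℝ} [ha : Fact (0 < a)] {t ξ : ℝ}

omit [FiniteDimensional ℂ E] in
theorem Regular.resolvent_add_reflect (hk : k.Regular a) (hξ : ξ ∈ Icc 0 a) (f : SymmC a E)
    (t : ℝ) : (k.resolvent a ξ (f + f.reflect)).extend t =
      (k.resolvent a ξ f).extend t + (k.resolvent a ξ f).extend (-t) := by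
  simp only [map_add, hk.resolvent_reflect hξ, SymmC.extend_add, SymmC.extend_reflect]

omit [FiniteDimensional ℂ E] in
theorem Regular.resolvent_sub_reflect (hk : k.Regular a) (hξ : ξ ∈ Icc 0 a) (f : SymmC a E)
    (t : ℝ) : (k.resolvent a ξ (f - f.reflect)).extend t =
      (k.resolvent a ξ f).extend t - (k.resolvent a ξ f).extend (-t) := by
  simp only [map_sub, hk.resolvent_reflect hξ, SymmC.extend_sub, SymmC.extend_reflect]

variable (k a) in
/-- The density `q(ξ, ξ)⁻¹ (ψ_ξ(ξ) + ψ_ξ(-ξ))`. -/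
def density (f : SymmC a E) (ξ : ℝ) : E :=
  k.diagInv a ξ ((k.resolvent a ξ f).extend ξ + (k.resolvent a ξ f).extend (-ξ))

theorem Regular.continuous_density (hk : k.Regular a)
    (hu : ∀ ξ ∈ Icc 0 a, IsUnit (k.unitSol a ξ ξ)) (f : SymmC a E) :
    Continuous (k.density a f) := by
  have : CompleteSpace E := FiniteDimensional.complete ℂ E
  exact (hk.continuous_diagInv hu).clm_apply ((hk.continuous_sol f continuous_id
    continuous_id).add (hk.continuous_sol f continuous_neg continuous_id))

theorem Regular.hasRSIntegral_density (hk : k.Regular a)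
    (hu : ∀ ξ ∈ Icc 0 a, IsUnit (k.unitSol a ξ ξ)) (f : SymmC a E) (ht : t ∈ Icc (-a) a) :
    HasRSIntegral (fun ξ => k.unitSol a t ξ) (k.density a f) |t| a
      (k.unitSol a t a (k.density a f a) -
        ((k.resolvent a a f).extend t + (k.resolvent a a f).extend (-t))) := by
  have h := hk.hasRSIntegral_unitSol (f := f + f.reflect) (c := k.density a f) (t := t)
    (by
      ext s
      change f _ + f _ = f _ + f _
      rw [add_comm]
      simp only [neg_neg]) (hk.continuous_density hu f) (fun ξ hξ => by
      rw [density, unitSol_diagInv hξ (hu ξ hξ), hk.resolvent_add_reflect hξ]) ht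
  rwa [hk.resolvent_add_reflect ⟨ha.out.le, le_rfl⟩] at h

theorem Regular.integral_unitSol_diagInv_sub (hk : k.Regular a)
    (hu : ∀ ξ ∈ Icc 0 a, IsUnit (k.unitSol a ξ ξ)) (f : SymmC a E) (ht : t ∈ Icc (-a) a) :
    ∫ ξ in |t|..a, k.unitSol a t ξ (k.diagInv a ξ
      ((k.resolvent a ξ f).extend ξ - (k.resolvent a ξ f).extend (-ξ))) =
      ∫ s in t..a, ((k.resolvent a a f).extend s - (k.resolvent a a f).extend (-s)) := by
  have h := hk.integral_unitSol_diagInv hu (f := f - f.reflect) (t := t)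
    (by
      ext s
      change f _ - f _ = -(f _ - f _)
      rw [neg_sub]
      simp only [neg_neg]) ht
  simp only [hk.resolvent_sub_reflect (⟨ha.out.le, le_rfl⟩ : a ∈ Icc 0 a)] at h
  rw [← h]
  refine intervalIntegral.integral_congr fun ξ hξ => ?_
  rw [uIcc_of_le (abs_le.2 ht)] at hξ
  simp only [hk.resolvent_sub_reflect (⟨(abs_nonneg t).trans hξ.1, hξ.2⟩ : ξ ∈ Icc 0 a)]

end decomposition

variable {n : ℕ} {a : ℝ} [ha : Fact (0 < a)] {k : EvenKernel (Fin n → ℂ)} {ξ t : ℝ}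
  {q p : ℝ → ℝ → Matrix (Fin n) (Fin n) ℂ} {f : ℝ → Fin n → ℂ}

/-- q is even in its first variable, so M is half an integral over [-ξ, ξ], that is, half the
pairing of q* with constants. At ξ = 0 both sides are zero whatever q(·, 0) is. -/
theorem Regular.kreinM_apply (hk : k.Regular a)
    (hqk : ∀ ξ ∈ Ioc 0 a, ∀ t ∈ Icc (-ξ) ξ, q t ξ = (matCLM n).symm (k.unitSol a t ξ))
    (hξ : ξ ∈ Icc 0 a) (i j : Fin n) :
    kreinM q ξ i j = (1 / 2 : ℂ) * k.pairing (ContinuousMap.const (Icc (-a) a) (Pi.single j 1)) ξ i := by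
  rcases hξ.1.eq_or_lt with rfl | h0
  · simp [kreinM, pairing]
  set c : ℝ → ℂ := fun s => k.unitSol a s ξ (Pi.single j 1) i with hc
  have hcc : Continuous fun s => k.unitSol a s ξ (Pi.single j 1) :=
    (hk.continuous_unitSol continuous_id continuous_const).clm_apply continuous_const
  have hci : ∀ b d, IntervalIntegrable c volume b d := fun b d =>
    ((continuous_apply i).comp hcc).intervalIntegrable b d
  have h1 : k.pairing (ContinuousMap.const (Icc (-a) a) (Pi.single j 1)) ξ i = ∫ s in (-ξ)..ξ, c s := by
    rw [hk.pairing_eq hξ, intervalIntegral.integral_of_le (by linarith)]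
    exact ((ContinuousLinearMap.proj (R := ℂ) (φ := fun _ : Fin n => ℂ) i).integral_comp_comm
      (hcc.integrableOn_Icc.mono_set Ioc_subset_Icc_self)).symm
  have h2 := intervalIntegral.integral_comp_neg (a := 0) (b := ξ) c
  have h3 : ∫ s in 0..ξ, c (-s) = ∫ s in 0..ξ, c s := by
    simp only [hc, hk.unitSol_neg hξ]
  rw [h3, neg_zero] at h2
  have h4 : kreinM q ξ i j = ∫ s in 0..ξ, c s := by
    rw [kreinM, Matrix.of_apply]
    refine intervalIntegral.integral_congr fun s hs => ?_
    rw [uIcc_of_le h0.le] at hs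
    simp only [hc, hqk ξ ⟨h0, hξ.2⟩ s ⟨by linarith [hs.1], hs.2⟩, matCLM_symm_apply]
  rw [h1, h4, ← intervalIntegral.integral_add_adjacent_intervals (hci (-ξ) 0) (hci 0 ξ), ← h2]
  ring

/-- For constant data the two boundary values are equal by evenness; their sum cancels the factor
1/2 and leaves M' = q*(ξ, ξ) q(ξ, ξ). -/
theorem Regular.hasDerivWithinAt_kreinM (hk : k.Regular a)
    (hqk : ∀ ξ ∈ Ioc 0 a, ∀ t ∈ Icc (-ξ) ξ, q t ξ = (matCLM n).symm (k.unitSol a t ξ))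
    (hξ : ξ ∈ Icc 0 a) (i j : Fin n) :
    HasDerivWithinAt (fun η => kreinM q η i j)
      ((matCLM n).symm (k.dualSol a ξ ξ ∘L k.unitSol a ξ ξ) i j) (Icc 0 a) ξ := by
  have h := (hasDerivWithinAt_pi.1
    (hk.hasDerivWithinAt_pairing (ContinuousMap.const (Icc (-a) a) (Pi.single j 1)) hξ) i).const_mul
    (1 / 2 : ℂ)
  rw [← unitSol_apply, ← unitSol_apply, hk.unitSol_neg hξ, ← two_smul ℂ, map_smul, Pi.smul_apply,
    smul_eq_mul, ← mul_assoc, one_div, inv_mul_cancel₀ two_ne_zero, one_mul] at h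
  rw [matCLM_symm_apply]
  refine h.congr (fun η hη => ?_) ?_
  · rw [hk.kreinM_apply hqk hη, one_div]
  · rw [hk.kreinM_apply hqk hξ, one_div]

theorem Regular.kreinM'_eq (hk : k.Regular a)
    (hqk : ∀ ξ ∈ Ioc 0 a, ∀ t ∈ Icc (-ξ) ξ, q t ξ = (matCLM n).symm (k.unitSol a t ξ))
    (hξ : ξ ∈ Icc 0 a) :
    kreinM' a q ξ = (matCLM n).symm (k.dualSol a ξ ξ ∘L k.unitSol a ξ ξ) :=
  Matrix.ext fun i j => (hk.hasDerivWithinAt_kreinM hqk hξ i j).derivWithin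
    (uniqueDiffOn_Icc ha.out ξ hξ)

theorem Regular.isUnit_unitSol (hk : k.Regular a)
    (hqk : ∀ ξ ∈ Ioc 0 a, ∀ t ∈ Icc (-ξ) ξ, q t ξ = (matCLM n).symm (k.unitSol a t ξ))
    (hξ : ξ ∈ Icc 0 a) (hdet : (kreinM' a q ξ).det ≠ 0) : IsUnit (k.unitSol a ξ ξ) := by
  have h : (matCLM n).symm (k.dualSol a ξ ξ ∘L k.unitSol a ξ ξ)
      = (matCLM n).symm (k.dualSol a ξ ξ) * (matCLM n).symm (k.unitSol a ξ ξ) :=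
    map_mul (matCLM n).symm _ _
  rw [hk.kreinM'_eq hqk hξ, h, Matrix.det_mul] at hdet
  have h2 := (Matrix.isUnit_iff_isUnit_det _).2 (right_ne_zero_of_mul hdet).isUnit
  simpa using! h2.map (matCLM n)

/-- This is where q*(ξ, ξ) drops out: M'⁻¹ q*(ξ, ξ) = q(ξ, ξ)⁻¹. -/
theorem Regular.inv_kreinM'_mulVec (hk : k.Regular a)
    (hqk : ∀ ξ ∈ Ioc 0 a, ∀ t ∈ Icc (-ξ) ξ, q t ξ = (matCLM n).symm (k.unitSol a t ξ))
    (hξ : ξ ∈ Icc 0 a) (hdet : (kreinM' a q ξ).det ≠ 0) (w : Fin n → ℂ) :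
    (kreinM' a q ξ)⁻¹ *ᵥ k.dualSol a ξ ξ w = k.diagInv a ξ w := by
  have h : k.dualSol a ξ ξ w = kreinM' a q ξ *ᵥ k.diagInv a ξ w := by
    rw [hk.kreinM'_eq hqk hξ, matCLM_symm_mulVec, ContinuousLinearMap.comp_apply,
      unitSol_diagInv hξ (hk.isUnit_unitSol hqk hξ hdet)]
  rw [h, Matrix.mulVec_mulVec, Matrix.nonsing_inv_mul _ hdet.isUnit, Matrix.one_mulVec]

/-- A function that is continuous on `[-a, a]`, as an element of `C[-a, a]`. -/
def _root_.SymmC.ofContinuousOn {E : Type*} [TopologicalSpace E] {f : ℝ → E}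
    (hf : ContinuousOn f (Icc (-a) a)) : SymmC a E :=
  ⟨(Icc (-a) a).domRestrict f, hf.domRestrict⟩

theorem _root_.SymmC.extend_ofContinuousOn {E : Type*} [TopologicalSpace E] {f : ℝ → E}
    (hf : ContinuousOn f (Icc (-a) a)) (ht : t ∈ Icc (-a) a) :
    (SymmC.ofContinuousOn hf).extend t = f t := SymmC.extend_apply _ ht

theorem truncPairing_eq (hpk : ∀ t ξ, p t ξ = (matCLM n).symm (k.dualSol a t ξ))
    (hf : ContinuousOn f (Icc (-a) a)) (hξ : ξ ∈ Icc 0 a) :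
    truncPairing p f ξ = k.pairing (SymmC.ofContinuousOn hf) ξ := by
  rw [truncPairing, pairing, intervalIntegral.integral_of_le (by linarith [hξ.1])]
  refine setIntegral_congr_fun measurableSet_Ioc fun s hs => ?_
  simp only [hpk, matCLM_symm_mulVec,
    SymmC.extend_ofContinuousOn hf (Icc_neg_subset hξ (Ioc_subset_Icc_self hs))]

theorem Regular.hasDerivWithinAt_truncPairing (hk : k.Regular a)
    (hpk : ∀ t ξ, p t ξ = (matCLM n).symm (k.dualSol a t ξ))
    (hf : ContinuousOn f (Icc (-a) a)) (hξ : ξ ∈ Icc 0 a) :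
    HasDerivWithinAt (truncPairing p f) (k.dualSol a ξ ξ
      ((k.resolvent a ξ (SymmC.ofContinuousOn hf)).extend ξ +
      (k.resolvent a ξ (SymmC.ofContinuousOn hf)).extend (-ξ))) (Icc 0 a) ξ :=
  (hk.hasDerivWithinAt_pairing _ hξ).congr (fun _ hη => truncPairing_eq hpk hf hη)
    (truncPairing_eq hpk hf hξ)

theorem Regular.kreinDensity_eq (hk : k.Regular a)
    (hqk : ∀ ξ ∈ Ioc 0 a, ∀ t ∈ Icc (-ξ) ξ, q t ξ = (matCLM n).symm (k.unitSol a t ξ))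
    (hpk : ∀ t ξ, p t ξ = (matCLM n).symm (k.dualSol a t ξ))
    (hf : ContinuousOn f (Icc (-a) a)) (hξ : ξ ∈ Icc 0 a) (hdet : (kreinM' a q ξ).det ≠ 0) :
    kreinDensity a q p f ξ = k.density a (SymmC.ofContinuousOn hf) ξ := by
  rw [kreinDensity, (hk.hasDerivWithinAt_truncPairing hpk hf hξ).derivWithin
    (uniqueDiffOn_Icc ha.out ξ hξ), hk.inv_kreinM'_mulVec hqk hξ hdet, density]

/-- The value of `∫_{-ξ}^{ξ} q*(s, ξ) df(s)`. -/
def stieltjesPairing (k : EvenKernel (Fin n → ℂ)) (g : SymmC a (Fin n → ℂ)) (ξ : ℝ) :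
    Fin n → ℂ :=
  k.dualSol a ξ ξ ((k.resolvent a ξ g).extend ξ - (k.resolvent a ξ g).extend (-ξ))

theorem Regular.hasStieltjesIntegral_dualSol (hk : k.Regular a)
    (hpk : ∀ t ξ, p t ξ = (matCLM n).symm (k.dualSol a t ξ))
    (hf : ContinuousOn f (Icc (-a) a)) (hξ : ξ ∈ Icc 0 a) :
    HasStieltjesIntegral (fun s => p s ξ) f (-ξ) ξ
      (k.stieltjesPairing (SymmC.ofContinuousOn hf) ξ) := by
  have key : HasRSIntegral (fun s => matCLM n (p s ξ)) f (-ξ) ξ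
      (k.stieltjesPairing (SymmC.ofContinuousOn hf) ξ) := by
    rcases hξ.1.eq_or_lt with rfl | h0
    · intro ε hε
      refine ⟨1, one_pos, fun N x τ hx0 hxN hp => ?_⟩
      have hmono : ∀ i < N, x i ≤ x (i + 1) := fun i hi => (hp i hi).1.trans (hp i hi).2.1
      have hx : ∀ i ≤ N, x i = 0 := fun i hi => le_antisymm
        (hxN ▸ le_of_forall_le_succ hmono hi le_rfl)
        (by simpa [hx0] using! le_of_forall_le_succ hmono (Nat.zero_le i) hi)
      rw [Finset.sum_eq_zero fun i hi => by
        have hi := Finset.mem_range.1 hi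
        rw [hx i hi.le, hx (i + 1) hi, sub_self, map_zero], stieltjesPairing, neg_zero, sub_self,
        map_zero, sub_zero, norm_zero]
      exact hε
    · refine (hk.hasRSIntegral_dualSol ⟨h0, hξ.2⟩ (SymmC.ofContinuousOn hf)).congr_Ioc
        (SymmC.continuous_extend _).continuousAt (fun s _ => ?_) fun s hs =>
          (SymmC.extend_ofContinuousOn hf (Icc_neg_subset hξ hs)).symm
      rw [hpk, AlgEquiv.apply_symm_apply]
  exact key

theorem Regular.eq_extend_resolvent_of_isSystemSol {H : ℝ → Matrix (Fin n) (Fin n) ℂ}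
    (hk : k.Regular a)
    (hkH : ∀ᵐ t, t ∈ Ioo (-2 * a) (2 * a) → k.toFun t = matCLM n (H t))
    (hf : ContinuousOn f (Icc (-a) a)) {ψ : ℝ → Fin n → ℂ} (hψ : IsSystemSol H a f ψ) :
    EqOn ψ (k.resolvent a a (SymmC.ofContinuousOn hf)).extend (Icc (-a) a) := by
  have haa : a ∈ Icc 0 a := ⟨ha.out.le, le_rfl⟩
  obtain ⟨C, hC⟩ := exists_bddMeas_indicator_Icc hψ.1
  intro t ht
  rw [← indicator_of_mem ht ψ]
  refine hk.eq_extend_resolvent haa hC (fun s hs => ?_) t ht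
  rw [truncConv_congr (v := ψ) fun r hr => indicator_of_mem (Ioc_subset_Icc_self hr) ψ,
    truncConv_eq_integral hkH hs haa, indicator_of_mem hs, hψ.2 s hs,
    SymmC.extend_ofContinuousOn hf hs]

theorem Regular.potential_integrand_eq (hk : k.Regular a)
    (hqk : ∀ ξ ∈ Ioc 0 a, ∀ t ∈ Icc (-ξ) ξ, q t ξ = (matCLM n).symm (k.unitSol a t ξ))
    (hdet : ∀ ξ ∈ Icc 0 a, (kreinM' a q ξ).det ≠ 0) (g : SymmC a (Fin n → ℂ))
    (hξ : ξ ∈ Ioc |t| a) :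
    q t ξ *ᵥ ((kreinM' a q ξ)⁻¹ *ᵥ k.stieltjesPairing g ξ) =
      k.unitSol a t ξ (k.diagInv a ξ
        ((k.resolvent a ξ g).extend ξ - (k.resolvent a ξ g).extend (-ξ))) := by
  have h0 : 0 < ξ := (abs_nonneg t).trans_lt hξ.1
  rw [hqk ξ ⟨h0, hξ.2⟩ t (abs_le.1 hξ.1.le), stieltjesPairing,
    hk.inv_kreinM'_mulVec hqk ⟨h0.le, hξ.2⟩ (hdet ξ ⟨h0.le, hξ.2⟩), matCLM_symm_mulVec]

theorem Regular.intervalIntegrable_potential (hk : k.Regular a)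
    (hqk : ∀ ξ ∈ Ioc 0 a, ∀ t ∈ Icc (-ξ) ξ, q t ξ = (matCLM n).symm (k.unitSol a t ξ))
    (hdet : ∀ ξ ∈ Icc 0 a, (kreinM' a q ξ).det ≠ 0) (g : SymmC a (Fin n → ℂ))
    (ht : t ∈ Icc (-a) a) :
    IntervalIntegrable (fun ξ => q t ξ *ᵥ ((kreinM' a q ξ)⁻¹ *ᵥ k.stieltjesPairing g ξ))
      volume |t| a := by
  have hc : Continuous fun ξ => k.unitSol a t ξ (k.diagInv a ξ
      ((k.resolvent a ξ g).extend ξ - (k.resolvent a ξ g).extend (-ξ))) :=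
    (hk.continuous_unitSol continuous_const continuous_id).clm_apply
      ((hk.continuous_diagInv fun ξ hξ => hk.isUnit_unitSol hqk hξ (hdet ξ hξ)).clm_apply
        ((hk.continuous_sol g continuous_id continuous_id).sub
          (hk.continuous_sol g continuous_neg continuous_id)))
  refine (hc.intervalIntegrable _ _).congr fun ξ hξ => ?_
  rw [uIoc_of_le (abs_le.2 ht)] at hξ
  exact (hk.potential_integrand_eq hqk hdet g hξ).symm

theorem Regular.kreinPotential_eq (hk : k.Regular a)
    (hqk : ∀ ξ ∈ Ioc 0 a, ∀ t ∈ Icc (-ξ) ξ, q t ξ = (matCLM n).symm (k.unitSol a t ξ))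
    (hdet : ∀ ξ ∈ Icc 0 a, (kreinM' a q ξ).det ≠ 0) (g : SymmC a (Fin n → ℂ))
    (ht : t ∈ Icc (-a) a) :
    kreinPotential a q (k.stieltjesPairing g) t =
      ∫ s in t..a, ((k.resolvent a a g).extend s - (k.resolvent a a g).extend (-s)) := by
  rw [← hk.integral_unitSol_diagInv_sub
    (fun ξ hξ => hk.isUnit_unitSol hqk hξ (hdet ξ hξ)) g ht, kreinPotential,
    intervalIntegral.integral_of_le (abs_le.2 ht), intervalIntegral.integral_of_le (abs_le.2 ht)]
  exact setIntegral_congr_fun measurableSet_Ioc fun ξ hξ =>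
    hk.potential_integrand_eq hqk hdet g hξ

theorem Regular.hasDerivWithinAt_kreinPotential (hk : k.Regular a)
    (hqk : ∀ ξ ∈ Ioc 0 a, ∀ t ∈ Icc (-ξ) ξ, q t ξ = (matCLM n).symm (k.unitSol a t ξ))
    (hdet : ∀ ξ ∈ Icc 0 a, (kreinM' a q ξ).det ≠ 0) (g : SymmC a (Fin n → ℂ))
    (ht : t ∈ Icc (-a) a) :
    HasDerivWithinAt (kreinPotential a q (k.stieltjesPairing g))
      (-((k.resolvent a a g).extend t - (k.resolvent a a g).extend (-t))) (Icc (-a) a) t := by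
  have hc : Continuous fun s => (k.resolvent a a g).extend s - (k.resolvent a a g).extend (-s) :=
    (SymmC.continuous_extend _).sub ((SymmC.continuous_extend _).comp continuous_neg)
  refine ((hc.integral_hasStrictDerivAt a t).hasDerivAt.neg.hasDerivWithinAt).congr
    (fun s hs => ?_) ?_
  · rw [hk.kreinPotential_eq hqk hdet g hs, intervalIntegral.integral_symm]
    rfl
  · rw [hk.kreinPotential_eq hqk hdet g ht, intervalIntegral.integral_symm]
    rfl

/-- The integrand is prescribed only for ξ > |t|, because q(0, 0) is arbitrary. Continuity of the
density at |t| makes the left end point harmless. -/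
theorem Regular.hasRSIntegral_kreinDensity (hk : k.Regular a)
    (hqk : ∀ ξ ∈ Ioc 0 a, ∀ t ∈ Icc (-ξ) ξ, q t ξ = (matCLM n).symm (k.unitSol a t ξ))
    (hpk : ∀ t ξ, p t ξ = (matCLM n).symm (k.dualSol a t ξ))
    (hdet : ∀ ξ ∈ Icc 0 a, (kreinM' a q ξ).det ≠ 0)
    (hf : ContinuousOn f (Icc (-a) a)) (ht : t ∈ Icc (-a) a) (g : ℝ → _)
    (hg : ∀ ξ ∈ Ioc |t| a, g ξ = k.unitSol a t ξ) :
    HasRSIntegral g (kreinDensity a q p f) |t| a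
      (k.unitSol a t a (k.density a (SymmC.ofContinuousOn hf) a) -
        ((k.resolvent a a (SymmC.ofContinuousOn hf)).extend t +
          (k.resolvent a a (SymmC.ofContinuousOn hf)).extend (-t))) := by
  have hu := fun ξ hξ => hk.isUnit_unitSol hqk hξ (hdet ξ hξ)
  refine (hk.hasRSIntegral_density hu _ ht).congr_Ioc
    (hk.continuous_density hu _).continuousAt hg fun ξ hξ => ?_
  have hξ' : ξ ∈ Icc 0 a := ⟨(abs_nonneg t).trans hξ.1, hξ.2⟩
  exact hk.kreinDensity_eq hqk hpk hf hξ' (hdet ξ hξ')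

end EvenKernel

end

theorem theorem4p2 (n : ℕ) (a : ℝ) (ha : 0 < a)
    (H : ℝ → Matrix (Fin n) (Fin n) ℂ)
    (hH : ∀ i j, IntegrableOn (fun t => H t i j) (Ioo (-2 * a) (2 * a)) volume)
    (heven : ∀ᵐ t ∂(volume.restrict (Ioo (-2 * a) (2 * a))), H (-t) = H t)
    (q : ℝ → ℝ → Matrix (Fin n) (Fin n) ℂ)
    (hq : ∀ ξ ∈ Ioc 0 a, IsTruncatedSol H ξ (fun t => q t ξ))
    (hq_unique : ∀ ξ ∈ Ioc 0 a, ∀ Q : ℝ → Matrix (Fin n) (Fin n) ℂ,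
      IsTruncatedSol H ξ Q → EqOn Q (fun t => q t ξ) (Icc (-ξ) ξ))
    (hdet : ∀ ξ ∈ Icc 0 a, (kreinM' a q ξ).det ≠ 0) :
    -- `M` really is differentiable
    (∀ ξ ∈ Icc 0 a, ∀ i j,
      DifferentiableWithinAt ℝ (fun η => kreinM q η i j) (Icc 0 a) ξ) ∧
    -- the transposed equation has a unique solution `p = q*` as well
    ∃ p : ℝ → ℝ → Matrix (Fin n) (Fin n) ℂ,
      (∀ ξ ∈ Ioc 0 a, IsTruncatedSolStar H ξ (fun t => p t ξ) ∧
        ∀ Q : ℝ → Matrix (Fin n) (Fin n) ℂ,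
          IsTruncatedSolStar H ξ Q → EqOn Q (fun t => p t ξ) (Icc (-ξ) ξ)) ∧
      ∀ f : ℝ → Fin n → ℂ, ContinuousOn f (Icc (-a) a) →
        ∃ φ : ℝ → Fin n → ℂ,
          -- `φ` is the unique continuous solution
          IsSystemSol H a f φ ∧
          (∀ ψ : ℝ → Fin n → ℂ, IsSystemSol H a f ψ → EqOn ψ φ (Icc (-a) a)) ∧
          -- all derivatives and integrals in the formula exist, and the formula holds
          (∀ ξ ∈ Icc 0 a, DifferentiableWithinAt ℝ (truncPairing p f) (Icc 0 a) ξ) ∧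
          ∃ S : ℝ → Fin n → ℂ,
            (∀ ξ ∈ Icc 0 a, HasStieltjesIntegral (fun s => p s ξ) f (-ξ) ξ (S ξ)) ∧
            ∀ t ∈ Icc (-a) a,
              IntervalIntegrable (fun ξ => q t ξ *ᵥ ((kreinM' a q ξ)⁻¹ *ᵥ S ξ)) volume |t| a ∧
              DifferentiableWithinAt ℝ (kreinPotential a q S) (Icc (-a) a) t ∧
              ∃ J : Fin n → ℂ,
                HasStieltjesIntegral (fun ξ => q t ξ) (kreinDensity a q p f) |t| a J ∧
                -- the first integral is the ordinary one as soon as that makes sense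
                (AbsolutelyContinuousOnInterval (kreinDensity a q p f) 0 a →
                  IntervalIntegrable
                    (fun ξ => q t ξ *ᵥ deriv (kreinDensity a q p f) ξ) volume |t| a ∧
                  J = ∫ ξ in |t|..a, q t ξ *ᵥ deriv (kreinDensity a q p f) ξ) ∧
                φ t = (1 / 2 : ℂ) • (q t a *ᵥ kreinDensity a q p f a)
                  - (1 / 2 : ℂ) • J
                  - (1 / 2 : ℂ) • derivWithin (kreinPotential a q S) (Icc (-a) a) t := by
  have : Fact (0 < a) := ⟨ha⟩
  have hkH := symmKernel_ae_eq hH heven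
  set k := symmKernel H hH
  have hk : k.Regular a := EvenKernel.regular_of_unique hkH hq hq_unique
  have hqk : ∀ ξ ∈ Ioc 0 a, ∀ t ∈ Icc (-ξ) ξ, q t ξ = (matCLM n).symm (k.unitSol a t ξ) :=
    fun ξ hξ t ht =>
      hk.eq_unitSol_of_isTruncatedSol hkH (Ioc_subset_Icc_self hξ) (hq ξ hξ) ht
  have haa : a ∈ Icc 0 a := ⟨ha.le, le_rfl⟩
  have hud : UniqueDiffOn ℝ (Icc (-a) a) := uniqueDiffOn_Icc (by linarith)
  refine ⟨fun ξ hξ i j => (hk.hasDerivWithinAt_kreinM hqk hξ i j).differentiableWithinAt,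
    fun t ξ => (matCLM n).symm (k.dualSol a t ξ), fun ξ hξ =>
      ⟨hk.isTruncatedSolStar_dualSol hkH (Ioc_subset_Icc_self hξ), fun Q hQ t ht =>
        hk.eq_dualSol_of_isTruncatedSolStar hkH (Ioc_subset_Icc_self hξ) hQ t ht⟩, fun f hf => ?_⟩
  set p : ℝ → ℝ → Matrix (Fin n) (Fin n) ℂ := fun t ξ => (matCLM n).symm (k.dualSol a t ξ)
  have hpk : ∀ t ξ, p t ξ = (matCLM n).symm (k.dualSol a t ξ) := fun _ _ => rfl
  set g := SymmC.ofContinuousOn hf with hg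
  refine ⟨(k.resolvent a a g).extend, ⟨(SymmC.continuous_extend _).continuousOn, fun t ht => ?_⟩,
    fun ψ hψ t ht => ?_, fun ξ hξ =>
      (hk.hasDerivWithinAt_truncPairing hpk hf hξ).differentiableWithinAt,
    k.stieltjesPairing g, fun ξ hξ => hk.hasStieltjesIntegral_dualSol hpk hf hξ, fun t ht =>
      ⟨hk.intervalIntegrable_potential hqk hdet g ht,
        (hk.hasDerivWithinAt_kreinPotential hqk hdet g ht).differentiableWithinAt, _,
        hk.hasRSIntegral_kreinDensity hqk hpk hdet hf ht (fun ξ => matCLM n (q t ξ))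
          fun ξ hξ => ?_, fun hac => ?_, ?_⟩⟩
  · rw [← EvenKernel.truncConv_eq_integral hkH ht haa, hk.extend_resolvent_add haa g ht, hg,
      SymmC.extend_ofContinuousOn hf ht]
  · exact hk.eq_extend_resolvent_of_isSystemSol hkH hf hψ ht
  · rw [hqk ξ ⟨(abs_nonneg t).trans_lt hξ.1, hξ.2⟩ t (abs_le.1 hξ.1.le),
      AlgEquiv.apply_symm_apply]
  · have h := (hk.hasRSIntegral_kreinDensity hqk hpk hdet hf ht (fun ξ => k.unitSol a t ξ)
      fun ξ hξ => rfl).eq_integral_deriv (abs_le.2 ht)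
      (hk.continuous_unitSol continuous_const continuous_id)
      (hac.mono (by
        rw [uIcc_of_le (abs_le.2 ht), uIcc_of_le ha.le]
        exact Icc_subset_Icc_left (abs_nonneg t)))
    have he : ∀ ξ ∈ Ioc |t| a, k.unitSol a t ξ (deriv (kreinDensity a q p f) ξ)
        = q t ξ *ᵥ deriv (kreinDensity a q p f) ξ := fun ξ hξ => by
      rw [hqk ξ ⟨(abs_nonneg t).trans_lt hξ.1, hξ.2⟩ t (abs_le.1 hξ.1.le), matCLM_symm_mulVec]
    refine ⟨h.1.congr fun ξ hξ => he ξ (by rwa [uIoc_of_le (abs_le.2 ht)] at hξ), h.2.trans ?_⟩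
    rw [intervalIntegral.integral_of_le (abs_le.2 ht), intervalIntegral.integral_of_le (abs_le.2 ht)]
    exact setIntegral_congr_fun measurableSet_Ioc he
  · rw [(hk.hasDerivWithinAt_kreinPotential hqk hdet g ht).derivWithin (hud t ht),
      hqk a ⟨ha, le_rfl⟩ t ht, matCLM_symm_mulVec, hk.kreinDensity_eq hqk hpk hf haa (hdet a haa)]
    -- With ψ = ψ_a: ½ qF(a) - ½ (qF(a) - ψ(t) - ψ(-t)) + ½ (ψ(t) - ψ(-t)) = ψ(t).
    module
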